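/- **Setting.** Let $1\le N<M$ be integers and let $\hat A$ be the normalized banded matrix of a point of the totally positive Grassmannian $Gr^{TP}(N,M)$: $\hat A$ is a real $N\times M$ matrix with all maximal minors positive, $\hat A^i_j=0$ for $j<i$ and for $j>M-N+i$, and all row sums equal to $1$. Let $k_1<\dots<k_M$ be real. Let $\vec t=(t_1=x,t_2,t_3,\dots)$ be real times for which $\theta(\lambda,\vec t)=\sum_{n\ge1}\lambda^nt_n$ converges for all $\lambda$, put $f^{(i)}(\vec t)=\sum_j\hat A^i_j e^{\theta(k_j,\vec t)}$ and let $D=\partial_x^N-w_1(\vec t)\partial_x^{N-1}-\dots-w_N(\vec t)$ be the Darboux operator, determined by $Df^{(i)}=0$ for $i=1,\dots,N$. *The curve.* For $\xi>1$ put $\lambda_1=0$, $\lambda_l=-\xi^{2(l-2)}$ and $\alpha_l=\xi^{2l-5}$ for $2\le l\le M-N+1$, and $\alpha_1=\lambda_1$; write $\lambda^{(r)}_l,\alpha^{(r)}_l$ for these points on a copy $\Gamma_r$ of $\mathbb{CP}^1$, $1\le r\le N$. Let $\Gamma$ be obtained from $N+1$ copies $\Gamma_0,\dots,\Gamma_N$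 of $\mathbb{CP}^1$ by gluing, in pairs, $\lambda^{(r)}_1\in\Gamma_r$ to $k_{N-r+1}\in\Gamma_0$ for $1\le r\le N$, and, for $2\le l\le M-N+1$, $\lambda^{(1)}_l$ to $k_{N+l-1}\in\Gamma_0$ and $\lambda^{(r)}_l$ to $\alpha^{(r-1)}_l\in\Gamma_{r-1}$ for $2\le r\le N$. *The ovals.* The finite ovals $\Omega_{r,n}$, $1\le r\le N$, $1\le n\le M-N$, are the images in $\Gamma$ of: $[\lambda^{(1)}_{n+1},\lambda^{(1)}_n]\cup[k_{N+n-1},k_{N+n}]$ for $r=1$; $[\lambda^{(r)}_{n+1},\lambda^{(r)}_n]\cup[\alpha^{(r-1)}_n,\alpha^{(r-1)}_{n+1}]$ for $r\ge2$, $n\ge 2$; and for $r\ge2$, $n=1$ the same together with $[k_{N-r+1},k_{N-r+2}]\subset\Gamma_0$. The infinite oval $\Omega_0$ is the image of the points at infinity of all sheets and of the real points outside $]k_1,k_M[$ on $\Gamma_0$, outside $]\lambda^{(r)}_{M-N+1},\alpha^{(r)}_{M-N+1}[$ on $\Gamma_r$ for $1\le r<N$, and outside $]\lambda^{(N)}_{M-N+1},\lambda^{(N)}_1[$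 on $\Gamma_N$. *The vacuum wave function.* A vacuum wave function $\Psi(P,\vec t)$ on $\Gamma$ takes equal values at glued points for all $\vec t$ and satisfies: $\Psi=e^{\theta(\lambda,\vec t)}$ on $\Gamma_0$; on each $\Gamma_r$, $r\ge1$, $\Psi$ is real and meromorphic in $\lambda$, with at most simple poles, all at points $b^{(r)}_n\in\,]\lambda^{(r)}_{n+1},\lambda^{(r)}_n[$, $1\le n\le M-N$, independent of $\vec t$; its value at the point at infinity of $\Gamma_r$ is $\bigl(f^{(N-r+1)}+\sum_{i>N-r+1}\epsilon^{(r)}_if^{(i)}\bigr)\big/\bigl(1+\sum_{i>N-r+1}\epsilon^{(r)}_i\bigr)$ for some real constants $\epsilon^{(r)}_i$. **Theorem.** There is $\xi_0>1$, depending only on $N$, $M$ and $\hat A$, such that for all $\xi>\xi_0$ and all $k_1<\dots<k_M$ a vacuum wave function exists, and for every vacuum wave function $\Psi$ (with $D$ indeed annihilating every $f^{(i)}$) the following holds. For every $\vec t$ there are finite multisets $\mathcal D^{(r)}(\vec t)\subset\mathbb C$, $0\le r\le N$, such that $D\Psi=\prod_{\gamma\in\mathcal D^{(0)}(\vec t)}(\lambda-\gamma)\,e^{\theta(\lambda,\vec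 t)}$ on $\Gamma_0$ and, for $r\ge1$, $D\Psi$ on $\Gamma_r$ is a nonzero real constant (depending on $\vec t$) times $\prod_{\gamma\in\mathcal D^{(r)}(\vec t)}(\lambda-\gamma)\big/\prod_n(\lambda-b^{(r)}_n)$. Consequently the normalized wave function $\tilde\Psi(P,\vec t)=D\Psi(P,\vec t)/D\Psi(P,\vec 0)$ has zero divisor $\mathcal D(\vec t)=\bigcup_r\mathcal D^{(r)}(\vec t)$ and (Krichever) pole divisor $\mathcal D=\mathcal D(\vec 0)$, common points cancelling. For every $\vec t$: 1. $\Gamma_0$ contains exactly $N$ points of $\mathcal D(\vec t)$; 2. each $\Gamma_r$, $1\le r\le N$, contains exactly $M-N-1$ points of $\mathcal D(\vec t)$; 3. the points of $\mathcal D(\vec t)$ lying on the same $\Gamma_r$ are pairwise different; 4. $\mathcal D(\vec t)\cap\Omega_0=\emptyset$; 5. every point of $\mathcal D(\vec t)$ is real and lies in some finite oval; 6. each finite oval contains exactly one point of $\mathcal D(\vec t)$ according to the counting rule: if a divisor point lies at a double point of $\Gamma$, then there is a divisor point on each of its two branches, and the two are assigned to the two different ovals through the double point; every other divisor point is assigned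 to the oval on which it lies. In particular the Krichever divisor $\mathcal D=\mathcal D(\vec 0)$ has properties 4–6 (the Dubrovin–Natanzon position): exactly one point in each finite oval and none in the infinite oval. -/

import Mathlib

open Filter Topology Polynomial

noncomputable section

namespace KPSoliton

/-! ### Times and phases -/

/-- A sequence of real KP times `(t₁, t₂, t₃, …)`, with `t n` standing for `t_{n+1}`, for which the
phase `θ(z, t) = ∑ zⁿ tₙ` is an entire function of `z`. Every finitely supported sequence is one. -/
abbrev Times : Type :=
  {t : ℕ → ℝ // ∀ x : ℝ, Summable fun n : ℕ => x ^ (n + 1) * t n}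

/-- All times equal to zero. -/
def zeroTimes : Times := ⟨fun _ => 0, fun x => by simp⟩

/-- The time sequence with its first entry `t₁ = x` replaced by `x`. -/
def Times.withX (t : Times) (x : ℝ) : Times :=
  ⟨Function.update t.1 0 x, fun y => by
    have h := t.2 y
    rw [← summable_nat_add_iff 1] at h ⊢
    simpa using h⟩

/-- The phase `θ(z, t) = ∑_{n ≥ 1} zⁿ tₙ` at a real or complex point `z`. -/
def theta {𝕜 : Type} [RCLike 𝕜] (z : 𝕜) (t : Times) : 𝕜 :=
  ∑' n : ℕ, z ^ (n + 1) * ((t.1 n : ℝ) : 𝕜)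

variable {N M : ℕ}

/-! ### The matrix, the heat hierarchy solutions and the Darboux operator -/

/-- `A` is the normalized banded matrix representing a point of the totally positive
Grassmannian: it vanishes outside the band `i ≤ j ≤ i + M - N`, all its maximal minors are strictly
positive and each of its rows sums to one. -/
structure IsNormalizedBanded (A : Matrix (Fin N) (Fin M) ℝ) : Prop where
  band : ∀ i j, (j.val < i.val ∨ i.val + (M - N) < j.val) → A i j = 0
  minor_pos : ∀ s : Fin N → Fin M, StrictMono s → 0 < (A.submatrix id s).det
  row_sum : ∀ i, ∑ j, A i j = 1

/-- The heat hierarchy solution `f⁽ⁱ⁾(t) = ∑_j Aⁱ_j exp θ(k_j, t)` attached to row `i`. -/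
def heat (A : Matrix (Fin N) (Fin M) ℝ) (k : Fin M → ℝ) (i : Fin N) (t : Times) : ℝ :=
  ∑ j, A i j * Real.exp (theta (k j) t)

/-- The `n`-th derivative in `x = t₁` of a function of the times. -/
def dx {F : Type} [NormedAddCommGroup F] [NormedSpace ℝ F] (n : ℕ) (g : Times → F) (t : Times) :
    F :=
  iteratedDeriv n (fun x : ℝ => g (t.withX x)) (t.1 0)

/-- The matrix with entries `∂_x^{N-1-j} f⁽ⁱ⁾` (`j = 0, …, N-1`), whose determinant is up to sign the
Wronskian of `f⁽¹⁾, …, f⁽ᴺ⁾`. -/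
def wronskianMatrix (A : Matrix (Fin N) (Fin M) ℝ) (k : Fin M → ℝ) (t : Times) :
    Matrix (Fin N) (Fin N) ℝ :=
  Matrix.of fun i j => dx (N - 1 - j.val) (heat A k i) t

/-- The coefficients `w₁, …, w_N` (with `w j` standing for `w_{j+1}`) of the Darboux operator: the
solution of the linear system `∂_x^N f⁽ⁱ⁾ = ∑_j w_j ∂_x^{N-j} f⁽ⁱ⁾`, `i = 1, …, N`. -/
def darbouxCoeff (A : Matrix (Fin N) (Fin M) ℝ) (k : Fin M → ℝ) (t : Times) : Fin N → ℝ :=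
  (wronskianMatrix A k t)⁻¹.mulVec fun i => dx N (heat A k i) t

/-- The Darboux operator `D = ∂_x^N - w₁ ∂_x^{N-1} - ⋯ - w_N`, applied to a function of the times. -/
def darboux (A : Matrix (Fin N) (Fin M) ℝ) (k : Fin M → ℝ) (g : Times → ℂ) (t : Times) : ℂ :=
  dx N g t - ∑ j : Fin N, (darbouxCoeff A k t j : ℂ) * dx (N - 1 - j.val) g t

/-! ### The curve

The sheets `Γ_0, …, Γ_N` are copies of the Riemann sphere `OnePoint ℂ`. Sheet `Γ_R` with
`R = 1, …, N` is written `Fin.succ r` with `r = R - 1 : Fin N`. The argument `l` of `lam` and `alp`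
is the 1-based index of the marked points. -/

/-- The marked points `λ₁ = 0`, `λ_l = -ξ^{2(l-2)}` (`l ≥ 2`) of each sheet `Γ_1, …, Γ_N`. -/
def lam (ξ : ℝ) (l : ℕ) : ℝ := if l ≤ 1 then 0 else -ξ ^ (2 * (l - 2))

/-- The marked points `α_s = ξ^{2s-5}` (`s ≥ 2`) of each sheet `Γ_1, …, Γ_N`, with the convention
`α₁ = λ₁ = 0`. -/
def alp (ξ : ℝ) (s : ℕ) : ℝ := if s ≤ 1 then 0 else ξ ^ (2 * (s : ℤ) - 5)

/-- The pairs of marked real points, given as (sheet, coordinate), that are glued together: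
`λ₁` on `Γ_r` with `k_{N-r+1}` on `Γ_0`; `λ_l` on `Γ_1` with `k_{N+l-1}` on `Γ_0`; and `λ_l` on `Γ_r`
with `α_l` on `Γ_{r-1}` (`2 ≤ r ≤ N`), for `2 ≤ l ≤ M-N+1`. The family `k` is indexed from `0`. -/
inductive Glued (k : Fin M → ℝ) (ξ : ℝ) : Fin (N + 1) × ℝ → Fin (N + 1) × ℝ → Prop
  | first (r : Fin (N + 1)) (j : Fin M) (hr : 1 ≤ r.val) (hj : j.val + r.val = N) :
      Glued k ξ (r, lam ξ 1) (0, k j)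
  | one (r : Fin (N + 1)) (l : ℕ) (j : Fin M) (hr : r.val = 1) (hl : 2 ≤ l)
      (hj : j.val + 2 = N + l) :
      Glued k ξ (r, lam ξ l) (0, k j)
  | step (r s : Fin (N + 1)) (l : ℕ) (hs : 1 ≤ s.val) (hr : r.val = s.val + 1) (hl : 2 ≤ l)
      (hl' : l ≤ M - N + 1) :
      Glued k ξ (r, lam ξ l) (s, alp ξ l)

/-- A finite complex point of a sheet, as a point of the disjoint union of the sheets. -/
def sheetPoint (r : Fin (N + 1)) (z : ℂ) : Fin (N + 1) × OnePoint ℂ := (r, (z : OnePoint ℂ))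

/-- A real point of a sheet, as a point of the disjoint union of the sheets. -/
def realPoint (p : Fin (N + 1) × ℝ) : Fin (N + 1) × OnePoint ℂ := sheetPoint p.1 (p.2 : ℂ)

/-- The curve `Γ = Γ_0 ⊔ ⋯ ⊔ Γ_N` with the marked points glued in pairs. -/
def Curve (N : ℕ) (k : Fin M → ℝ) (ξ : ℝ) : Type :=
  Quot (Relation.Map (Glued (N := N) k ξ) realPoint realPoint)

/-- The projection of the disjoint union of the sheets onto `Γ`. -/
def toCurve (k : Fin M → ℝ) (ξ : ℝ) (p : Fin (N + 1) × OnePoint ℂ) : Curve N k ξ := Quot.mk _ p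

/-- The real points of the sheets that lie on the finite oval `Ω_{r,n}`; here `(r, n)` is indexed
from `0`, so the oval below is `Ω_{r+1,n+1}` in 1-based notation. It consists of
`[λ_{n+2}, λ_{n+1}]` on its own sheet; of an interval `[k_i, k_{i+1}]` on `Γ_0` if it is attached to
`Γ_1` or if `n = 0`; and of `[α_{n+1}, α_{n+2}]` on the preceding sheet if that is not `Γ_0`. -/
inductive OnFiniteOval (k : Fin M → ℝ) (ξ : ℝ) :
    Fin N × Fin (M - N) → Fin (N + 1) × ℝ → Prop
  | own (r : Fin N) (n : Fin (M - N)) (x : ℝ)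
      (hx : x ∈ Set.Icc (lam ξ (n.val + 2)) (lam ξ (n.val + 1))) :
      OnFiniteOval k ξ (r, n) (r.succ, x)
  | vacuumFirst (r : Fin N) (n : Fin (M - N)) (i j : Fin M) (x : ℝ) (hr : r.val = 0)
      (hi : i.val + 1 = N + n.val) (hj : j.val = i.val + 1) (hx : x ∈ Set.Icc (k i) (k j)) :
      OnFiniteOval k ξ (r, n) (0, x)
  | vacuumNext (r : Fin N) (n : Fin (M - N)) (i j : Fin M) (x : ℝ) (hr : 1 ≤ r.val)
      (hn : n.val = 0) (hi : i.val + r.val + 1 = N) (hj : j.val = i.val + 1)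
      (hx : x ∈ Set.Icc (k i) (k j)) :
      OnFiniteOval k ξ (r, n) (0, x)
  | previous (r : Fin N) (n : Fin (M - N)) (x : ℝ) (hr : 1 ≤ r.val)
      (hx : x ∈ Set.Icc (alp ξ (n.val + 1)) (alp ξ (n.val + 2))) :
      OnFiniteOval k ξ (r, n) (r.castSucc, x)

/-- The finite ovals of `Γ`. -/
def finiteOval (k : Fin M → ℝ) (ξ : ℝ) (o : Fin N × Fin (M - N)) : Set (Curve N k ξ) :=
  (fun p => toCurve k ξ (realPoint p)) '' {p | OnFiniteOval k ξ o p}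

/-- The finite real points of the sheets that lie on the infinite oval: the points of `Γ_0` outside
`]k_1, k_M[`, the points of `Γ_r` (`1 ≤ r < N`) outside `]λ_{M-N+1}, α_{M-N+1}[` and the points of
`Γ_N` outside `]λ_{M-N+1}, λ_1[`. -/
inductive OnInfiniteOval (k : Fin M → ℝ) (ξ : ℝ) : Fin (N + 1) × ℝ → Prop
  | vacuum (x : ℝ) (hx : (∀ j, x ≤ k j) ∨ ∀ j, k j ≤ x) : OnInfiniteOval k ξ (0, x)
  | left (r : Fin N) (x : ℝ) (hx : x ≤ lam ξ (M - N + 1)) : OnInfiniteOval k ξ (r.succ, x)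
  | right (r : Fin N) (x : ℝ) (hr : r.val + 1 < N) (hx : alp ξ (M - N + 1) ≤ x) :
      OnInfiniteOval k ξ (r.succ, x)
  | rightLast (r : Fin N) (x : ℝ) (hr : r.val + 1 = N) (hx : lam ξ 1 ≤ x) :
      OnInfiniteOval k ξ (r.succ, x)

/-- The infinite oval `Ω_0`, which also contains the points at infinity `P_0, Q_1, …, Q_N` of all
the sheets. -/
def infiniteOval (k : Fin M → ℝ) (ξ : ℝ) : Set (Curve N k ξ) :=
  (fun p => toCurve k ξ (realPoint p)) '' {p | OnInfiniteOval k ξ p} ∪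
    Set.range fun r : Fin (N + 1) => toCurve k ξ (r, OnePoint.infty)

/-! ### The vacuum wave function -/

/-- `Ψ r z t` is the value at the point with coordinate `z` of sheet `Γ_r` of a vacuum wave function
on the curve, with pole divisor `b` (`b r n`, indexed from `0`, is `b^{(r+1)}_{n+1}`); its values at
the points of `b` are irrelevant. The row of `A` attached to sheet `r.succ` is `Fin.rev r`, that is,
row `N - R + 1` for `R = r + 1` in 1-based notation. The numbers `ε` may have any size and sign. -/
structure IsVacuumWave (A : Matrix (Fin N) (Fin M) ℝ) (k : Fin M → ℝ) (ξ : ℝ)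
    (b : Fin N → Fin (M - N) → ℝ) (Ψ : Fin (N + 1) → ℂ → Times → ℂ) : Prop where
  /-- On `Γ_0` it is Sato's vacuum wave function. -/
  sato : ∀ z t, Ψ 0 z t = Complex.exp (theta z t)
  /-- Each pole lies in the prescribed interval, independently of the times. -/
  pole_mem : ∀ r n, b r n ∈ Set.Ioo (lam ξ (n.val + 2)) (lam ξ (n.val + 1))
  /-- On `Γ_r` with `r ≥ 1` it is meromorphic and real, with at most simple poles, all in `b`. -/
  meromorphic : ∀ r t, ∃ p : ℝ[X], p.natDegree ≤ M - N ∧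
    ∀ z : ℂ, (∀ n, z ≠ b r n) → Ψ r.succ z t = aeval z p / ∏ n, (z - b r n)
  /-- The value at the point at infinity `Q_r`. -/
  at_infinity : ∀ r : Fin N, ∃ ε : Fin N → ℝ, 1 + ∑ i ∈ Finset.Ioi r.rev, ε i ≠ 0 ∧
    ∀ t, Tendsto (fun z => Ψ r.succ z t) (Bornology.cobounded ℂ)
      (𝓝 (((heat A k r.rev t + ∑ i ∈ Finset.Ioi r.rev, ε i * heat A k i t) /
        (1 + ∑ i ∈ Finset.Ioi r.rev, ε i) : ℝ) : ℂ))
  /-- The values at glued points agree at all times. -/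
  glue : ∀ p q, Glued k ξ p q → ∀ t, Ψ p.1 p.2 t = Ψ q.1 q.2 t

/-! ### The divisor after the Darboux transformation -/

/-- The function `DΨ`. -/
def dressed (A : Matrix (Fin N) (Fin M) ℝ) (k : Fin M → ℝ) (Ψ : Fin (N + 1) → ℂ → Times → ℂ)
    (r : Fin (N + 1)) (z : ℂ) (t : Times) : ℂ :=
  darboux A k (Ψ r z) t

/-- The normalized wave function `Ψ̃(P, t) = DΨ(P, t) / DΨ(P, 0)`. -/
def normalized (A : Matrix (Fin N) (Fin M) ℝ) (k : Fin M → ℝ) (Ψ : Fin (N + 1) → ℂ → Times → ℂ)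
    (r : Fin (N + 1)) (z : ℂ) (t : Times) : ℂ :=
  dressed A k Ψ r z t / dressed A k Ψ r z zeroTimes

/-- The monic polynomial function `z ↦ ∏ (z - γ)` with the given multiset of roots. -/
def rootProd (S : Multiset ℂ) (z : ℂ) : ℂ := (S.map fun γ => z - γ).prod

/-- `D t r` is the multiset of the divisor points `γ` on `Γ_r` at times `t`: the divisor of zeros of
`DΨ` other than the fixed zeros `Q_1, …, Q_N`. On `Γ_0` we have `DΨ = ∏ (z - γ) e^θ`. On `Γ_r`,
`r ≥ 1`, the function `DΨ` is a nonzero constant times `∏ (z - γ) / ∏ (z - b)`. This determines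
every `D t r`. -/
structure IsDivisor (A : Matrix (Fin N) (Fin M) ℝ) (k : Fin M → ℝ) (b : Fin N → Fin (M - N) → ℝ)
    (Ψ : Fin (N + 1) → ℂ → Times → ℂ) (D : Times → Fin (N + 1) → Multiset ℂ) : Prop where
  sheet_zero : ∀ t z, dressed A k Ψ 0 z t = rootProd (D t 0) z * Complex.exp (theta z t)
  sheet_succ : ∀ t r, ∃ R : ℝ, R ≠ 0 ∧ ∀ z : ℂ, (∀ n, z ≠ b r n) →
    dressed A k Ψ r.succ z t = R * rootProd (D t r.succ) z / ∏ n, (z - b r n)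

/-- The normalized wave function has zero divisor `Z t` and pole divisor `P`, the latter independent
of the times (a point common to both divisors cancels). -/
structure HasZerosPoles (A : Matrix (Fin N) (Fin M) ℝ) (k : Fin M → ℝ)
    (b : Fin N → Fin (M - N) → ℝ) (Ψ : Fin (N + 1) → ℂ → Times → ℂ)
    (Z : Times → Fin (N + 1) → Multiset ℂ) (P : Fin (N + 1) → Multiset ℂ) : Prop where
  sheet_zero : ∀ t z, z ∉ P 0 →
    normalized A k Ψ 0 z t = rootProd (Z t 0) z / rootProd (P 0) z * Complex.exp (theta z t)
  sheet_succ : ∀ t r, ∃ c : ℝ, c ≠ 0 ∧ ∀ z : ℂ, (∀ n, z ≠ b r n) → z ∉ P r.succ →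
    normalized A k Ψ r.succ z t = c * (rootProd (Z t r.succ) z / rootProd (P r.succ) z)

/-- The points of a divisor given sheet by sheet. -/
abbrev DivisorPoint (E : Fin (N + 1) → Multiset ℂ) : Type :=
  {p : Fin (N + 1) × ℂ // p.2 ∈ E p.1}

/-- The image on `Γ` of a divisor point. -/
def DivisorPoint.onCurve (k : Fin M → ℝ) (ξ : ℝ) {E : Fin (N + 1) → Multiset ℂ}
    (p : DivisorPoint E) : Curve N k ξ :=
  toCurve k ξ (sheetPoint p.1.1 p.1.2)

/-- An assignment of the divisor points to finite ovals that obeys the counting rule: a point is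
assigned to an oval on which it lies, and two divisor points on different sheets that collide at a
double point are assigned to different ovals. -/
def IsCounting (k : Fin M → ℝ) (ξ : ℝ) (E : Fin (N + 1) → Multiset ℂ)
    (a : DivisorPoint E → Fin N × Fin (M - N)) : Prop :=
  (∀ p, p.onCurve k ξ ∈ finiteOval k ξ (a p)) ∧
    ∀ p q, p ≠ q → p.onCurve k ξ = q.onCurve k ξ → a p ≠ a q

/-- The Dubrovin–Natanzon position of a divisor: no point lies on the infinite oval; all the points
are real and lie on finite ovals; at a double point the divisor has a point on both branches or on
none; the counting rule can be applied, and however that is done, each finite oval receives exactly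
one point. -/
structure IsDubrovinNatanzon (k : Fin M → ℝ) (ξ : ℝ) (E : Fin (N + 1) → Multiset ℂ) : Prop where
  not_infinite : ∀ p : DivisorPoint E, p.onCurve k ξ ∉ infiniteOval k ξ
  real_finite : ∀ p : DivisorPoint E, p.1.2.im = 0 ∧ ∃ o, p.onCurve k ξ ∈ finiteOval k ξ o
  collide : ∀ p q : Fin (N + 1) × ℝ, Glued k ξ p q → ((p.2 : ℂ) ∈ E p.1 ↔ (q.2 : ℂ) ∈ E q.1)
  counting : ∃ a : DivisorPoint E → Fin N × Fin (M - N), IsCounting k ξ E a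
  one_each : ∀ a : DivisorPoint E → Fin N × Fin (M - N), IsCounting k ξ E a → ∀ o, ∃! p, a p = o

end KPSoliton

end

/-!
The proof has two independent halves: every vacuum wave function has the asserted divisor as soon
as `ξ > 1`, and for large `ξ` a vacuum wave function exists. Put `K = M - N`.

*The divisor.* The Wronskian of the heat hierarchy solutions is the product of `A` with a matrix
of Vandermonde type, so it is not zero by the Cauchy–Binet formula (`wronskian_ne_zero`), and `D`
is well defined and annihilates the solutions (`darboux_heat`). By Lagrange interpolation at the
points `λ_l`, where the gluing prescribes the values, a vacuum wave function is on every sheet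
`Γ_r`, `r ≥ 1`, a combination of the exponentials `e^{θ(k_j)}` with time independent rational
coefficients of degree at most `K` (`IsVacuumWave.exists_polys`). So `D` acts on it by replacing
these exponentials by the numbers `d_j = D e^{θ(k_j)}`. On `Γ_0` this gives a numerator of degree
`N`. On `Γ_r` the value at infinity is a combination of functions annihilated by `D`, so the
numerator has degree at most `K - 1` (`IsVacuumWave.coeff_eq_zero`); it is not zero because a zero
numerator would force the preceding sheets to vanish and in the end the last `K + 1` of the `d_j`,
whereas `(d_j)` is a nonzero vector of the kernel of `A` (`IsVacuumWave.isRealWave`). Altogether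
there are at most `N + N (K - 1) = N K` zeros, as many as there are finite ovals. Going around a
finite oval one meets exactly one pole, in the interval `]λ_{n+1}, λ_n[`, and equal values at the
double points, so by parity there is a zero on the oval (`IsRealWave.exists_zero`). Hence each
oval has exactly one zero and there are no others (`IsRealWave.count`). To make this precise when
zeros lie at double points, the arcs of the ovals are taken half open, without their right ends:
the half open arcs of different ovals are disjoint, and a zero at the right end of an arc
reappears on the other branch at the left end of the next arc of the same oval. This also yields
the counting rule and keeps the zeros off the infinite oval (`IsRealWave.isDubrovinNatanzon`).

*Existence.* Identify a combination of the `e^{θ(k_j)}` with its vector of coefficients. A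
rational function on a sheet with prescribed values `y_l` at the `λ_l` has the form `(∑ w_l y_l /
(z - λ_l)) / (∑ w_l / (z - λ_l))`. If the weights `w_l` are positive, then its poles interlace the
`λ_l` (`exists_poles`), and if their sum is one, its value at infinity is `∑ w_l y_l`. The weights
have to be found such that this is row `i = N - r + 1` of `A` modified by the rows below it, which
is a linear system (`elimCoeff`, `sheetWeight_spec`); the values at the `α_l` are then the nodes
of the next sheet (`chainNodes`). For `ξ → ∞` the points separate so strongly that the value at
`α_{m+2}` tends to the weighted mean of the first `m + 1` nodes alone (`tendsto_alp_div`). In the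
limit the scheme becomes elimination in a totally positive matrix: with the vectors of minors
`bandMinor`, a three-term Plücker relation with positive coefficients (`bandMinor_relation`)
writes row `i` as a positive combination of `e_i` and the vectors belonging to row `i + 1`, such
that its truncations are proportional to the vectors belonging to row `i`
(`IsTotallyPositiveBand.exists_weights`). The limit system is triangular (`elimCoeff_limit`), so
by continuity the weights are positive for all large `ξ` (`sheet_limit`,
`eventually_sheetWeight`). As the points `λ_l`, `α_l` do not involve `k`, neither does the bound
on `ξ`, and `exists_vacuumWave` assembles the function.
-/

open Filter Topology Polynomial

noncomputable section

namespace KPSoliton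

variable {N M : ℕ}

/-! ### Derivatives of sums of exponentials -/

lemma theta_ofReal (x : ℝ) (t : Times) : theta (x : ℂ) t = ((theta x t : ℝ) : ℂ) := by
  simp only [theta]
  push_cast
  rfl

lemma summable_theta {𝕜 : Type} [RCLike 𝕜] (z : 𝕜) (t : Times) :
    Summable fun n : ℕ => z ^ (n + 1) * ((t.1 n : ℝ) : 𝕜) := by
  have h := (t.2 ‖z‖).norm
  apply Summable.of_norm
  convert h using 2 with n
  simp

/-- Changing `t₁` shifts the phase linearly. -/
lemma theta_withX {𝕜 : Type} [RCLike 𝕜] (z : 𝕜) (t : Times) (x : ℝ) :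
    theta z (t.withX x) = z * (x : 𝕜) + (theta z t - z * ((t.1 0 : ℝ) : 𝕜)) := by
  have h1 := (summable_theta z (t.withX x)).tsum_eq_zero_add
  have h2 := (summable_theta z t).tsum_eq_zero_add
  have e1 : theta z (t.withX x) = _ := h1
  have e2 : theta z t = _ := h2
  rw [e1, e2]
  simp [Times.withX]

lemma withX_self (t : Times) : t.withX (t.1 0) = t := by
  apply Subtype.ext
  simp [Times.withX]

/-- The `n`-th `x`-derivative of a linear combination of solutions of `∂_x e_j = z_j e_j`. -/
lemma iteratedDeriv_sum_exp {𝕜 : Type} [RCLike 𝕜] {ι : Type*} [Fintype ι] (c z : ι → 𝕜)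
    (e : ι → ℝ → 𝕜) (he : ∀ j x, HasDerivAt (e j) (z j * e j x) x) (n : ℕ) :
    iteratedDeriv n (fun x => ∑ j, c j * e j x) = fun x => ∑ j, c j * z j ^ n * e j x := by
  induction n with
  | zero => simp
  | succ n ih =>
    rw [iteratedDeriv_succ, ih]
    funext x
    have : HasDerivAt (fun x => ∑ j, c j * z j ^ n * e j x)
        (∑ j, c j * z j ^ n * (z j * e j x)) x :=
      HasDerivAt.fun_sum fun j _ => (he j x).const_mul _
    rw [this.deriv]
    exact Finset.sum_congr rfl fun j _ => by ring

lemma dx_sum_cexp {ι : Type*} [Fintype ι] (c z : ι → ℂ) (n : ℕ) (t : Times) :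
    dx n (fun s => ∑ j, c j * Complex.exp (theta (z j) s)) t =
      ∑ j, c j * z j ^ n * Complex.exp (theta (z j) t) := by
  unfold dx
  rw [iteratedDeriv_sum_exp c z (fun j x => Complex.exp (theta (z j) (t.withX x)))]
  · simp only [withX_self]
  · intro j x
    simp only [theta_withX]
    have h1 : HasDerivAt (fun y : ℝ => z j * (y : ℂ) + (theta (z j) t - z j * ((t.1 0 : ℝ) : ℂ)))
        (z j) x := by
      simpa using ((Complex.ofRealCLM.hasDerivAt (x := x)).const_mul (z j)).add_const
        (theta (z j) t - z j * ((t.1 0 : ℝ) : ℂ))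
    rw [mul_comm (z j) (Complex.exp _)]
    exact h1.cexp

lemma dx_sum_exp {ι : Type*} [Fintype ι] (c z : ι → ℝ) (n : ℕ) (t : Times) :
    dx n (fun s => ∑ j, c j * Real.exp (theta (z j) s)) t =
      ∑ j, c j * z j ^ n * Real.exp (theta (z j) t) := by
  unfold dx
  rw [iteratedDeriv_sum_exp (𝕜 := ℝ) c z (fun j x => Real.exp (theta (z j) (t.withX x)))]
  · simp only [withX_self]
  · intro j x
    simp only [theta_withX]
    have h1 : HasDerivAt (fun y : ℝ => z j * y + (theta (z j) t - z j * t.1 0)) (z j) x := by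
      simpa using ((hasDerivAt_id x).const_mul (z j)).add_const (theta (z j) t - z j * t.1 0)
    rw [mul_comm (z j) (Real.exp _)]
    exact h1.exp

/-- The symbol of the Darboux operator: the monic real polynomial `P` with
`D e^{θ(z)} = P(z) e^{θ(z)}`. -/
def darbouxPoly (A : Matrix (Fin N) (Fin M) ℝ) (k : Fin M → ℝ) (t : Times) : ℝ[X] :=
  X ^ N - ∑ j : Fin N, C (darbouxCoeff A k t j) * X ^ (N - 1 - j.val)

lemma darbouxPoly_degree (A : Matrix (Fin N) (Fin M) ℝ) (k : Fin M → ℝ) (t : Times) :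
    (∑ j : Fin N, C (darbouxCoeff A k t j) * X ^ (N - 1 - j.val) : ℝ[X]).degree < N := by
  refine (degree_sum_le _ _).trans_lt ?_
  rw [Finset.sup_lt_iff (by simp [bot_lt_iff_ne_bot])]
  intro j _
  refine (degree_C_mul_X_pow_le _ _).trans_lt ?_
  have := j.2
  exact_mod_cast (by omega : N - 1 - j.val < N)

lemma darbouxPoly_monic (A : Matrix (Fin N) (Fin M) ℝ) (k : Fin M → ℝ) (t : Times) :
    (darbouxPoly A k t).Monic :=
  monic_X_pow_sub (darbouxPoly_degree A k t)

lemma darbouxPoly_natDegree (A : Matrix (Fin N) (Fin M) ℝ) (k : Fin M → ℝ) (t : Times) :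
    (darbouxPoly A k t).natDegree = N := by
  have h : (darbouxPoly A k t).degree = N := by
    unfold darbouxPoly
    rw [degree_sub_eq_left_of_degree_lt] <;> rw [degree_X_pow]
    exact darbouxPoly_degree A k t
  exact natDegree_eq_of_degree_eq_some h

lemma darboux_sum_cexp (A : Matrix (Fin N) (Fin M) ℝ) (k : Fin M → ℝ) {ι : Type*} [Fintype ι]
    (c z : ι → ℂ) (t : Times) :
    darboux A k (fun s => ∑ j, c j * Complex.exp (theta (z j) s)) t =
      ∑ j, c j * (aeval (z j) (darbouxPoly A k t) * Complex.exp (theta (z j) t)) := by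
  unfold darboux
  simp only [dx_sum_cexp, darbouxPoly, map_sub, map_sum, map_mul, map_pow, aeval_X, aeval_C,
    Complex.coe_algebraMap]
  simp only [sub_mul, mul_sub, Finset.sum_sub_distrib, Finset.sum_mul, Finset.mul_sum]
  rw [Finset.sum_comm]
  congr 1
  · exact Finset.sum_congr rfl fun j _ => by ring
  · exact Finset.sum_congr rfl fun j _ => Finset.sum_congr rfl fun i _ => by ring

/-! ### The Wronskian -/

/-- Expansion of `det (A * X)` over all selections of columns of `A`. -/
lemma det_mul_expand (A : Matrix (Fin N) (Fin M) ℝ) (X : Matrix (Fin M) (Fin N) ℝ) :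
    (A * X).det = ∑ s : Fin N → Fin M, (A.submatrix id s).det * ∏ i, X (s i) i := by
  simp only [Matrix.det_apply', Matrix.mul_apply, Matrix.submatrix_apply, id]
  simp only [Finset.prod_univ_sum, Finset.sum_mul, Finset.mul_sum, Fintype.piFinset_univ]
  rw [Finset.sum_comm]
  refine Finset.sum_congr rfl fun s _ => Finset.sum_congr rfl fun σ _ => ?_
  rw [Finset.prod_mul_distrib]
  ring

/-- The Cauchy–Binet formula, with the sum running over all selections instead of the increasing
ones; each increasing selection then appears `N!` times. -/
lemma factorial_mul_det_mul (A : Matrix (Fin N) (Fin M) ℝ) (X : Matrix (Fin M) (Fin N) ℝ) :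
    (N.factorial : ℝ) * (A * X).det =
      ∑ s : Fin N → Fin M, (A.submatrix id s).det * (X.submatrix s id).det := by
  have key : ∀ σ : Equiv.Perm (Fin N), (A * X).det =
      ∑ s : Fin N → Fin M, (A.submatrix id s).det * (Equiv.Perm.sign σ * ∏ i, X (s (σ i)) i) := by
    intro σ
    rw [det_mul_expand]
    rw [← Equiv.sum_comp (Equiv.arrowCongr σ.symm (Equiv.refl (Fin M)))]
    refine Finset.sum_congr rfl fun s _ => ?_
    have : A.submatrix id ((Equiv.arrowCongr σ.symm (Equiv.refl (Fin M))) s) =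
        (A.submatrix id s).submatrix id σ := by
      ext i j; simp
    rw [this, Matrix.det_permute']
    simp only [Equiv.arrowCongr_apply, Equiv.symm_symm, Function.comp, Equiv.refl_apply]
    ring
  have h2 : ∑ _σ : Equiv.Perm (Fin N), (A * X).det = (N.factorial : ℝ) * (A * X).det := by
    simp [Fintype.card_perm]
  rw [← h2, Finset.sum_congr rfl fun σ _ => key σ, Finset.sum_comm]
  refine Finset.sum_congr rfl fun s _ => ?_
  rw [Matrix.det_apply' (X.submatrix s id), Finset.mul_sum]
  simp

/-- If all maximal minors of `A` and `X` are positive, so is the determinant of the product. -/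
lemma det_mul_pos (hNM : N ≤ M) (A : Matrix (Fin N) (Fin M) ℝ) (X : Matrix (Fin M) (Fin N) ℝ)
    (hA : ∀ s : Fin N → Fin M, StrictMono s → 0 < (A.submatrix id s).det)
    (hX : ∀ s : Fin N → Fin M, StrictMono s → 0 < (X.submatrix s id).det) :
    0 < (A * X).det := by
  have hnn : ∀ s : Fin N → Fin M, 0 ≤ (A.submatrix id s).det * (X.submatrix s id).det := by
    intro s
    by_cases hs : Function.Injective s
    · set σ := Tuple.sort s
      have hm : StrictMono (s ∘ σ) :=
        (Tuple.monotone_sort s).strictMono_of_injective (hs.comp σ.injective)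
      have h1 := hA _ hm
      have h2 := hX _ hm
      have e1 : A.submatrix id (s ∘ σ) = (A.submatrix id s).submatrix id σ := rfl
      have e2 : X.submatrix (s ∘ σ) id = (X.submatrix s id).submatrix σ id := rfl
      rw [e1, Matrix.det_permute'] at h1
      rw [e2, Matrix.det_permute] at h2
      rcases Int.units_eq_one_or (Equiv.Perm.sign σ) with h | h
      · simp only [h, Units.val_one, Int.cast_one, one_mul] at h1 h2
        positivity
      · simp only [h, Units.val_neg, Units.val_one, Int.cast_neg, Int.cast_one] at h1 h2
        nlinarith
    · obtain ⟨i, j, hij, hne⟩ : ∃ i j, s i = s j ∧ i ≠ j := by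
        simpa [Function.Injective] using hs
      have : (A.submatrix id s).det = 0 :=
        Matrix.det_zero_of_column_eq hne (by simp [hij])
      simp [this]
  have hsm : StrictMono (Fin.castLE hNM) := fun a b h => h
  have : 0 < ∑ s : Fin N → Fin M, (A.submatrix id s).det * (X.submatrix s id).det :=
    Finset.sum_pos' (fun s _ => hnn s)
      ⟨Fin.castLE hNM, Finset.mem_univ _, mul_pos (hA _ hsm) (hX _ hsm)⟩
  rw [← factorial_mul_det_mul] at this
  exact (mul_pos_iff_of_pos_left (by exact_mod_cast N.factorial_pos)).1 this

/-- The Wronskian of the heat hierarchy solutions does not vanish: up to the order of its columns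
the Wronskian matrix is the product of `A` with a matrix of Vandermonde type. -/
lemma wronskian_ne_zero (hNM : N < M) {A : Matrix (Fin N) (Fin M) ℝ} (hA : IsNormalizedBanded A)
    {k : Fin M → ℝ} (hk : StrictMono k) (t : Times) : (wronskianMatrix A k t).det ≠ 0 := by
  set X : Matrix (Fin M) (Fin N) ℝ :=
    Matrix.of fun m j => Real.exp (theta (k m) t) * k m ^ j.val with hXdef
  have hX : ∀ s : Fin N → Fin M, StrictMono s → 0 < (X.submatrix s id).det := by
    intro s hs
    have : X.submatrix s id = Matrix.of fun i j =>
        Real.exp (theta (k (s i)) t) * Matrix.vandermonde (k ∘ s) i j := by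
      ext i j; simp [hXdef, Matrix.vandermonde]
    rw [this, Matrix.det_mul_column, Matrix.det_vandermonde]
    refine mul_pos (Finset.prod_pos fun i _ => Real.exp_pos _)
      (Finset.prod_pos fun i _ => Finset.prod_pos fun j hj => sub_pos.2 ?_)
    exact hk (hs (Finset.mem_Ioi.1 hj))
  have hpos := det_mul_pos hNM.le A X hA.minor_pos hX
  have hW : wronskianMatrix A k t = (A * X).submatrix id (Fin.revPerm (n := N)) := by
    ext i j
    have := dx_sum_exp (fun j => A i j) k (N - 1 - j.val) t
    simp only [wronskianMatrix, Matrix.of_apply, Matrix.submatrix_apply, id, Matrix.mul_apply]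
    refine this.trans (Finset.sum_congr rfl fun m _ => ?_)
    simp only [hXdef, Matrix.of_apply, Fin.revPerm_apply, Fin.val_rev]
    rw [show N - (j.val + 1) = N - 1 - j.val by omega]
    ring
  rw [hW, Matrix.det_permute']
  rcases Int.units_eq_one_or (Equiv.Perm.sign (Fin.revPerm (n := N))) with h | h <;>
    simp [h, hpos.ne']

/-- The real numbers `d_j = D e^{θ(k_j)}`. -/
def darbouxExp (A : Matrix (Fin N) (Fin M) ℝ) (k : Fin M → ℝ) (t : Times) (j : Fin M) : ℝ :=
  (darbouxPoly A k t).eval (k j) * Real.exp (theta (k j) t)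

/-- The Darboux operator on a linear combination of the exponentials `e^{θ(k_j)}`. -/
lemma darboux_sum_vertex (A : Matrix (Fin N) (Fin M) ℝ) (k : Fin M → ℝ) (c : Fin M → ℂ)
    (t : Times) :
    darboux A k (fun s => ∑ j, c j * ((Real.exp (theta (k j) s) : ℝ) : ℂ)) t =
      ∑ j, c j * (darbouxExp A k t j : ℂ) := by
  have h := darboux_sum_cexp A k c (fun j => (k j : ℂ)) t
  simp only [theta_ofReal, ← Complex.ofReal_exp] at h
  rw [h]
  refine Finset.sum_congr rfl fun j _ => ?_
  have : aeval (k j : ℂ) (darbouxPoly A k t) = (((darbouxPoly A k t).eval (k j) : ℝ) : ℂ) := by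
    rw [← Complex.coe_algebraMap, aeval_algebraMap_apply]; simp
  rw [this, darbouxExp]
  push_cast
  ring

/-- `D` annihilates the heat hierarchy solutions, so `(d_j)` lies in the kernel of `A`. -/
lemma sum_mul_darbouxExp (hNM : N < M) {A : Matrix (Fin N) (Fin M) ℝ} (hA : IsNormalizedBanded A)
    {k : Fin M → ℝ} (hk : StrictMono k) (t : Times) (i : Fin N) :
    ∑ j, A i j * darbouxExp A k t j = 0 := by
  have hW := wronskian_ne_zero hNM hA hk t
  have h1 : (wronskianMatrix A k t).mulVec (darbouxCoeff A k t) = fun i => dx N (heat A k i) t := by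
    rw [darbouxCoeff, Matrix.mulVec_mulVec, Matrix.mul_nonsing_inv _ (isUnit_iff_ne_zero.2 hW),
      Matrix.one_mulVec]
  have h2 := congrFun h1 i
  have h3 : ∀ n, dx n (heat A k i) t = ∑ j, A i j * k j ^ n * Real.exp (theta (k j) t) :=
    fun n => dx_sum_exp (fun j => A i j) k n t
  simp only [Matrix.mulVec, dotProduct, wronskianMatrix, Matrix.of_apply, h3] at h2
  simp only [darbouxExp, darbouxPoly, eval_sub, eval_pow, eval_X, eval_finsetSum, eval_mul, eval_C,
    sub_mul, mul_sub, Finset.sum_sub_distrib, sub_eq_zero, Finset.sum_mul, Finset.mul_sum]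
  rw [Finset.sum_comm]
  simp only [Finset.sum_mul] at h2
  refine Eq.trans ?_ (h2.symm.trans ?_)
  · exact Finset.sum_congr rfl fun j _ => by ring
  · exact Finset.sum_congr rfl fun j _ => Finset.sum_congr rfl fun i _ => by ring

lemma heat_coe (A : Matrix (Fin N) (Fin M) ℝ) (k : Fin M → ℝ) (i : Fin N) (s : Times) :
    (heat A k i s : ℂ) = ∑ j, (A i j : ℂ) * ((Real.exp (theta (k j) s) : ℝ) : ℂ) := by
  simp [heat]

lemma darboux_heat (hNM : N < M) {A : Matrix (Fin N) (Fin M) ℝ} (hA : IsNormalizedBanded A)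
    {k : Fin M → ℝ} (hk : StrictMono k) (i : Fin N) (t : Times) :
    darboux A k (fun s => (heat A k i s : ℂ)) t = 0 := by
  simp only [heat_coe]
  rw [darboux_sum_vertex]
  have := sum_mul_darbouxExp hNM hA hk t i
  exact_mod_cast this

/-! ### The marked points -/

lemma lam_one (ξ : ℝ) : lam ξ 1 = 0 := by simp [lam]

lemma alp_one (ξ : ℝ) : alp ξ 1 = 0 := by simp [alp]

lemma lam_succ_lt {ξ : ℝ} (hξ : 1 < ξ) {l : ℕ} (hl : 1 ≤ l) : lam ξ (l + 1) < lam ξ l := by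
  unfold lam
  have h0 : 0 < ξ := by linarith
  rcases Nat.lt_or_ge 1 l with h | h
  · rw [if_neg (by omega), if_neg (by omega), neg_lt_neg_iff]
    exact pow_lt_pow_right₀ hξ (by omega)
  · rw [if_neg (by omega), if_pos h]
    exact neg_lt_zero.2 (by positivity)

lemma lam_lt {ξ : ℝ} (hξ : 1 < ξ) {l m : ℕ} (hl : 1 ≤ l) (hlm : l < m) : lam ξ m < lam ξ l := by
  induction m, hlm using Nat.le_induction with
  | base => exact lam_succ_lt hξ hl
  | succ m hm ih => exact (lam_succ_lt hξ (by omega)).trans ih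

lemma lam_le {ξ : ℝ} (hξ : 1 < ξ) {l m : ℕ} (hl : 1 ≤ l) (hlm : l ≤ m) : lam ξ m ≤ lam ξ l := by
  rcases hlm.lt_or_eq with h | rfl
  · exact (lam_lt hξ hl h).le
  · exact le_rfl

lemma lam_nonpos {ξ : ℝ} (hξ : 1 < ξ) (l : ℕ) : lam ξ l ≤ 0 := by
  unfold lam
  have h0 : 0 < ξ := by linarith
  split_ifs
  · exact le_rfl
  · exact neg_nonpos.2 (by positivity)

lemma alp_succ_lt {ξ : ℝ} (hξ : 1 < ξ) {l : ℕ} (hl : 1 ≤ l) : alp ξ l < alp ξ (l + 1) := by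
  unfold alp
  have h0 : 0 < ξ := by linarith
  rcases Nat.lt_or_ge 1 l with h | h
  · rw [if_neg (show ¬ l ≤ 1 by omega), if_neg (show ¬ l + 1 ≤ 1 by omega)]
    exact zpow_lt_zpow_right₀ hξ (by push_cast; omega)
  · rw [if_neg (show ¬ l + 1 ≤ 1 by omega), if_pos h]
    positivity

lemma alp_lt {ξ : ℝ} (hξ : 1 < ξ) {l m : ℕ} (hl : 1 ≤ l) (hlm : l < m) : alp ξ l < alp ξ m := by
  induction m, hlm using Nat.le_induction with
  | base => exact alp_succ_lt hξ hl
  | succ m hm ih => exact ih.trans (alp_succ_lt hξ (by omega))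

lemma alp_le {ξ : ℝ} (hξ : 1 < ξ) {l m : ℕ} (hl : 1 ≤ l) (hlm : l ≤ m) : alp ξ l ≤ alp ξ m := by
  rcases hlm.lt_or_eq with h | rfl
  · exact (alp_lt hξ hl h).le
  · exact le_rfl

lemma alp_nonneg {ξ : ℝ} (hξ : 1 < ξ) (l : ℕ) : 0 ≤ alp ξ l := by
  unfold alp
  have h0 : 0 < ξ := by linarith
  split_ifs
  · exact le_rfl
  · positivity

lemma lam_injective {ξ : ℝ} (hξ : 1 < ξ) (n : ℕ) :
    Function.Injective fun l : Fin n => lam ξ (l.val + 1) := by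
  intro l m h
  rcases lt_trichotomy l.val m.val with h' | h' | h'
  · exact absurd h (lam_lt hξ (by omega) (by omega)).ne'
  · exact Fin.ext h'
  · exact absurd h (lam_lt hξ (by omega) (by omega)).ne

/-! ### The pole polynomial -/

/-- The monic polynomial with the given simple roots. -/
def polePoly {n : ℕ} (b : Fin n → ℝ) : ℝ[X] := ∏ i, (X - C (b i))

lemma polePoly_monic {n : ℕ} (b : Fin n → ℝ) : (polePoly b).Monic :=
  monic_prod_of_monic _ _ fun _ _ => monic_X_sub_C _

lemma polePoly_natDegree {n : ℕ} (b : Fin n → ℝ) : (polePoly b).natDegree = n := by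
  simp [polePoly, natDegree_prod_of_monic _ _ fun i _ => monic_X_sub_C (b i)]

lemma aeval_polePoly {n : ℕ} (b : Fin n → ℝ) (z : ℂ) :
    aeval z (polePoly b) = ∏ i, (z - (b i : ℂ)) := by
  simp [polePoly]

lemma eval_polePoly {n : ℕ} (b : Fin n → ℝ) (x : ℝ) :
    (polePoly b).eval x = ∏ i, (x - b i) := by
  simp [polePoly, eval_prod]

lemma aeval_ofReal (x : ℝ) (p : ℝ[X]) : aeval (x : ℂ) p = ((p.eval x : ℝ) : ℂ) := by
  rw [← Complex.coe_algebraMap, aeval_algebraMap_apply]; simp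

/-! ### Values at infinity -/

/-- The behaviour of `p` at infinity is that of its reflected polynomial at `0`. -/
lemma tendsto_aeval_div_pow {n : ℕ} (p : ℝ[X]) (hp : p.natDegree ≤ n) :
    Tendsto (fun z : ℂ => aeval z p / z ^ n) (Bornology.cobounded ℂ)
      (𝓝 ((p.coeff n : ℝ) : ℂ)) := by
  have h1 : Tendsto (fun z : ℂ => aeval z⁻¹ (reflect n p)) (Bornology.cobounded ℂ)
      (𝓝 ((p.coeff n : ℝ) : ℂ)) := by
    have h2 : aeval (0 : ℂ) (reflect n p) = ((p.coeff n : ℝ) : ℂ) := by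
      rw [← Complex.ofReal_zero, aeval_ofReal, ← coeff_zero_eq_eval_zero, coeff_reflect,
        revAt_le (Nat.zero_le _), Nat.sub_zero]
    rw [← h2]
    exact ((reflect n p).continuous_aeval.tendsto 0).comp tendsto_inv₀_cobounded
  refine h1.congr' ?_
  filter_upwards [Bornology.eventually_ne_cobounded (0 : ℂ)] with z hz
  have : Invertible z := invertibleOfNonzero hz
  have h2 := eval₂_reflect_mul_pow (algebraMap ℝ ℂ) z n p hp
  rw [invOf_eq_inv] at h2
  rw [aeval_def, aeval_def, ← h2, mul_div_cancel_right₀ _ (pow_ne_zero n hz)]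

lemma tendsto_aeval_div {n : ℕ} (b : Fin n → ℝ) (p : ℝ[X]) (hp : p.natDegree ≤ n) :
    Tendsto (fun z : ℂ => aeval z p / ∏ i, (z - b i)) (Bornology.cobounded ℂ)
      (𝓝 ((p.coeff n : ℝ) : ℂ)) := by
  have hB : (polePoly b).coeff n = 1 := by
    have := (polePoly_monic b).coeff_natDegree
    rwa [polePoly_natDegree] at this
  have h1 := (tendsto_aeval_div_pow p hp).div
    (tendsto_aeval_div_pow (polePoly b) (polePoly_natDegree b).le) (by simp [hB])
  rw [hB, Complex.ofReal_one, div_one] at h1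
  refine h1.congr' ?_
  filter_upwards [Bornology.eventually_ne_cobounded (0 : ℂ)] with z hz
  rw [Pi.div_apply, div_div_div_cancel_right₀ (pow_ne_zero n hz), aeval_polePoly]

/-- The value at infinity of a real rational function with at most `n` finite poles. -/
lemma eq_coeff_of_tendsto {n : ℕ} (b : Fin n → ℝ) (p : ℝ[X]) (hp : p.natDegree ≤ n) {f : ℂ → ℂ}
    (hf : ∀ z : ℂ, (∀ i, z ≠ b i) → f z = aeval z p / ∏ i, (z - b i)) {L : ℂ}
    (hL : Tendsto f (Bornology.cobounded ℂ) (𝓝 L)) : L = (p.coeff n : ℝ) := by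
  refine tendsto_nhds_unique hL ((tendsto_aeval_div b p hp).congr' ?_)
  filter_upwards [eventually_all.2 fun i => Bornology.eventually_ne_cobounded (b i : ℂ)] with z hz
  exact (hf z hz).symm

/-! ### Vacuum wave functions as combinations of the exponentials -/

section Wave

variable {A : Matrix (Fin N) (Fin M) ℝ} {k : Fin M → ℝ} {ξ : ℝ}
  {b : Fin N → Fin (M - N) → ℝ} {Ψ : Fin (N + 1) → ℂ → Times → ℂ}

/-- No pole lies at a marked point `λ_l`. -/
lemma IsVacuumWave.lam_ne (hξ : 1 < ξ) (h : IsVacuumWave A k ξ b Ψ) (r : Fin N)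
    (n : Fin (M - N)) {l : ℕ} (hl : 1 ≤ l) : lam ξ l ≠ b r n := by
  have h1 := h.pole_mem r n
  rcases Nat.lt_or_ge (n.val + 1) l with h' | h'
  · have := lam_le hξ (by omega) (show n.val + 2 ≤ l by omega)
    exact (this.trans_lt h1.1).ne
  · exact (h1.2.trans_le (lam_le hξ hl h')).ne'

lemma IsVacuumWave.pole_neg (hξ : 1 < ξ) (h : IsVacuumWave A k ξ b Ψ) (r : Fin N)
    (n : Fin (M - N)) : b r n < 0 :=
  (h.pole_mem r n).2.trans_le (lam_nonpos hξ _)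

/-- A vacuum wave function is determined on a sheet by its values at the points `λ_l`, by Lagrange
interpolation. -/
lemma IsVacuumWave.exists_poly (hξ : 1 < ξ) (h : IsVacuumWave A k ξ b Ψ) (r : Fin N)
    (y : Fin (M - N + 1) → Fin M → ℝ)
    (hy : ∀ (l : Fin (M - N + 1)) t, Ψ r.succ (lam ξ (l.val + 1) : ℝ) t =
      ∑ j, (y l j : ℂ) * ((Real.exp (theta (k j) t) : ℝ) : ℂ)) :
    ∃ p : Fin M → ℝ[X], (∀ j, (p j).natDegree ≤ M - N) ∧
      ∀ t (z : ℂ), (∀ n, z ≠ b r n) → Ψ r.succ z t =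
        (∑ j, aeval z (p j) * ((Real.exp (theta (k j) t) : ℝ) : ℂ)) / ∏ n, (z - b r n) := by
  set v : Fin (M - N + 1) → ℝ := fun l => lam ξ (l.val + 1) with hv
  have hinj : Set.InjOn v (Finset.univ : Finset (Fin (M - N + 1))) :=
    (lam_injective hξ _).injOn
  set p : Fin M → ℝ[X] := fun j =>
    Lagrange.interpolate Finset.univ v fun l => (polePoly (b r)).eval (v l) * y l j with hp
  have hdeg : ∀ j, (p j).degree < (M - N + 1 : ℕ) := fun j => by
    have := Lagrange.degree_interpolate_lt (fun l => (polePoly (b r)).eval (v l) * y l j) hinj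
    rwa [Finset.card_univ, Fintype.card_fin] at this
  refine ⟨p, fun j => natDegree_le_iff_coeff_eq_zero.2 fun m hm =>
    (degree_lt_iff_coeff_zero _ _).1 (hdeg j) m hm,
    fun t z hz => ?_⟩
  obtain ⟨q, hq, hq'⟩ := h.meromorphic r t
  have hkey : q = ∑ j, C (Real.exp (theta (k j) t)) * p j := by
    refine Polynomial.eq_of_degrees_lt_of_eval_index_eq Finset.univ hinj ?_ ?_ ?_
    · refine degree_le_natDegree.trans_lt ?_
      simp only [Finset.card_univ, Fintype.card_fin]
      exact_mod_cast Nat.lt_succ_of_le hq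
    · refine (degree_sum_le _ _).trans_lt ((Finset.sup_lt_iff ?_).2 fun j _ => ?_)
      · simp [bot_lt_iff_ne_bot]
      · rw [degree_C_mul (Real.exp_ne_zero _)]
        simpa using hdeg j
    · intro l _
      have hne : ∀ n, ((v l : ℝ) : ℂ) ≠ b r n := fun n h0 =>
        h.lam_ne hξ r n (by omega) (Complex.ofReal_injective h0)
      have h1 := hq' (v l : ℝ) hne
      rw [hy l t, ← aeval_polePoly, aeval_ofReal, aeval_ofReal] at h1
      have hB : (polePoly (b r)).eval (v l) ≠ 0 := by
        rw [eval_polePoly, Finset.prod_ne_zero_iff]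
        exact fun n _ => sub_ne_zero.2 (h.lam_ne hξ r n (by omega))
      rw [eq_div_iff (by exact_mod_cast hB)] at h1
      have h2 : (∑ j, y l j * Real.exp (theta (k j) t)) * (polePoly (b r)).eval (v l) =
          q.eval (v l) := by exact_mod_cast h1
      rw [← h2, eval_finsetSum, Finset.sum_mul]
      refine Finset.sum_congr rfl fun j _ => ?_
      rw [eval_mul, eval_C, hp, Lagrange.eval_interpolate_at_node _ hinj (Finset.mem_univ l)]
      ring
  rw [hq' z hz, hkey]
  congr 1
  rw [map_sum]
  refine Finset.sum_congr rfl fun j _ => ?_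
  simp [mul_comm]

/-- On every sheet `Γ_r`, `r ≥ 1`, a vacuum wave function is a combination of the exponentials
`e^{θ(k_j)}` with time independent real rational coefficients. -/
lemma IsVacuumWave.exists_polys (hNM : N < M) (hξ : 1 < ξ) (h : IsVacuumWave A k ξ b Ψ) :
    ∃ p : Fin N → Fin M → ℝ[X], (∀ r j, (p r j).natDegree ≤ M - N) ∧
      ∀ r t (z : ℂ), (∀ n, z ≠ b r n) → Ψ r.succ z t =
        (∑ j, aeval z (p r j) * ((Real.exp (theta (k j) t) : ℝ) : ℂ)) / ∏ n, (z - b r n) := by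
  suffices ∀ (m : ℕ) (hm : m < N), ∃ p : Fin M → ℝ[X], (∀ j, (p j).natDegree ≤ M - N) ∧
      ∀ t (z : ℂ), (∀ n, z ≠ b ⟨m, hm⟩ n) → Ψ (Fin.succ ⟨m, hm⟩) z t =
        (∑ j, aeval z (p j) * ((Real.exp (theta (k j) t) : ℝ) : ℂ)) / ∏ n, (z - b ⟨m, hm⟩ n) by
    choose p hp using this
    exact ⟨fun r => p r.1 r.2, fun r => (hp r.1 r.2).1, fun r => (hp r.1 r.2).2⟩
  have hsingle : ∀ (i : Fin M) t, Ψ 0 (k i : ℝ) t = ∑ j, ((Pi.single i 1 : Fin M → ℝ) j : ℂ) *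
      ((Real.exp (theta (k j) t) : ℝ) : ℂ) := by
    intro i t
    rw [h.sato, theta_ofReal, Finset.sum_eq_single i]
    · simp
    · intro j _ hj; simp [hj]
    · simp
  -- the values at the nodes `λ_l` come from `Γ_0` and from the preceding sheet
  intro m
  induction m with
  | zero =>
    intro hm
    refine h.exists_poly hξ ⟨0, hm⟩
      (fun l => Pi.single ⟨N - 1 + l.val, by have := l.2; omega⟩ 1) fun l t => ?_
    rw [← hsingle]
    rcases Nat.eq_zero_or_pos l.val with hl | hl
    · obtain rfl : l = 0 := Fin.ext hl
      refine h.glue _ _ (Glued.first (Fin.succ ⟨0, hm⟩) ⟨N - 1 + 0, by omega⟩ ?_ ?_) t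
      · simp
      · simp; omega
    · refine h.glue _ _ (Glued.one (Fin.succ ⟨0, hm⟩) (l.val + 1)
        ⟨N - 1 + l.val, by have := l.2; omega⟩ ?_ ?_ ?_) t
      · simp
      · omega
      · simp; omega
  | succ m ih =>
    intro hm
    obtain ⟨p, hp, hp'⟩ := ih (by omega)
    refine h.exists_poly hξ ⟨m + 1, hm⟩ (fun l => if l.val = 0 then
      Pi.single ⟨N - 2 - m, by omega⟩ 1 else fun j =>
        (p j).eval (alp ξ (l.val + 1)) / (polePoly (b ⟨m, by omega⟩)).eval (alp ξ (l.val + 1)))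
      fun l t => ?_
    rcases Nat.eq_zero_or_pos l.val with hl | hl
    · rw [hl]
      simp only [if_true]
      rw [← hsingle]
      refine h.glue _ _ (Glued.first (Fin.succ ⟨m + 1, hm⟩) ⟨N - 2 - m, by omega⟩ ?_ ?_) t
      · simp
      · simp; omega
    · simp only [if_neg hl.ne']
      have hne : ∀ n, ((alp ξ (l.val + 1) : ℝ) : ℂ) ≠ b ⟨m, by omega⟩ n := fun n h0 =>
        ((h.pole_neg hξ ⟨m, by omega⟩ n).trans_le (alp_nonneg hξ (l.val + 1))).ne'
          (Complex.ofReal_injective h0)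
      refine (h.glue _ _ (Glued.step (Fin.succ ⟨m + 1, hm⟩) (Fin.succ ⟨m, by omega⟩) (l.val + 1)
        ?_ ?_ ?_ ?_) t).trans ((hp' t (alp ξ (l.val + 1) : ℝ) hne).trans ?_)
      · simp
      · simp
      · omega
      · omega
      · rw [← aeval_polePoly, aeval_ofReal, Finset.sum_div]
        refine Finset.sum_congr rfl fun j _ => ?_
        rw [aeval_ofReal]
        push_cast
        ring

end Wave

/-! ### Order of the marked points -/

lemma lam_le_lam_iff {ξ : ℝ} (hξ : 1 < ξ) {l m : ℕ} (hl : 1 ≤ l) (hm : 1 ≤ m) :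
    lam ξ m ≤ lam ξ l ↔ l ≤ m :=
  ⟨fun h => not_lt.1 fun h' => (lam_lt hξ hm h').not_ge h, lam_le hξ hl⟩

lemma lam_lt_lam_iff {ξ : ℝ} (hξ : 1 < ξ) {l m : ℕ} (hl : 1 ≤ l) (hm : 1 ≤ m) :
    lam ξ m < lam ξ l ↔ l < m :=
  ⟨fun h => not_le.1 fun h' => (lam_le hξ hm h').not_gt h, lam_lt hξ hl⟩

lemma alp_le_alp_iff {ξ : ℝ} (hξ : 1 < ξ) {l m : ℕ} (hl : 1 ≤ l) (hm : 1 ≤ m) :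
    alp ξ l ≤ alp ξ m ↔ l ≤ m :=
  ⟨fun h => not_lt.1 fun h' => (alp_lt hξ hm h').not_ge h, alp_le hξ hl⟩

lemma alp_lt_alp_iff {ξ : ℝ} (hξ : 1 < ξ) {l m : ℕ} (hl : 1 ≤ l) (hm : 1 ≤ m) :
    alp ξ l < alp ξ m ↔ l < m :=
  ⟨fun h => not_le.1 fun h' => (alp_le hξ hm h').not_gt h, alp_lt hξ hl⟩

lemma alp_pos {ξ : ℝ} (hξ : 1 < ξ) {l : ℕ} (hl : 2 ≤ l) : 0 < alp ξ l := by
  simpa [alp_one] using alp_lt hξ le_rfl hl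

lemma lam_neg {ξ : ℝ} (hξ : 1 < ξ) {l : ℕ} (hl : 2 ≤ l) : lam ξ l < 0 := by
  simpa [lam_one] using lam_lt hξ le_rfl hl

/-! ### Double points -/

section Double

variable {k : Fin M → ℝ} {ξ : ℝ}

lemma Glued.fst_pos {p q : Fin (N + 1) × ℝ} (h : Glued k ξ p q) : 1 ≤ p.1.val := by
  cases h <;> simp only <;> omega

/-- A branch `λ_l` of a double point is never a branch of the form `k_j` or `α_l`. -/
lemma Glued.not_glued (hξ : 1 < ξ) {p q q' : Fin (N + 1) × ℝ} (h : Glued k ξ p q) :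
    ¬ Glued k ξ q q' := by
  intro h'
  cases h with
  | first r j hr hj => simpa using h'.fst_pos
  | one r l j hr hl hj => simpa using h'.fst_pos
  | step r s l hs hr hl hl' =>
    have h1 := alp_pos hξ hl
    generalize hx : alp ξ l = x at h' h1
    cases h' with
    | first r j hr hj => simp [lam_one] at h1
    | one r l j hr hl hj => exact absurd h1 (lam_nonpos hξ _).not_gt
    | step r s l hs hr hl hl' => exact absurd h1 (lam_nonpos hξ _).not_gt

lemma Glued.right_unique (hξ : 1 < ξ) {p q q' : Fin (N + 1) × ℝ} (h : Glued k ξ p q)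
    (h' : Glued k ξ p q') : q = q' := by
  have hinj : ∀ {l m : ℕ}, 1 ≤ l → 1 ≤ m → lam ξ l = lam ξ m → l = m := fun hl hm e =>
    le_antisymm ((lam_le_lam_iff hξ hl hm).1 e.ge) ((lam_le_lam_iff hξ hm hl).1 e.le)
  obtain ⟨p1, p2⟩ := p
  cases h with
  | first r j hr hj =>
    generalize hx : lam ξ 1 = x at h'
    cases h' with
    | first r j' hr hj' => rw [show j = j' from Fin.ext (by omega)]
    | one r l j hr hl hj => have := hinj le_rfl (by omega) hx; omega
    | step r s l hs hr hl hl' => have := hinj le_rfl (by omega) hx; omega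
  | one r l j hr hl hj =>
    generalize hx : lam ξ l = x at h'
    cases h' with
    | first r j' hr hj' => have := hinj (by omega) le_rfl hx; omega
    | one r l' j' hr hl' hj' =>
      have := hinj (by omega) (by omega) hx
      rw [show j = j' from Fin.ext (by omega)]
    | step r s l hs hr hl hl' => omega
  | step r s l hs hr hl hl' =>
    generalize hx : lam ξ l = x at h'
    cases h' with
    | first r j' hr hj' => have := hinj (by omega) le_rfl hx; omega
    | one r l' j' hr hl' hj' => omega
    | step r s' l' hs hr hl hl' =>
      have := hinj (by omega) (by omega) hx
      rw [show s = s' from Fin.ext (by omega), this]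

lemma Glued.left_unique (hξ : 1 < ξ) (hk : StrictMono k) {p p' q : Fin (N + 1) × ℝ}
    (h : Glued k ξ p q) (h' : Glued k ξ p' q) : p = p' := by
  have hinj : ∀ {l m : ℕ}, 1 ≤ l → 1 ≤ m → alp ξ l = alp ξ m → l = m := fun hl hm e =>
    le_antisymm ((alp_le_alp_iff hξ hl hm).1 e.le) ((alp_le_alp_iff hξ hm hl).1 e.ge)
  cases h with
  | first r j hr hj =>
    generalize hx : k j = x at h'
    generalize hz : (0 : Fin (N + 1)) = z at h'
    cases h' with
    | first r' j' hr hj' =>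
      have := hk.injective hx
      subst this
      rw [show r = r' from Fin.ext (by omega)]
    | one r' l j' hr hl hj' =>
      have := hk.injective hx
      subst this
      omega
    | step r s l hs hr hl hl' => subst hz; simp at hs
  | one r l j hr hl hj =>
    generalize hx : k j = x at h'
    generalize hz : (0 : Fin (N + 1)) = z at h'
    cases h' with
    | first r' j' hr hj' =>
      have := hk.injective hx
      subst this
      omega
    | one r' l' j' hr' hl hj' =>
      have := hk.injective hx
      subst this
      rw [show r = r' from Fin.ext (by omega), show l = l' by omega]
    | step r s l hs hr hl hl' => subst hz; simp at hs
  | step r s l hs hr hl hl' =>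
    generalize hx : alp ξ l = x at h'
    cases h' with
    | first r' j' hr hj' => simp at hs
    | one r' l' j' hr hl hj' => simp at hs
    | step r' s' l' hs' hr' hl hl' =>
      have := hinj (by omega) (by omega) hx
      rw [show r = r' from Fin.ext (by omega), this]

/-- The relation of lying on the two branches of a double point. -/
def Partner (k : Fin M → ℝ) (ξ : ℝ) (p q : Fin (N + 1) × ℝ) : Prop :=
  Glued k ξ p q ∨ Glued k ξ q p

lemma Partner.symm {p q : Fin (N + 1) × ℝ} (h : Partner k ξ p q) : Partner k ξ q p := Or.symm h

lemma realPoint_injective : Function.Injective (realPoint (N := N)) := by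
  rintro ⟨r, x⟩ ⟨s, y⟩ h
  simpa [realPoint, sheetPoint] using h

lemma Partner.toCurve_eq {p q : Fin (N + 1) × ℝ} (h : Partner k ξ p q) :
    toCurve k ξ (realPoint p) = toCurve k ξ (realPoint q) := by
  rcases h with h | h
  · exact Quot.sound ⟨p, q, h, rfl, rfl⟩
  · exact (Quot.sound ⟨q, p, h, rfl, rfl⟩).symm

/-- Two points of the sheets have the same image on the curve only if they coincide or are the two
branches of a double point. -/
lemma eq_or_partner_of_toCurve_eq (hξ : 1 < ξ) (hk : StrictMono k)
    {P Q : Fin (N + 1) × OnePoint ℂ} (h : toCurve k ξ P = toCurve k ξ Q) :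
    P = Q ∨ ∃ p q, Partner k ξ p q ∧ realPoint p = P ∧ realPoint q = Q := by
  have h' := Quot.eqvGen_exact h
  clear h
  induction h' with
  | rel P Q h =>
    obtain ⟨p, q, h, rfl, rfl⟩ := h
    exact Or.inr ⟨p, q, Or.inl h, rfl, rfl⟩
  | refl P => exact Or.inl rfl
  | symm P Q _ ih =>
    rcases ih with rfl | ⟨p, q, h, rfl, rfl⟩
    · exact Or.inl rfl
    · exact Or.inr ⟨q, p, h.symm, rfl, rfl⟩
  | trans P Q R _ _ ih₁ ih₂ =>
    rcases ih₁ with rfl | ⟨p, q, hpq, rfl, rfl⟩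
    · exact ih₂
    · rcases ih₂ with rfl | ⟨q', s, hqs, hq, rfl⟩
      · exact Or.inr ⟨p, q, hpq, rfl, rfl⟩
      · obtain rfl := realPoint_injective hq
        refine Or.inl ?_
        rcases hpq with hpq | hpq <;> rcases hqs with hqs | hqs
        · exact absurd hqs (hpq.not_glued hξ)
        · rw [hpq.left_unique hξ hk hqs]
        · rw [hpq.right_unique hξ hqs]
        · exact absurd hpq (hqs.not_glued hξ)

end Double

/-! ### The arcs of the ovals -/

/-- `IsArc k ξ o s a c` says that the interval `[a, c]` of the real part of the sheet `Γ_s` is one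
of the two or three arcs of which the finite oval `o` is made. -/
inductive IsArc (k : Fin M → ℝ) (ξ : ℝ) :
    Fin N × Fin (M - N) → Fin (N + 1) → ℝ → ℝ → Prop
  | own (r : Fin N) (n : Fin (M - N)) :
      IsArc k ξ (r, n) r.succ (lam ξ (n.val + 2)) (lam ξ (n.val + 1))
  | vacuumFirst (r : Fin N) (n : Fin (M - N)) (i j : Fin M) (hr : r.val = 0)
      (hi : i.val + 1 = N + n.val) (hj : j.val = i.val + 1) : IsArc k ξ (r, n) 0 (k i) (k j)
  | vacuumNext (r : Fin N) (n : Fin (M - N)) (i j : Fin M) (hr : 1 ≤ r.val)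
      (hn : n.val = 0) (hi : i.val + r.val + 1 = N) (hj : j.val = i.val + 1) :
      IsArc k ξ (r, n) 0 (k i) (k j)
  | previous (r : Fin N) (n : Fin (M - N)) (hr : 1 ≤ r.val) :
      IsArc k ξ (r, n) r.castSucc (alp ξ (n.val + 1)) (alp ξ (n.val + 2))

/-- The point `p` lies on an arc of the oval `o` and is not the right end of that arc. -/
def OnHalfOpenArc (k : Fin M → ℝ) (ξ : ℝ) (o : Fin N × Fin (M - N)) (p : Fin (N + 1) × ℝ) : Prop :=
  ∃ a c, IsArc k ξ o p.1 a c ∧ p.2 ∈ Set.Ico a c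

section Arcs

variable {k : Fin M → ℝ} {ξ : ℝ}

lemma onFiniteOval_iff {o : Fin N × Fin (M - N)} {p : Fin (N + 1) × ℝ} :
    OnFiniteOval k ξ o p ↔ ∃ a c, IsArc k ξ o p.1 a c ∧ p.2 ∈ Set.Icc a c := by
  constructor
  · intro h
    cases h with
    | own r n x hx => exact ⟨_, _, IsArc.own r n, hx⟩
    | vacuumFirst r n i j x hr hi hj hx => exact ⟨_, _, IsArc.vacuumFirst r n i j hr hi hj, hx⟩
    | vacuumNext r n i j x hr hn hi hj hx => exact ⟨_, _, IsArc.vacuumNext r n i j hr hn hi hj, hx⟩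
    | previous r n x hr hx => exact ⟨_, _, IsArc.previous r n hr, hx⟩
  · obtain ⟨s, x⟩ := p
    rintro ⟨a, c, h, hx⟩
    cases h with
    | own r n => exact OnFiniteOval.own r n x hx
    | vacuumFirst r n i j hr hi hj => exact OnFiniteOval.vacuumFirst r n i j x hr hi hj hx
    | vacuumNext r n i j hr hn hi hj => exact OnFiniteOval.vacuumNext r n i j x hr hn hi hj hx
    | previous r n hr => exact OnFiniteOval.previous r n x hr hx

lemma OnHalfOpenArc.onFiniteOval {o : Fin N × Fin (M - N)} {p : Fin (N + 1) × ℝ}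
    (h : OnHalfOpenArc k ξ o p) : OnFiniteOval k ξ o p := by
  obtain ⟨a, c, h, hx⟩ := h
  exact onFiniteOval_iff.2 ⟨a, c, h, hx.1, hx.2.le⟩

/-- Half open arcs on `Γ_0`, described by the position of their left end. -/
lemma onHalfOpenArc_zero {o : Fin N × Fin (M - N)} {x : ℝ}
    (h : OnHalfOpenArc k ξ o (0, x)) : ∃ i j : Fin M, j.val = i.val + 1 ∧ k i ≤ x ∧ x < k j ∧
      ((o.1.val = 0 ∧ i.val + 1 = N + o.2.val) ∨
        (1 ≤ o.1.val ∧ o.2.val = 0 ∧ i.val + o.1.val + 1 = N)) := by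
  obtain ⟨a, c, h, hx⟩ := h
  simp only at h hx
  generalize hz : (0 : Fin (N + 1)) = z at h
  cases h with
  | own r n => exact absurd hz.symm (Fin.succ_ne_zero r)
  | vacuumFirst r n i j hr hi hj => exact ⟨i, j, hj, hx.1, hx.2, Or.inl ⟨hr, hi⟩⟩
  | vacuumNext r n i j hr hn hi hj => exact ⟨i, j, hj, hx.1, hx.2, Or.inr ⟨hr, hn, hi⟩⟩
  | previous r n hr => have := congrArg Fin.val hz; simp at this; omega

/-- Half open arcs on `Γ_s`, `s ≥ 1`, described by the position of their ends. -/
lemma onHalfOpenArc_pos {o : Fin N × Fin (M - N)} {s : Fin (N + 1)} (hs : 1 ≤ s.val) {x : ℝ}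
    (h : OnHalfOpenArc k ξ o (s, x)) :
    (s.val = o.1.val + 1 ∧ lam ξ (o.2.val + 2) ≤ x ∧ x < lam ξ (o.2.val + 1)) ∨
      (s.val = o.1.val ∧ alp ξ (o.2.val + 1) ≤ x ∧ x < alp ξ (o.2.val + 2)) := by
  obtain ⟨a, c, h, hx⟩ := h
  simp only at h hx
  cases h with
  | own r n => exact Or.inl ⟨by simp, hx.1, hx.2⟩
  | vacuumFirst r n i j hr hi hj => simp at hs
  | vacuumNext r n i j hr hn hi hj => simp at hs
  | previous r n hr => exact Or.inr ⟨by simp, hx.1, hx.2⟩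

/-- The half open arcs of different ovals are disjoint. -/
lemma OnHalfOpenArc.unique (hξ : 1 < ξ) (hk : StrictMono k) {o o' : Fin N × Fin (M - N)}
    {p : Fin (N + 1) × ℝ} (h : OnHalfOpenArc k ξ o p) (h' : OnHalfOpenArc k ξ o' p) : o = o' := by
  obtain ⟨s, x⟩ := p
  rcases Nat.eq_zero_or_pos s.val with hs | hs
  · obtain rfl : s = 0 := Fin.ext hs
    obtain ⟨i, j, hij, hi, hj, ho⟩ := onHalfOpenArc_zero h
    obtain ⟨i', j', hij', hi', hj', ho'⟩ := onHalfOpenArc_zero h'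
    have h1 : i.val < j'.val := hk.lt_iff_lt.1 (hi.trans_lt hj')
    have h2 : i'.val < j.val := hk.lt_iff_lt.1 (hi'.trans_lt hj)
    have := o.1.2
    have := o'.1.2
    exact Prod.ext (Fin.ext (by omega)) (Fin.ext (by omega))
  · rcases onHalfOpenArc_pos hs h with ⟨h1, h2, h3⟩ | ⟨h1, h2, h3⟩ <;>
      rcases onHalfOpenArc_pos hs h' with ⟨h1', h2', h3'⟩ | ⟨h1', h2', h3'⟩
    · have e1 := (lam_lt_lam_iff hξ (by omega) (by omega)).1 (h2.trans_lt h3')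
      have e2 := (lam_lt_lam_iff hξ (by omega) (by omega)).1 (h2'.trans_lt h3)
      exact Prod.ext (Fin.ext (by omega)) (Fin.ext (by omega))
    · have := lam_nonpos hξ (o.2.val + 1)
      have := alp_nonneg hξ (o'.2.val + 1)
      linarith
    · have := lam_nonpos hξ (o'.2.val + 1)
      have := alp_nonneg hξ (o.2.val + 1)
      linarith
    · have e1 := (alp_lt_alp_iff hξ (by omega) (by omega)).1 (h2.trans_lt h3')
      have e2 := (alp_lt_alp_iff hξ (by omega) (by omega)).1 (h2'.trans_lt h3)
      exact Prod.ext (Fin.ext (by omega)) (Fin.ext (by omega))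

/-- The half open arcs through the two branches of a double point belong to different ovals. -/
lemma Glued.oval_ne (hξ : 1 < ξ) (hk : StrictMono k) {o o' : Fin N × Fin (M - N)}
    {p q : Fin (N + 1) × ℝ} (hpq : Glued k ξ p q) (h : OnHalfOpenArc k ξ o p)
    (h' : OnHalfOpenArc k ξ o' q) : o ≠ o' := by
  rintro rfl
  cases hpq with
  | first r m hr hm =>
    obtain ⟨i, j, hij, hi, hj, ho⟩ := onHalfOpenArc_zero h'
    have h1 : i.val ≤ m.val := hk.le_iff_le.1 hi
    have h2 : m.val < j.val := hk.lt_iff_lt.1 hj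
    rcases onHalfOpenArc_pos hr h with ⟨g1, g2, g3⟩ | ⟨g1, g2, g3⟩
    · have := (lam_lt_lam_iff hξ (by omega) (by omega)).1 g3
      omega
    · omega
  | one r l m hr hl hm =>
    obtain ⟨i, j, hij, hi, hj, ho⟩ := onHalfOpenArc_zero h'
    have h1 : i.val ≤ m.val := hk.le_iff_le.1 hi
    have h2 : m.val < j.val := hk.lt_iff_lt.1 hj
    rcases onHalfOpenArc_pos hr.ge h with ⟨g1, g2, g3⟩ | ⟨g1, g2, g3⟩
    · have := (lam_lt_lam_iff hξ (by omega) (by omega)).1 g3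
      have := (lam_le_lam_iff hξ (by omega) (by omega)).1 g2
      omega
    · have := lam_neg hξ hl
      have := alp_nonneg hξ (o.2.val + 1)
      linarith
  | step r s l hs hr hl hl' =>
    rcases onHalfOpenArc_pos (by omega) h with ⟨g1, g2, g3⟩ | ⟨g1, g2, g3⟩
    · rcases onHalfOpenArc_pos hs h' with ⟨g1', g2', g3'⟩ | ⟨g1', g2', g3'⟩
      · omega
      · have := (lam_lt_lam_iff hξ (by omega) (by omega)).1 g3
        have := (lam_le_lam_iff hξ (by omega) (by omega)).1 g2
        have := (alp_lt_alp_iff hξ (by omega) (by omega)).1 g3'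
        have := (alp_le_alp_iff hξ (by omega) (by omega)).1 g2'
        omega
    · have := lam_neg hξ hl
      have := alp_nonneg hξ (o.2.val + 1)
      linarith

/-- An oval closes up: the right end of each of its arcs is glued to the left end of another. -/
lemma IsArc.exists_next {o : Fin N × Fin (M - N)} {s : Fin (N + 1)} {a c : ℝ}
    (h : IsArc k ξ o s a c) : ∃ s' a' c', IsArc k ξ o s' a' c' ∧ Partner k ξ (s, c) (s', a') := by
  cases h with
  | own r n =>
    have hr := r.2
    have hn := n.2
    by_cases hr0 : r.val = 0
    · refine ⟨_, _, _, IsArc.vacuumFirst r n ⟨N + n.val - 1, by omega⟩ ⟨N + n.val, by omega⟩ hr0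
        (by simp only; omega) (by simp only; omega), Or.inl ?_⟩
      by_cases hn0 : n.val = 0
      · rw [show lam ξ (n.val + 1) = lam ξ 1 by rw [hn0]]
        exact Glued.first _ _ (by simp) (by simp; omega)
      · exact Glued.one _ _ _ (by simpa) (by omega) (by simp only; omega)
    · by_cases hn0 : n.val = 0
      · refine ⟨_, _, _, IsArc.vacuumNext r n ⟨N - 1 - r.val, by omega⟩ ⟨N - r.val, by omega⟩
          (by omega) hn0 (by simp only; omega) (by simp only; omega), Or.inl ?_⟩
        rw [hn0]
        exact Glued.first _ _ (by simp) (by simp; omega)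
      · exact ⟨_, _, _, IsArc.previous r n (by omega), Or.inl (Glued.step _ _ _
          (by simp only [Fin.val_castSucc]; omega) (by simp) (by omega) (by omega))⟩
  | vacuumFirst r n i j hr hi hj =>
    refine ⟨_, _, _, IsArc.own r n, Or.inr (Glued.one _ _ _ (by simpa) (by omega) (by omega))⟩
  | vacuumNext r n i j hr hn hi hj =>
    refine ⟨_, _, _, IsArc.previous r n hr, Or.inr ?_⟩
    rw [hn, show alp ξ (0 + 1) = lam ξ 1 by simp [alp_one, lam_one]]
    exact Glued.first _ _ (by simpa) (by simp only [Fin.val_castSucc]; omega)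
  | previous r n hr =>
    have hn := n.2
    exact ⟨_, _, _, IsArc.own r n, Or.inr (Glued.step _ _ _
      (by simp only [Fin.val_castSucc]; omega) (by simp) (by omega) (by omega))⟩

/-- A point of the infinite oval on a half open arc of a finite oval is a double point, and no half
open arc starts from its other branch. -/
lemma OnInfiniteOval.exists_partner (hNM : N < M) (hξ : 1 < ξ) (hk : StrictMono k)
    {o : Fin N × Fin (M - N)} {p : Fin (N + 1) × ℝ} (h : OnInfiniteOval k ξ p)
    (h' : OnHalfOpenArc k ξ o p) :
    ∃ q, Partner k ξ p q ∧ ∀ o', ¬ OnHalfOpenArc k ξ o' q := by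
  have hN : 0 < N := o.1.pos
  cases h with
  | vacuum x hx =>
    obtain ⟨i, j, hij, hi, hj, ho⟩ := onHalfOpenArc_zero h'
    rcases hx with hx | hx
    · have hx0 : x = k ⟨0, by omega⟩ :=
        le_antisymm (hx _) (le_trans (hk.monotone (Fin.mk_le_of_le_val (Nat.zero_le _))) hi)
      refine ⟨(Fin.last N, lam ξ 1), Or.inr ?_, fun o' ho' => ?_⟩
      · rw [hx0]
        exact Glued.first _ _ (by simp only [Fin.val_last]; omega) (by simp)
      · have ho1 := o'.1.2
        rcases onHalfOpenArc_pos (by simp only [Fin.val_last]; omega) ho' with ⟨g1, g2, g3⟩ | ⟨g1, g2, g3⟩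
        · have := (lam_lt_lam_iff hξ (by omega) (by omega)).1 g3
          omega
        · simp at g1; omega
    · exact absurd (hx j) (not_le.2 hj)
  | left r x hx =>
    have hr := r.2
    have hn := o.2.2
    rcases onHalfOpenArc_pos (by simp) h' with ⟨g1, g2, g3⟩ | ⟨g1, g2, g3⟩
    · have g4 := (lam_le_lam_iff hξ (by omega) (by omega)).1 (g2.trans hx)
      have hx0 : x = lam ξ (M - N + 1) :=
        le_antisymm hx (by rwa [show M - N + 1 = o.2.val + 2 by omega])
      by_cases hr0 : r.val = 0
      · refine ⟨(0, k ⟨M - 1, by omega⟩), Or.inl ?_, fun o' ho' => ?_⟩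
        · rw [hx0]
          exact Glued.one _ _ _ (by simpa) (by omega) (by simp only; omega)
        · obtain ⟨i, j, hij, hi, hj, ho⟩ := onHalfOpenArc_zero ho'
          have h2 := hk.lt_iff_lt.1 hj
          have := j.2
          simp only [Fin.lt_def] at h2
          omega
      · refine ⟨(r.castSucc, alp ξ (M - N + 1)), Or.inl ?_, fun o' ho' => ?_⟩
        · rw [hx0]
          exact Glued.step _ _ _ (by simp only [Fin.val_castSucc]; omega) (by simp) (by omega) le_rfl
        · have hn' := o'.2.2
          rcases onHalfOpenArc_pos (by simp only [Fin.val_castSucc]; omega) ho' with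
            ⟨g1, g2, g3⟩ | ⟨g1, g2, g3⟩
          · have := lam_nonpos hξ (o'.2.val + 1)
            have := alp_nonneg hξ (M - N + 1)
            linarith
          · have := (alp_lt_alp_iff hξ (by omega) (by omega)).1 g3
            omega
    · have := lam_neg hξ (show 2 ≤ M - N + 1 by omega)
      have := alp_nonneg hξ (o.2.val + 1)
      linarith
  | right r x hr hx =>
    have hn := o.2.2
    rcases onHalfOpenArc_pos (by simp) h' with ⟨g1, g2, g3⟩ | ⟨g1, g2, g3⟩
    · have := lam_nonpos hξ (o.2.val + 1)
      have := alp_nonneg hξ (M - N + 1)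
      linarith
    · have := (alp_lt_alp_iff hξ (by omega) (by omega)).1 (hx.trans_lt g3)
      omega
  | rightLast r x hr hx =>
    have ho1 := o.1.2
    rcases onHalfOpenArc_pos (by simp) h' with ⟨g1, g2, g3⟩ | ⟨g1, g2, g3⟩
    · have := (lam_lt_lam_iff hξ (by omega) (by omega)).1 (hx.trans_lt g3)
      omega
    · simp at g1; omega

end Arcs

/-! ### Counting zeros on the ovals -/

/-- A real polynomial without zeros on an interval has the same sign at both ends. -/
lemma eval_mul_eval_pos {F : ℝ[X]} {a c : ℝ} (hac : a ≤ c)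
    (h : ∀ x ∈ Set.Icc a c, F.eval x ≠ 0) : 0 < F.eval a * F.eval c := by
  by_contra hcon
  have ha := h a (Set.left_mem_Icc.2 hac)
  have hc := h c (Set.right_mem_Icc.2 hac)
  have hcont : ContinuousOn (fun x => F.eval x) (Set.Icc a c) := F.continuous.continuousOn
  rcases lt_or_gt_of_ne ha with ha' | ha' <;> rcases lt_or_gt_of_ne hc with hc' | hc'
  · exact hcon (mul_pos_of_neg_of_neg ha' hc')
  · obtain ⟨x, hx, hx0⟩ := intermediate_value_Icc hac hcont ⟨ha'.le, hc'.le⟩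
    exact h x hx hx0
  · obtain ⟨x, hx, hx0⟩ := intermediate_value_Icc' hac hcont ⟨hc'.le, ha'.le⟩
    exact h x hx hx0
  · exact hcon (mul_pos ha' hc')

/-- `F r` is the numerator of a real function on the sheet `Γ_r`, and `u` the factor that remains,
so that `F * u` takes equal values at glued points. What is required of `u` is its sign at the marked
points: with one pole in each interval `]λ_{l+1}, λ_l[` it changes sign there, and it is positive at
all the points `k_j` and `α_l`. The bounds on the degrees add up to the number of finite ovals. -/
structure IsRealWave (k : Fin M → ℝ) (ξ : ℝ) (F : Fin (N + 1) → ℝ[X])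
    (u : Fin (N + 1) × ℝ → ℝ) : Prop where
  glue : ∀ p q, Glued k ξ p q → (F p.1).eval p.2 * u p = (F q.1).eval q.2 * u q
  pos_vacuum : ∀ j, 0 < u (0, k j)
  pos_alp : ∀ (r : Fin N) l, 0 < u (r.succ, alp ξ l)
  neg_lam : ∀ (r : Fin N) (n : Fin (M - N)),
    u (r.succ, lam ξ (n.val + 2)) * u (r.succ, lam ξ (n.val + 1)) < 0
  ne_zero : ∀ r, F r ≠ 0
  degree_zero : (F 0).natDegree ≤ N
  degree_succ : ∀ r : Fin N, (F r.succ).natDegree ≤ M - N - 1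

/-- The divisor of zeros of the polynomials `F r`. -/
def zeroDivisor (F : Fin (N + 1) → ℝ[X]) (r : Fin (N + 1)) : Multiset ℂ :=
  ((F r).map (algebraMap ℝ ℂ)).roots

section Count

variable {k : Fin M → ℝ} {ξ : ℝ} {F : Fin (N + 1) → ℝ[X]} {u : Fin (N + 1) × ℝ → ℝ}

lemma IsRealWave.mem_zeroDivisor (h : IsRealWave k ξ F u) (r : Fin (N + 1)) (x : ℝ) :
    (x : ℂ) ∈ zeroDivisor F r ↔ (F r).eval x = 0 := by
  have hne : (F r).map (algebraMap ℝ ℂ) ≠ 0 :=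
    (Polynomial.map_ne_zero_iff (algebraMap ℝ ℂ).injective).2 (h.ne_zero r)
  rw [zeroDivisor, mem_roots hne, IsRoot.def, eval_map_algebraMap, aeval_ofReal,
    Complex.ofReal_eq_zero]

lemma IsRealWave.u_ne_zero (hNM : N < M) (h : IsRealWave k ξ F u) {p q : Fin (N + 1) × ℝ}
    (hpq : Glued k ξ p q) : u p ≠ 0 ∧ u q ≠ 0 := by
  have hlam : ∀ (r : Fin (N + 1)) l, 1 ≤ r.val → 1 ≤ l → l ≤ M - N + 1 → u (r, lam ξ l) ≠ 0 := by
    intro r l hr hl hl'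
    obtain ⟨r, rfl⟩ := Fin.exists_succ_eq.2 (show r ≠ 0 by rintro rfl; simp at hr)
    rcases hl.eq_or_lt with rfl | hl
    · exact right_ne_zero_of_mul (h.neg_lam r ⟨0, by omega⟩).ne
    · have := left_ne_zero_of_mul (h.neg_lam r ⟨l - 2, by omega⟩).ne
      rwa [show l - 2 + 2 = l by omega] at this
  cases hpq with
  | first r j hr hj => exact ⟨hlam r 1 hr le_rfl (by omega), (h.pos_vacuum j).ne'⟩
  | one r l j hr hl hj =>
    exact ⟨hlam r l hr.ge (by omega) (by have := j.2; omega), (h.pos_vacuum j).ne'⟩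
  | step r s l hs hr hl hl' =>
    refine ⟨hlam r l (by omega) (by omega) hl', ?_⟩
    obtain ⟨s, rfl⟩ := Fin.exists_succ_eq.2 (show s ≠ 0 by rintro rfl; simp at hs)
    exact (h.pos_alp s l).ne'

/-- Zeros at a double point occur on both branches. -/
lemma IsRealWave.zero_iff (hNM : N < M) (h : IsRealWave k ξ F u) {p q : Fin (N + 1) × ℝ}
    (hpq : Glued k ξ p q) : (F p.1).eval p.2 = 0 ↔ (F q.1).eval q.2 = 0 := by
  have h1 := h.u_ne_zero hNM hpq
  have h2 := h.glue p q hpq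
  constructor <;> intro h3
  · rw [h3, zero_mul, eq_comm, mul_eq_zero] at h2
    exact h2.resolve_right h1.2
  · rw [h3, zero_mul, mul_eq_zero] at h2
    exact h2.resolve_right h1.1

lemma IsRealWave.zero_of_partner (hNM : N < M) (h : IsRealWave k ξ F u)
    {p q : Fin (N + 1) × ℝ} (hpq : Partner k ξ p q) (hp : (F p.1).eval p.2 = 0) :
    (F q.1).eval q.2 = 0 := by
  rcases hpq with hpq | hpq
  · exact (h.zero_iff hNM hpq).1 hp
  · exact (h.zero_iff hNM hpq).2 hp

lemma IsArc.lt (hξ : 1 < ξ) (hk : StrictMono k) {o : Fin N × Fin (M - N)} {s : Fin (N + 1)}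
    {a c : ℝ} (h : IsArc k ξ o s a c) : a < c := by
  cases h with
  | own r n => exact lam_lt hξ (by omega) (by omega)
  | vacuumFirst r n i j hr hi hj => exact hk (Fin.lt_def.2 (by omega))
  | vacuumNext r n i j hr hn hi hj => exact hk (Fin.lt_def.2 (by omega))
  | previous r n hr => exact alp_lt hξ (by omega) (by omega)

/-- Parity of the number of zeros: every finite oval carries exactly one sign change of `u`, hence a
zero of `F`. A zero at a double point may be replaced by the zero on its other branch, so that the
zero can be found on a half open arc. -/
lemma IsRealWave.exists_zero (hNM : N < M) (hξ : 1 < ξ) (hk : StrictMono k)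
    (h : IsRealWave k ξ F u) (o : Fin N × Fin (M - N)) :
    ∃ p, (F p.1).eval p.2 = 0 ∧ OnHalfOpenArc k ξ o p := by
  by_contra hcon
  have hno : ∀ {s a c}, IsArc k ξ o s a c → ∀ x ∈ Set.Icc a c, (F s).eval x ≠ 0 := by
    intro s a c harc x hx h0
    rcases hx.2.lt_or_eq with hlt | rfl
    · exact hcon ⟨(s, x), h0, a, c, harc, hx.1, hlt⟩
    · obtain ⟨s', a', c', harc', hp⟩ := harc.exists_next
      exact hcon ⟨(s', a'), h.zero_of_partner hNM hp h0, a', c', harc', le_rfl, harc'.lt hξ hk⟩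
  have hsign : ∀ {s a c}, IsArc k ξ o s a c → 0 < (F s).eval a * (F s).eval c :=
    fun harc => eval_mul_eval_pos (harc.lt hξ hk).le (hno harc)
  -- values of the wave function at the two ends of an arc
  have hprod : ∀ {s a c}, IsArc k ξ o s a c → 0 < u (s, a) * u (s, c) →
      0 < ((F s).eval a * u (s, a)) * ((F s).eval c * u (s, c)) := fun harc hu => by
    have := mul_pos (hsign harc) hu
    linarith
  obtain ⟨r, n⟩ := o
  have hr := r.2
  have hn := n.2
  have hown : ((F r.succ).eval (lam ξ (n.val + 2)) * u (r.succ, lam ξ (n.val + 2))) *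
      ((F r.succ).eval (lam ξ (n.val + 1)) * u (r.succ, lam ξ (n.val + 1))) < 0 := by
    have := mul_neg_of_pos_of_neg (hsign (IsArc.own r n)) (h.neg_lam r n)
    linarith
  have hvac : ∀ {i j : Fin M}, IsArc k ξ (r, n) 0 (k i) (k j) →
      0 < ((F 0).eval (k i) * u (0, k i)) * ((F 0).eval (k j) * u (0, k j)) := fun harc =>
    hprod harc (mul_pos (h.pos_vacuum _) (h.pos_vacuum _))
  have hprev : 1 ≤ r.val →
      0 < ((F r.castSucc).eval (alp ξ (n.val + 1)) * u (r.castSucc, alp ξ (n.val + 1))) *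
        ((F r.castSucc).eval (alp ξ (n.val + 2)) * u (r.castSucc, alp ξ (n.val + 2))) := by
    intro hr1
    refine hprod (IsArc.previous r n hr1) ?_
    obtain ⟨s, hs⟩ := Fin.exists_succ_eq.2
      (show r.castSucc ≠ 0 by intro h0; have := congrArg Fin.val h0; simp at this; omega)
    rw [← hs]
    exact mul_pos (h.pos_alp _ _) (h.pos_alp _ _)
  by_cases hr0 : r.val = 0
  · have g1 := hvac (IsArc.vacuumFirst r n ⟨N + n.val - 1, by omega⟩ ⟨N + n.val, by omega⟩ hr0
      (by simp only; omega) (by simp only; omega))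
    have g2 := h.glue _ _ (Glued.one (k := k) (ξ := ξ) r.succ (n.val + 2) ⟨N + n.val, by omega⟩
      (by simpa) (by omega) (by simp only; omega))
    have g3 : (F r.succ).eval (lam ξ (n.val + 1)) * u (r.succ, lam ξ (n.val + 1)) =
        (F 0).eval (k ⟨N + n.val - 1, by omega⟩) * u (0, k ⟨N + n.val - 1, by omega⟩) := by
      by_cases hn0 : n.val = 0
      · rw [show lam ξ (n.val + 1) = lam ξ 1 by rw [hn0]]
        exact h.glue _ _ (Glued.first r.succ ⟨N + n.val - 1, by omega⟩ (by simp) (by simp; omega))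
      · exact h.glue _ _ (Glued.one r.succ (n.val + 1) ⟨N + n.val - 1, by omega⟩
          (by simpa) (by omega) (by simp only; omega))
    simp only at g2
    rw [g2, g3, mul_comm] at hown
    exact hown.not_gt g1
  · have g1 := hprev (by omega)
    have g2 := h.glue _ _ (Glued.step (k := k) (ξ := ξ) r.succ r.castSucc (n.val + 2)
      (by simp only [Fin.val_castSucc]; omega) (by simp) (by omega) (by omega))
    simp only at g2
    by_cases hn0 : n.val = 0
    · have g3 := h.glue _ _ (Glued.first (k := k) (ξ := ξ) r.succ ⟨N - 1 - r.val, by omega⟩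
        (by simp) (by simp; omega))
      have g4 := h.glue _ _ (Glued.first (k := k) (ξ := ξ) r.castSucc ⟨N - r.val, by omega⟩
        (by simp only [Fin.val_castSucc]; omega) (by simp only [Fin.val_castSucc]; omega))
      have g5 := hvac (IsArc.vacuumNext r n ⟨N - 1 - r.val, by omega⟩ ⟨N - r.val, by omega⟩
        (by omega) hn0 (by simp only; omega) (by simp only; omega))
      simp only at g3 g4
      rw [← g3, ← g4] at g5
      rw [show alp ξ (n.val + 1) = lam ξ 1 by rw [hn0]; simp [alp_one, lam_one], ← g2] at g1
      rw [show lam ξ (n.val + 1) = lam ξ 1 by rw [hn0]] at hown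
      have := mul_pos g1 g5
      nlinarith [mul_self_nonneg ((F r.castSucc).eval (lam ξ 1) * u (r.castSucc, lam ξ 1))]
    · have g3 := h.glue _ _ (Glued.step (k := k) (ξ := ξ) r.succ r.castSucc (n.val + 1)
        (by simp only [Fin.val_castSucc]; omega) (by simp) (by omega) (by omega))
      simp only at g3
      rw [g2, g3, mul_comm] at hown
      exact hown.not_gt g1

/-- The number of zeros and the number of ovals agree, so each oval carries exactly one zero. -/
lemma IsRealWave.count (hNM : N < M) (hξ : 1 < ξ) (hk : StrictMono k) (h : IsRealWave k ξ F u) :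
    (zeroDivisor F 0).card = N ∧ (∀ r : Fin N, (zeroDivisor F r.succ).card = M - N - 1) ∧
      (∀ r, (zeroDivisor F r).Nodup) ∧
      (∀ r, ∀ γ ∈ zeroDivisor F r, ∃ x : ℝ, γ = x ∧ ∃ o, OnHalfOpenArc k ξ o (r, x)) ∧
      ∀ o p q, (F p.1).eval p.2 = 0 → (F q.1).eval q.2 = 0 →
        OnHalfOpenArc k ξ o p → OnHalfOpenArc k ξ o q → p = q := by
  choose Z hZ0 hZ using h.exists_zero hNM hξ hk
  set G : Fin N × Fin (M - N) → Σ _ : Fin (N + 1), ℂ := fun o => ⟨(Z o).1, ((Z o).2 : ℂ)⟩ with hG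
  have hZext : ∀ {o o'}, G o = G o' → Z o = Z o' := by
    intro o o' heq
    simp only [hG, Sigma.mk.injEq, heq_eq_eq, Complex.ofReal_inj] at heq
    exact Prod.ext heq.1 heq.2
  have hinj : Function.Injective G := by
    intro o o' heq
    have h2 := hZ o'
    rw [← hZext heq] at h2
    exact (hZ o).unique hξ hk h2
  -- the zeros found on the half open arcs of the ovals exhaust the divisor, as the degrees allow no
  -- more zeros than there are ovals
  set T : Finset (Σ _ : Fin (N + 1), ℂ) :=
    Finset.univ.sigma fun r => (zeroDivisor F r).toFinset with hT
  have hsub : Finset.univ.image G ⊆ T := by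
    intro x hx
    obtain ⟨o, -, rfl⟩ := Finset.mem_image.1 hx
    rw [hT, Finset.mem_sigma]
    exact ⟨Finset.mem_univ _, Multiset.mem_toFinset.2 ((h.mem_zeroDivisor _ _).2 (hZ0 o))⟩
  have hcardG : (Finset.univ.image G).card = N * (M - N) := by
    rw [Finset.card_image_of_injective _ hinj]
    simp
  have hcardT : T.card = ∑ r, (zeroDivisor F r).toFinset.card := Finset.card_sigma _ _
  set bound : Fin (N + 1) → ℕ := Fin.cons N fun _ => M - N - 1 with hbound
  have hle1 : ∀ r, (zeroDivisor F r).toFinset.card ≤ (zeroDivisor F r).card :=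
    fun r => Multiset.toFinset_card_le _
  have hle2 : ∀ r, (zeroDivisor F r).card ≤ bound r := by
    intro r
    refine Fin.cases ?_ (fun r => ?_) r
    · exact ((card_roots' _).trans natDegree_map_le).trans h.degree_zero
    · exact ((card_roots' _).trans natDegree_map_le).trans (h.degree_succ r)
  have hsum : ∑ r, bound r = N * (M - N) := by
    obtain ⟨K, hK⟩ : ∃ K, M - N = K + 1 := ⟨M - N - 1, by omega⟩
    rw [Fin.sum_univ_succ]
    simp only [hbound, Fin.cons_zero, Fin.cons_succ, Finset.sum_const, Finset.card_univ,
      Fintype.card_fin, smul_eq_mul]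
    rw [hK, Nat.add_sub_cancel]
    ring
  have hcard := Finset.card_le_card hsub
  rw [hcardG, hcardT, ← hsum] at hcard
  have heq1 : ∀ r, (zeroDivisor F r).toFinset.card = bound r := by
    have h3 : ∑ r, (zeroDivisor F r).toFinset.card = ∑ r, bound r :=
      le_antisymm (Finset.sum_le_sum fun r _ => (hle1 r).trans (hle2 r)) hcard
    intro r
    exact (Finset.sum_eq_sum_iff_of_le fun r _ => (hle1 r).trans (hle2 r)).1 h3 r
      (Finset.mem_univ r)
  have heq2 : ∀ r, (zeroDivisor F r).card = bound r := fun r =>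
    le_antisymm (hle2 r) ((heq1 r).symm.le.trans (hle1 r))
  have himage : Finset.univ.image G = T := by
    refine Finset.eq_of_subset_of_card_le hsub ?_
    rw [hcardG, hcardT, ← hsum]
    exact Finset.sum_le_sum fun r _ => (heq1 r).le
  have hmem : ∀ r, ∀ γ ∈ zeroDivisor F r, ∃ o, G o = ⟨r, γ⟩ := by
    intro r γ hγ
    have : (⟨r, γ⟩ : Σ _ : Fin (N + 1), ℂ) ∈ Finset.univ.image G := by
      rw [himage, hT, Finset.mem_sigma]
      exact ⟨Finset.mem_univ _, Multiset.mem_toFinset.2 hγ⟩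
    simpa using this
  have hZall : ∀ p, (F p.1).eval p.2 = 0 → ∃ o, Z o = p := by
    intro p hp
    obtain ⟨o, ho⟩ := hmem p.1 (p.2 : ℂ) ((h.mem_zeroDivisor _ _).2 hp)
    simp only [hG, Sigma.mk.injEq, heq_eq_eq, Complex.ofReal_inj] at ho
    exact ⟨o, Prod.ext ho.1 ho.2⟩
  refine ⟨heq2 0, fun r => heq2 r.succ, fun r => ?_, fun r γ hγ => ?_, ?_⟩
  · exact Multiset.toFinset_card_eq_card_iff_nodup.1 ((heq1 r).trans (heq2 r).symm)
  · obtain ⟨o, ho⟩ := hmem r γ hγ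
    simp only [hG, Sigma.mk.injEq, heq_eq_eq] at ho
    refine ⟨(Z o).2, ho.2.symm, o, ?_⟩
    rw [← ho.1]
    exact hZ o
  · intro o p q hp hq hop hoq
    obtain ⟨o₁, rfl⟩ := hZall p hp
    obtain ⟨o₂, rfl⟩ := hZall q hq
    rw [(hZ o₁).unique hξ hk hop, (hZ o₂).unique hξ hk hoq]

/-- The zero divisor of a real wave function is in the Dubrovin–Natanzon position. -/
lemma IsRealWave.isDubrovinNatanzon (hNM : N < M) (hξ : 1 < ξ) (hk : StrictMono k)
    (h : IsRealWave k ξ F u) : IsDubrovinNatanzon k ξ (zeroDivisor F) := by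
  obtain ⟨-, -, -, hreal, huniq⟩ := h.count hNM hξ hk
  -- the real coordinate and the half open arc of a divisor point
  have hpt : ∀ P : DivisorPoint (zeroDivisor F), ∃ p : Fin (N + 1) × ℝ, ∃ o,
      P.1 = (p.1, (p.2 : ℂ)) ∧ (F p.1).eval p.2 = 0 ∧ OnHalfOpenArc k ξ o p := by
    rintro ⟨⟨r, γ⟩, hγ⟩
    obtain ⟨x, rfl, o, ho⟩ := hreal r γ hγ
    exact ⟨(r, x), o, rfl, (h.mem_zeroDivisor _ _).1 hγ, ho⟩
  choose pt ov hpt1 hpt2 hpt3 using hpt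
  have hcurve : ∀ P : DivisorPoint (zeroDivisor F), P.onCurve k ξ = toCurve k ξ (realPoint (pt P)) := by
    intro P
    rw [DivisorPoint.onCurve, hpt1 P]
    rfl
  have hpt_inj : Function.Injective pt := by
    intro P Q hPQ
    apply Subtype.ext
    rw [hpt1 P, hpt1 Q, hPQ]
  have hov_inj : Function.Injective ov := by
    intro P Q hPQ
    have h3 := hpt3 Q
    rw [← hPQ] at h3
    exact hpt_inj (huniq _ _ _ (hpt2 P) (hpt2 Q) (hpt3 P) h3)
  have hov_surj : Function.Surjective ov := by
    intro o
    obtain ⟨p, hp, ho⟩ := h.exists_zero hNM hξ hk o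
    refine ⟨⟨(p.1, (p.2 : ℂ)), (h.mem_zeroDivisor _ _).2 hp⟩, ?_⟩
    set P : DivisorPoint (zeroDivisor F) := ⟨(p.1, (p.2 : ℂ)), (h.mem_zeroDivisor _ _).2 hp⟩ with hP
    have h1 : pt P = p := by
      have := hpt1 P
      simp only [hP, Prod.mk.injEq, Complex.ofReal_inj] at this
      exact Prod.ext this.1.symm this.2.symm
    have h3 := hpt3 P
    rw [h1] at h3
    exact h3.unique hξ hk ho
  have hzero_arc : ∀ p : Fin (N + 1) × ℝ, (F p.1).eval p.2 = 0 →
      ∃ P, pt P = p ∧ OnHalfOpenArc k ξ (ov P) p := by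
    intro p hp
    set P : DivisorPoint (zeroDivisor F) := ⟨(p.1, (p.2 : ℂ)), (h.mem_zeroDivisor _ _).2 hp⟩ with hP
    have h1 : pt P = p := by
      have := hpt1 P
      simp only [hP, Prod.mk.injEq, Complex.ofReal_inj] at this
      exact Prod.ext this.1.symm this.2.symm
    exact ⟨P, h1, by rw [← h1]; exact hpt3 P⟩
  -- a real point with the same image on the curve as a zero is a zero
  have hsame : ∀ p q : Fin (N + 1) × ℝ, (F p.1).eval p.2 = 0 →
      toCurve k ξ (realPoint p) = toCurve k ξ (realPoint q) → (F q.1).eval q.2 = 0 := by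
    intro p q hp hpq
    rcases eq_or_partner_of_toCurve_eq hξ hk hpq with heq | ⟨p', q', hpq', h1, h2⟩
    · rwa [← realPoint_injective heq]
    · obtain rfl := realPoint_injective h1
      obtain rfl := realPoint_injective h2
      exact h.zero_of_partner hNM hpq' hp
  -- a divisor point on an oval has the same image as the zero on a half open arc of that oval
  have hon : ∀ (P : DivisorPoint (zeroDivisor F)) o, P.onCurve k ξ ∈ finiteOval k ξ o →
      ∃ Q : DivisorPoint (zeroDivisor F), ov Q = o ∧ Q.onCurve k ξ = P.onCurve k ξ := by
    intro P o hPo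
    obtain ⟨q, hq, hqP⟩ := hPo
    simp only at hqP
    rw [hcurve] at hqP ⊢
    have hq0 := hsame _ _ (hpt2 P) hqP.symm
    obtain ⟨a, c, harc, hx⟩ := onFiniteOval_iff.1 hq
    have key : ∃ q', (F q'.1).eval q'.2 = 0 ∧ OnHalfOpenArc k ξ o q' ∧
        toCurve k ξ (realPoint q') = toCurve k ξ (realPoint q) := by
      rcases hx.2.lt_or_eq with hlt | heq
      · exact ⟨q, hq0, ⟨a, c, harc, hx.1, hlt⟩, rfl⟩
      · obtain ⟨s', a', c', harc', hp⟩ := harc.exists_next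
        rw [← heq] at hp
        exact ⟨(s', a'), h.zero_of_partner hNM hp hq0,
          ⟨a', c', harc', le_rfl, harc'.lt hξ hk⟩, hp.toCurve_eq.symm⟩
    obtain ⟨q', hq'0, hq'o, hq'⟩ := key
    obtain ⟨Q, hQ, hQo⟩ := hzero_arc q' hq'0
    refine ⟨Q, hQo.unique hξ hk hq'o, ?_⟩
    rw [hcurve, hQ, hq', hqP]
  refine ⟨?_, ?_, ?_, ⟨ov, ?_, ?_⟩, ?_⟩
  · intro P hP
    rw [hcurve] at hP
    rcases hP with ⟨q, hq, hqP⟩ | ⟨r, hr⟩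
    · simp only at hqP
      have hq0 := hsame _ _ (hpt2 P) hqP.symm
      obtain ⟨Q, rfl, hQo⟩ := hzero_arc q hq0
      obtain ⟨q', hpart, hno⟩ := OnInfiniteOval.exists_partner hNM hξ hk hq hQo
      obtain ⟨Q', -, hQ'o⟩ := hzero_arc q' (h.zero_of_partner hNM hpart hq0)
      exact hno _ hQ'o
    · rcases eq_or_partner_of_toCurve_eq hξ hk hr with heq | ⟨p', q', -, h1, -⟩
      · simp [realPoint, sheetPoint] at heq
      · simp [realPoint, sheetPoint] at h1
  · intro P
    refine ⟨?_, ov P, ?_⟩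
    · rw [hpt1 P]; simp
    · rw [hcurve]
      exact ⟨pt P, (hpt3 P).onFiniteOval, rfl⟩
  · intro p q hpq
    rw [h.mem_zeroDivisor, h.mem_zeroDivisor]
    exact h.zero_iff hNM hpq
  · intro P
    rw [hcurve]
    exact ⟨pt P, (hpt3 P).onFiniteOval, rfl⟩
  · intro P Q hne hPQ
    rw [hcurve, hcurve] at hPQ
    rcases eq_or_partner_of_toCurve_eq hξ hk hPQ with heq | ⟨p', q', hpq, h1, h2⟩
    · exact absurd (hpt_inj (realPoint_injective heq)) hne
    · obtain rfl := realPoint_injective h1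
      obtain rfl := realPoint_injective h2
      rcases hpq with hpq | hpq
      · exact hpq.oval_ne hξ hk (hpt3 P) (hpt3 Q)
      · exact (hpq.oval_ne hξ hk (hpt3 Q) (hpt3 P)).symm
  · intro a ha
    have ha_inj : Function.Injective a := by
      intro P Q hPQ
      by_contra hne
      obtain ⟨P', hP', hP'c⟩ := hon P _ (ha.1 P)
      obtain ⟨Q', hQ', hQ'c⟩ := hon Q _ (ha.1 Q)
      have : P' = Q' := hov_inj (by rw [hP', hQ', hPQ])
      refine ha.2 P Q hne ?_ hPQ
      rw [← hP'c, ← hQ'c, this]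
    -- `ov` is a bijection onto the ovals, so the injective map `a` is one by cardinality
    let e := Equiv.ofBijective ov ⟨hov_inj, hov_surj⟩
    have hsurj : Function.Surjective (a ∘ e.symm) :=
      Finite.injective_iff_surjective.1 (ha_inj.comp e.symm.injective)
    intro o
    obtain ⟨o', ho'⟩ := hsurj o
    exact ⟨e.symm o', ho', fun Q hQ => ha_inj (hQ.trans ho'.symm)⟩

end Count

/-! ### The divisor of the dressed wave function -/

lemma aeval_eq_rootProd (F : ℝ[X]) (z : ℂ) :
    aeval z F = F.leadingCoeff * rootProd ((F.map (algebraMap ℝ ℂ)).roots) z := by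
  have h := (IsAlgClosed.splits (F.map (algebraMap ℝ ℂ))).eq_prod_roots
  have h2 := congrArg (eval z) h
  rw [eval_map_algebraMap, eval_mul, eval_C, eval_multiset_prod, Multiset.map_map] at h2
  rw [h2, rootProd, leadingCoeff_map]
  simp

/-- The numbers `d_j = D e^{θ(k_j)}` form a nonzero vector of the kernel of `A`, so the last `K + 1`
of them are not all zero. -/
lemma exists_darbouxExp_ne_zero (hNM : N < M) {A : Matrix (Fin N) (Fin M) ℝ}
    (hA : IsNormalizedBanded A) {k : Fin M → ℝ} (hk : StrictMono k) (t : Times) :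
    ∃ j : Fin M, N ≤ j.val + 1 ∧ (darbouxPoly A k t).eval (k j) ≠ 0 := by
  by_contra hcon
  push Not at hcon
  have hd : ∀ j : Fin M, N ≤ j.val + 1 → darbouxExp A k t j = 0 := fun j hj => by
    rw [darbouxExp, hcon j hj, zero_mul]
  set B := A.submatrix id (Fin.castLE hNM.le)
  have hdet : B.det ≠ 0 := (hA.minor_pos (Fin.castLE hNM.le) (fun a b h => h)).ne'
  have hmul : B.mulVec (fun j => darbouxExp A k t (Fin.castLE hNM.le j)) = 0 := by
    funext i
    change ∑ j : Fin N, A i (Fin.castLE hNM.le j) * darbouxExp A k t (Fin.castLE hNM.le j) = 0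
    refine Eq.trans ?_ (sum_mul_darbouxExp hNM hA hk t i)
    refine Finset.sum_of_injOn (Fin.castLE hNM.le) (Fin.castLE_injective _).injOn
      (by intro j _; simp) ?_ ?_
    · intro j _ hj
      rw [hd j ?_, mul_zero]
      by_contra hlt
      exact hj ⟨⟨j.val, by omega⟩, by simp, rfl⟩
    · intro j _
      rfl
  have hzero := Matrix.eq_zero_of_mulVec_eq_zero hdet hmul
  have hall : ∀ j : Fin M, (darbouxPoly A k t).eval (k j) = 0 := by
    intro j
    rcases Nat.lt_or_ge j.val N with hj | hj
    · have h1 := congrFun hzero ⟨j.val, hj⟩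
      have h2 : darbouxExp A k t j = 0 := h1
      exact (mul_eq_zero.1 h2).resolve_right (Real.exp_ne_zero _)
    · exact hcon j (by omega)
  refine (darbouxPoly_monic A k t).ne_zero ?_
  refine Polynomial.eq_zero_of_degree_lt_of_eval_index_eq_zero Finset.univ (v := k)
    hk.injective.injOn ?_ fun j _ => hall j
  rw [degree_eq_natDegree (darbouxPoly_monic A k t).ne_zero, darbouxPoly_natDegree]
  simpa using hNM

section Dressed

variable {A : Matrix (Fin N) (Fin M) ℝ} {k : Fin M → ℝ} {ξ : ℝ}
  {b : Fin N → Fin (M - N) → ℝ} {Ψ : Fin (N + 1) → ℂ → Times → ℂ}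

/-- The numerators of `DΨ` on the sheets, when `p r j` is the numerator of the coefficient of
`e^{θ(k_j)}` in `Ψ`. -/
def zeroPoly (A : Matrix (Fin N) (Fin M) ℝ) (k : Fin M → ℝ) (p : Fin N → Fin M → ℝ[X]) (t : Times) :
    Fin (N + 1) → ℝ[X] :=
  Fin.cons (darbouxPoly A k t) fun r => ∑ j, C (darbouxExp A k t j) * p r j

/-- What remains of `DΨ` beside its numerator: the exponential on `Γ_0`, the reciprocal of the pole
polynomial on the other sheets. -/
def poleFactor (b : Fin N → Fin (M - N) → ℝ) (t : Times)
    (p : Fin (N + 1) × ℝ) : ℝ :=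
  Fin.cases (motive := fun _ => ℝ) (Real.exp (theta p.2 t))
    (fun r => ((polePoly (b r)).eval p.2)⁻¹) p.1

lemma IsVacuumWave.dressed_zero (h : IsVacuumWave A k ξ b Ψ) (z : ℂ) (t : Times) :
    dressed A k Ψ 0 z t = aeval z (darbouxPoly A k t) * Complex.exp (theta z t) := by
  have h1 : Ψ 0 z = fun s => ∑ _j : Unit, (1 : ℂ) * Complex.exp (theta z s) := by
    funext s
    simp [h.sato]
  rw [dressed, h1, darboux_sum_cexp A k (fun _ : Unit => 1) (fun _ => z)]
  simp

lemma dressed_succ {p : Fin M → ℝ[X]} {r : Fin N} {z : ℂ} {B : ℂ}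
    (hΨ : ∀ t, Ψ r.succ z t = (∑ j, aeval z (p j) * ((Real.exp (theta (k j) t) : ℝ) : ℂ)) / B)
    (t : Times) : dressed A k Ψ r.succ z t =
      aeval z (∑ j, C (darbouxExp A k t j) * p j) / B := by
  have h1 : Ψ r.succ z = fun s => ∑ j, (aeval z (p j) / B) * ((Real.exp (theta (k j) s) : ℝ) : ℂ) := by
    funext s
    rw [hΨ, Finset.sum_div]
    exact Finset.sum_congr rfl fun j _ => by ring
  rw [dressed, h1, darboux_sum_vertex, map_sum, Finset.sum_div]
  refine Finset.sum_congr rfl fun j _ => ?_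
  simp
  ring

/-- `DΨ` vanishes at the points at infinity, as `Ψ` takes there the value of a combination of the
functions annihilated by `D`. -/
lemma IsVacuumWave.coeff_eq_zero (hNM : N < M) (hA : IsNormalizedBanded A) (hk : StrictMono k)
    (h : IsVacuumWave A k ξ b Ψ) {r : Fin N} {p : Fin M → ℝ[X]}
    (hp : ∀ j, (p j).natDegree ≤ M - N)
    (hΨ : ∀ t (z : ℂ), (∀ n, z ≠ b r n) → Ψ r.succ z t =
        (∑ j, aeval z (p j) * ((Real.exp (theta (k j) t) : ℝ) : ℂ)) / ∏ n, (z - b r n)) (t : Times) :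
    (∑ j, C (darbouxExp A k t j) * p j).coeff (M - N) = 0 := by
  obtain ⟨ε, hε, hlim⟩ := h.at_infinity r
  set S := 1 + ∑ i ∈ Finset.Ioi r.rev, ε i with hS
  have hval : ∀ s, ∑ j, (p j).coeff (M - N) * Real.exp (theta (k j) s) =
      (heat A k r.rev s + ∑ i ∈ Finset.Ioi r.rev, ε i * heat A k i s) / S := by
    intro s
    have := eq_coeff_of_tendsto (b r) (∑ j, C (Real.exp (theta (k j) s)) * p j)
      (natDegree_sum_le_of_forall_le _ _ fun j _ => (natDegree_C_mul_le _ _).trans (hp j))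
      (f := fun z => Ψ r.succ z s) (fun z hz => ?_) (hlim s)
    · rw [Complex.ofReal_inj] at this
      rw [this, finsetSum_coeff]
      exact Finset.sum_congr rfl fun j _ => by rw [coeff_C_mul, mul_comm]
    · rw [hΨ s z hz, map_sum]
      congr 1
      refine Finset.sum_congr rfl fun j _ => ?_
      simp [mul_comm]
  have hval2 : ∀ s, ∑ j, (p j).coeff (M - N) * Real.exp (theta (k j) s) =
      ∑ j, ((A r.rev j + ∑ i ∈ Finset.Ioi r.rev, ε i * A i j) / S) *
        Real.exp (theta (k j) s) := by
    intro s
    rw [hval s]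
    simp only [heat, Finset.mul_sum]
    rw [Finset.sum_comm, ← Finset.sum_add_distrib, Finset.sum_div]
    refine Finset.sum_congr rfl fun j _ => ?_
    rw [add_div, add_div, add_mul, Finset.sum_div, Finset.sum_div, Finset.sum_mul]
    congr 1
    · ring
    · exact Finset.sum_congr rfl fun i _ => by ring
  have hD : (∑ j, (((p j).coeff (M - N) : ℝ) : ℂ) * (darbouxExp A k t j : ℂ)) =
      ∑ j, ((((A r.rev j + ∑ i ∈ Finset.Ioi r.rev, ε i * A i j) / S : ℝ)) : ℂ) *
        (darbouxExp A k t j : ℂ) := by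
    rw [← darboux_sum_vertex, ← darboux_sum_vertex]
    congr 1
    funext s
    exact_mod_cast hval2 s
  have hD' : (∑ j, (p j).coeff (M - N) * darbouxExp A k t j) =
      ∑ j, ((A r.rev j + ∑ i ∈ Finset.Ioi r.rev, ε i * A i j) / S) * darbouxExp A k t j := by
    exact_mod_cast hD
  have hker := sum_mul_darbouxExp hNM hA hk t
  rw [finsetSum_coeff]
  simp only [coeff_C_mul]
  simp only [mul_comm (darbouxExp A k t _)]
  rw [hD']
  have : ∑ j, ((A r.rev j + ∑ i ∈ Finset.Ioi r.rev, ε i * A i j) / S) * darbouxExp A k t j =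
      (∑ j, A r.rev j * darbouxExp A k t j +
        ∑ i ∈ Finset.Ioi r.rev, ε i * ∑ j, A i j * darbouxExp A k t j) / S := by
    simp only [Finset.mul_sum]
    rw [Finset.sum_comm, ← Finset.sum_add_distrib, Finset.sum_div]
    refine Finset.sum_congr rfl fun j _ => ?_
    rw [add_div, add_div, add_mul, Finset.sum_div, Finset.sum_div, Finset.sum_mul]
    congr 1
    · ring
    · exact Finset.sum_congr rfl fun i _ => by ring
  rw [this]
  simp [hker]

/-- A dressed vacuum wave function gives real data to which the count of zeros applies. -/
lemma IsVacuumWave.isRealWave (hNM : N < M) (hA : IsNormalizedBanded A) (hξ : 1 < ξ)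
    (hk : StrictMono k) (h : IsVacuumWave A k ξ b Ψ) {p : Fin N → Fin M → ℝ[X]}
    (hp : ∀ r j, (p r j).natDegree ≤ M - N)
    (hΨ : ∀ r t (z : ℂ), (∀ n, z ≠ b r n) → Ψ r.succ z t =
        (∑ j, aeval z (p r j) * ((Real.exp (theta (k j) t) : ℝ) : ℂ)) / ∏ n, (z - b r n))
    (t : Times) : IsRealWave k ξ (zeroPoly A k p t) (poleFactor b t) := by
  have halp : ∀ r n l, alp ξ l ≠ b r n := fun r n l =>
    ((h.pole_neg hξ r n).trans_le (alp_nonneg hξ l)).ne'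
  have hval0 : ∀ x : ℝ, dressed A k Ψ 0 x t =
      (((zeroPoly A k p t 0).eval x * poleFactor b t (0, x) : ℝ) : ℂ) := by
    intro x
    rw [h.dressed_zero, aeval_ofReal, theta_ofReal]
    simp [zeroPoly, poleFactor]
  have hvals : ∀ (r : Fin (N + 1)) (x : ℝ), (∀ r', r = Fin.succ r' → ∀ n, x ≠ b r' n) →
      dressed A k Ψ r x t =
      (((zeroPoly A k p t r).eval x * poleFactor b t (r, x) : ℝ) : ℂ) := by
    intro r x
    refine Fin.cases (fun _ => hval0 x) (fun r hx => ?_) r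
    have hx' : ∀ n, (x : ℂ) ≠ b r n := fun n h0 => hx r rfl n (Complex.ofReal_injective h0)
    rw [dressed_succ (fun s => hΨ r s x hx') t, ← aeval_polePoly, aeval_ofReal, aeval_ofReal]
    simp [zeroPoly, poleFactor, div_eq_mul_inv]
  have hglue : ∀ P Q, Glued k ξ P Q → (zeroPoly A k p t P.1).eval P.2 * poleFactor b t P =
      (zeroPoly A k p t Q.1).eval Q.2 * poleFactor b t Q := by
    intro P Q hPQ
    have h1 : dressed A k Ψ P.1 P.2 t = dressed A k Ψ Q.1 Q.2 t := by
      unfold dressed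
      congr 1
      funext s
      exact h.glue P Q hPQ s
    rw [hvals P.1 P.2, hvals Q.1 Q.2] at h1
    · exact_mod_cast h1
    · cases hPQ with
      | first r j hr hj => exact fun r' h0 => absurd h0.symm (Fin.succ_ne_zero r')
      | one r l j hr hl hj => exact fun r' h0 => absurd h0.symm (Fin.succ_ne_zero r')
      | step r s l hs hr hl hl' => exact fun r' _ n => halp r' n l
    · cases hPQ with
      | first r j hr hj => exact fun r' _ n => h.lam_ne hξ r' n le_rfl
      | one r l j hr hl hj => exact fun r' _ n => h.lam_ne hξ r' n (by omega)
      | step r s l hs hr hl hl' => exact fun r' _ n => h.lam_ne hξ r' n (by omega)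
  have hposv : ∀ x, 0 < poleFactor b t (0, x) := fun x => by
    simp [poleFactor, Real.exp_pos]
  have hposa : ∀ (r : Fin N) l, 0 < poleFactor b t (r.succ, alp ξ l) := fun r l => by
    simp only [poleFactor, Fin.cases_succ, inv_pos, eval_polePoly]
    exact Finset.prod_pos fun n _ =>
      sub_pos.2 ((h.pole_neg hξ r n).trans_le (alp_nonneg hξ l))
  have hdeg : ∀ r : Fin N, (zeroPoly A k p t r.succ).natDegree ≤ M - N - 1 := by
    intro r
    have h1 : (zeroPoly A k p t r.succ).natDegree ≤ M - N := by
      simp only [zeroPoly, Fin.cons_succ]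
      exact natDegree_sum_le_of_forall_le _ _ fun j _ => (natDegree_C_mul_le _ _).trans (hp r j)
    have h2 := h.coeff_eq_zero hNM hA hk (hp r) (hΨ r) t
    refine natDegree_le_iff_coeff_eq_zero.2 fun m hm => ?_
    rcases (show M - N ≤ m by omega).eq_or_lt with rfl | hlt
    · exact h2
    · exact coeff_eq_zero_of_natDegree_lt (h1.trans_lt hlt)
  refine ⟨hglue, fun j => hposv _, hposa, ?_, ?_, ?_, hdeg⟩
  · intro r n
    simp only [poleFactor, Fin.cases_succ]
    rw [← mul_inv, inv_lt_zero, eval_polePoly, eval_polePoly, ← Finset.prod_mul_distrib,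
      ← Finset.mul_prod_erase _ _ (Finset.mem_univ n)]
    have hn := h.pole_mem r n
    refine mul_neg_of_neg_of_pos
      (mul_neg_of_neg_of_pos (sub_neg.2 hn.1) (sub_pos.2 hn.2)) (Finset.prod_pos fun m hm => ?_)
    have hm' := h.pole_mem r m
    have hne : m.val ≠ n.val := fun h0 => (Finset.ne_of_mem_erase hm) (Fin.ext h0)
    rcases lt_or_gt_of_ne hne with hlt | hlt
    · have h1 := lam_le hξ (by omega) (show m.val + 2 ≤ n.val + 1 by omega)
      exact mul_pos_of_neg_of_neg (by linarith [hn.1, hn.2, hm'.1]) (by linarith [hm'.1])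
    · have h1 := lam_le hξ (by omega) (show n.val + 2 ≤ m.val + 1 by omega)
      exact mul_pos (by linarith [hm'.2]) (by linarith [hn.1, hn.2, hm'.2])
  · -- the polynomial of each sheet inherits a nonzero value from the preceding sheet
    have hsucc : ∀ (m : ℕ) (hm : m < N), zeroPoly A k p t (Fin.succ ⟨m, hm⟩) ≠ 0 := by
      intro m
      induction m with
      | zero =>
        intro hm h0
        obtain ⟨j, hj, hj0⟩ := exists_darbouxExp_ne_zero hNM hA hk t
        refine hj0 ?_
        have h1 : (zeroPoly A k p t 0).eval (k j) * poleFactor b t (0, k j) = 0 := by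
          rcases hj.eq_or_lt with hj1 | hj1
          · have := hglue _ _ (Glued.first (Fin.succ ⟨0, hm⟩) j (by simp) (by simp; omega))
            rw [← this, h0]
            simp
          · have := hglue _ _ (Glued.one (Fin.succ ⟨0, hm⟩) (j.val + 2 - N) j (by simp) (by omega)
              (by omega))
            rw [← this, h0]
            simp
        exact (mul_eq_zero.1 h1).resolve_right (hposv _).ne'
      | succ m ih =>
        intro hm h0
        have hm' : m < N := by omega
        refine ih hm' ?_
        refine Polynomial.eq_zero_of_degree_lt_of_eval_index_eq_zero
          (Finset.univ : Finset (Fin (M - N)))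
          (v := fun l => alp ξ (l.val + 2)) ?_ ?_ ?_
        · refine Set.injOn_of_injective fun l l' hl => Fin.ext ?_
          have h1 := (alp_le_alp_iff hξ (by omega) (by omega)).1 (le_of_eq hl)
          have h2 := (alp_le_alp_iff hξ (by omega) (by omega)).1 (le_of_eq hl.symm)
          omega
        · refine degree_le_natDegree.trans_lt ?_
          have := hdeg ⟨m, hm'⟩
          rw [Finset.card_univ, Fintype.card_fin]
          exact_mod_cast (by omega :
            (zeroPoly A k p t (Fin.succ ⟨m, hm'⟩)).natDegree < M - N)
        · intro l _
          have := hglue _ _ (Glued.step (Fin.succ ⟨m + 1, hm⟩) (Fin.succ ⟨m, hm'⟩) (l.val + 2)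
            (by simp) (by simp) (by simp) (by have := l.2; omega))
          simp only at this
          rw [h0, eval_zero, zero_mul] at this
          exact (mul_eq_zero.1 this.symm).resolve_right (hposa _ _).ne'
    intro r
    refine Fin.cases ?_ (fun r => hsucc r.1 r.2) r
    exact (darbouxPoly_monic A k t).ne_zero
  · exact (darbouxPoly_natDegree A k t).le

lemma theta_zeroTimes (z : ℂ) : theta z zeroTimes = 0 := by simp [theta, zeroTimes]

/-- All the asserted properties of a vacuum wave function hold as soon as `ξ > 1`. -/
lemma IsVacuumWave.exists_divisor (hNM : N < M) (hA : IsNormalizedBanded A) (hξ : 1 < ξ)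
    (hk : StrictMono k) (h : IsVacuumWave A k ξ b Ψ) :
    ∃ D : Times → Fin (N + 1) → Multiset ℂ,
      IsDivisor A k b Ψ D ∧ HasZerosPoles A k b Ψ D (D zeroTimes) ∧
      ∀ t, (D t 0).card = N ∧ (∀ r : Fin N, (D t r.succ).card = M - N - 1) ∧
        (∀ r, (D t r).Nodup) ∧ IsDubrovinNatanzon k ξ (D t) := by
  obtain ⟨p, hp, hΨ⟩ := h.exists_polys hNM hξ
  have hR := h.isRealWave hNM hA hξ hk hp hΨ
  have hdiv : IsDivisor A k b Ψ fun t => zeroDivisor (zeroPoly A k p t) := by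
    refine ⟨fun t z => ?_, fun t r => ?_⟩
    · rw [h.dressed_zero, aeval_eq_rootProd, (darbouxPoly_monic A k t).leadingCoeff]
      simp [zeroDivisor, zeroPoly]
    · refine ⟨(zeroPoly A k p t r.succ).leadingCoeff,
        leadingCoeff_ne_zero.2 ((hR t).ne_zero _), fun z hz => ?_⟩
      rw [dressed_succ (fun s => hΨ r s z hz) t, zeroDivisor, ← aeval_eq_rootProd]
      simp [zeroPoly]
  refine ⟨fun t => zeroDivisor (zeroPoly A k p t), hdiv, ?_, fun t => ?_⟩
  · have hrp : ∀ {S : Multiset ℂ} {z : ℂ}, z ∉ S → rootProd S z ≠ 0 := by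
      intro S z hz h0
      obtain ⟨γ, hγ, h1⟩ := Multiset.mem_map.1 (Multiset.prod_eq_zero_iff.1 h0)
      exact hz (by rwa [sub_eq_zero.1 h1])
    refine ⟨fun t z _ => ?_, fun t r => ?_⟩
    · rw [normalized, hdiv.sheet_zero, hdiv.sheet_zero, theta_zeroTimes, Complex.exp_zero, mul_one]
      ring
    · obtain ⟨R, hR0, hR1⟩ := hdiv.sheet_succ t r
      obtain ⟨R', hR'0, hR'1⟩ := hdiv.sheet_succ zeroTimes r
      refine ⟨R / R', div_ne_zero hR0 hR'0, fun z hz hzP => ?_⟩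
      rw [normalized, hR1 z hz, hR'1 z hz]
      have h1 : ∏ n, (z - (b r n : ℂ)) ≠ 0 :=
        Finset.prod_ne_zero_iff.2 fun n _ => sub_ne_zero.2 (hz n)
      have h2 := hrp hzP
      have h3 : (R' : ℂ) ≠ 0 := by exact_mod_cast hR'0
      push_cast
      field_simp
  · obtain ⟨h1, h2, h3, -⟩ := (hR t).count hNM hξ hk
    exact ⟨h1, h2, h3, (hR t).isDubrovinNatanzon hNM hξ hk⟩

end Dressed

/-! ### Elimination in a totally positive banded matrix -/

/-- A banded matrix with positive maximal minors and row sums one. Its columns are indexed by the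
natural numbers below `N + K`; the columns from `N + K` on vanish. -/
structure IsTotallyPositiveBand (N K : ℕ) (a : Matrix (Fin N) ℕ ℝ) : Prop where
  band : ∀ i j, (j < i.val ∨ i.val + K < j) → a i j = 0
  minor_pos : ∀ s : Fin N → ℕ, StrictMono s → (∀ r, s r < N + K) → 0 < (a.submatrix id s).det
  row_sum : ∀ i, ∑ j ∈ Finset.range (N + K), a i j = 1

/-- The columns `0, …, i - 1`, then `j`, then `m + i + 1, …, m + N - 1`. -/
def bandColumns (N i m j : ℕ) (r : Fin N) : ℕ :=
  if r.val < i then r.val else if r.val = i then j else m + r.val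

/-- As a function of `j`, this minor is the vector of the row space that vanishes in the columns
`0, …, i - 1` and `m + i + 1, …, m + N - 1`. -/
def bandMinor {N : ℕ} (a : Matrix (Fin N) ℕ ℝ) (i m j : ℕ) : ℝ :=
  (a.submatrix id (bandColumns N i m j)).det

section Band

variable {N K : ℕ} {a : Matrix (Fin N) ℕ ℝ}

lemma bandMinor_eq_zero_of_lt {i m j : ℕ} (hi : i < N) (hj : j < i) : bandMinor a i m j = 0 := by
  refine Matrix.det_zero_of_column_eq (i := ⟨j, by omega⟩) (j := ⟨i, hi⟩)
    (by simp [Fin.ext_iff]; omega) fun r => ?_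
  simp [bandColumns, hj]

lemma bandMinor_eq_zero_of_gt {i m r : ℕ} (hir : i < r) (hr : r < N) :
    bandMinor a i m (m + r) = 0 := by
  refine Matrix.det_zero_of_column_eq (i := ⟨r, hr⟩) (j := ⟨i, by omega⟩)
    (by simp [Fin.ext_iff]; omega) fun q => ?_
  simp [bandColumns, show ¬ r < i by omega, show r ≠ i by omega]

lemma bandMinor_pos (ha : IsTotallyPositiveBand N K a) {i m j : ℕ} (hm : m ≤ K)
    (hij : i ≤ j) (hjm : j ≤ i + m) : 0 < bandMinor a i m j := by
  refine ha.minor_pos _ ?_ ?_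
  · intro p q hpq
    have hpq' : p.val < q.val := hpq
    simp only [bandColumns]
    split_ifs <;> omega
  · intro p
    have := p.2
    simp only [bandColumns]
    split_ifs <;> omega

lemma bandMinor_mem_rowSpace {i : ℕ} (hi : i < N) (m : ℕ) :
    ∃ c : Fin N → ℝ, ∀ j, bandMinor a i m j = ∑ r, c r * a r j := by
  set B := a.submatrix id (bandColumns N i m 0)
  refine ⟨fun r => B.adjugate ⟨i, hi⟩ r, fun j => ?_⟩
  have h1 : a.submatrix id (bandColumns N i m j) = B.updateCol ⟨i, hi⟩ fun r => a r j := by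
    ext r q
    by_cases hq : q = ⟨i, hi⟩
    · subst hq
      simp [bandColumns]
    · have : q.val ≠ i := fun h => hq (Fin.ext h)
      simp [hq, B, bandColumns, this]
  rw [bandMinor, h1, ← Matrix.cramer_apply, Matrix.cramer_eq_adjugate_mulVec]
  rfl

/-- A vector of the row space that vanishes in `N` columns is zero. -/
lemma IsTotallyPositiveBand.eq_zero (ha : IsTotallyPositiveBand N K a) {y : ℕ → ℝ}
    (hy : ∃ c : Fin N → ℝ, ∀ j, y j = ∑ r, c r * a r j) {s : Fin N → ℕ} (hs : StrictMono s)
    (hs' : ∀ r, s r < N + K) (h : ∀ r, y (s r) = 0) (j : ℕ) : y j = 0 := by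
  obtain ⟨c, hc⟩ := hy
  have hc0 : c = 0 := by
    refine Matrix.eq_zero_of_vecMul_eq_zero (ha.minor_pos s hs hs').ne' ?_
    funext r
    have := h r
    rw [hc] at this
    exact this
  simp [hc, hc0]

/-- A three-term Plücker relation: the difference of the two sides lies in the row space and
vanishes in `N` columns. -/
lemma bandMinor_relation (ha : IsTotallyPositiveBand N K a) {i m : ℕ} (hi : i + 1 < N)
    (hm : m < K) (j : ℕ) :
    bandMinor a i (m + 1) j =
      bandMinor a i (m + 1) i / bandMinor a i m i * bandMinor a i m j +
      bandMinor a i (m + 1) (i + 1 + m) / bandMinor a (i + 1) m (i + 1 + m) *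
        bandMinor a (i + 1) m j := by
  have p1 := bandMinor_pos ha hm.le le_rfl (show i ≤ i + m by omega)
  have p2 := bandMinor_pos ha hm.le (show i + 1 ≤ i + 1 + m by omega) le_rfl
  set x := bandMinor a i (m + 1) i / bandMinor a i m i
  set y := bandMinor a i (m + 1) (i + 1 + m) / bandMinor a (i + 1) m (i + 1 + m)
  obtain ⟨c₁, h₁⟩ := bandMinor_mem_rowSpace (a := a) (show i < N by omega) (m + 1)
  obtain ⟨c₂, h₂⟩ := bandMinor_mem_rowSpace (a := a) (show i < N by omega) m
  obtain ⟨c₃, h₃⟩ := bandMinor_mem_rowSpace (a := a) hi m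
  have key := ha.eq_zero (y := fun j => bandMinor a i (m + 1) j -
      (x * bandMinor a i m j + y * bandMinor a (i + 1) m j))
    ⟨fun r => c₁ r - (x * c₂ r + y * c₃ r), fun j => by
      rw [h₁, h₂, h₃, Finset.mul_sum, Finset.mul_sum, ← Finset.sum_add_distrib,
        ← Finset.sum_sub_distrib]
      exact Finset.sum_congr rfl fun r _ => by ring⟩
    (s := bandColumns N i m i)
    (by
      intro p q hpq
      have hpq' : p.val < q.val := hpq
      simp only [bandColumns]
      split_ifs <;> omega)
    (by
      intro p
      have := p.2
      simp only [bandColumns]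
      split_ifs <;> omega)
    (by
      intro r
      have hr := r.2
      simp only [bandColumns]
      split_ifs with h1 h2
      · rw [bandMinor_eq_zero_of_lt (by omega) h1, bandMinor_eq_zero_of_lt (by omega) h1,
          bandMinor_eq_zero_of_lt hi (by omega)]
        ring
      · rw [bandMinor_eq_zero_of_lt hi (by omega), div_mul_cancel₀ _ p1.ne']
        ring
      · rw [bandMinor_eq_zero_of_gt (i := i) (by omega) hr]
        by_cases h3 : r.val = i + 1
        · rw [h3, show m + (i + 1) = i + 1 + m by omega, div_mul_cancel₀ _ p2.ne']
          ring
        · rw [bandMinor_eq_zero_of_gt (i := i + 1) (by omega) hr,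
            show m + r.val = (m + 1) + (r.val - 1) by omega,
            bandMinor_eq_zero_of_gt (i := i) (by omega) (by omega)]
          ring) j
  exact sub_eq_zero.1 key

/-- The vectors reached by eliminating row `i` with the rows below it, cut off behind column
`i + m` and scaled to start with the entry one. For `i = N` these are unit vectors. -/
def bandVec {N : ℕ} (a : Matrix (Fin N) ℕ ℝ) (i m j : ℕ) : ℝ :=
  if i < N then (if j ≤ i + m then bandMinor a i m j / bandMinor a i m i else 0)
  else if j = i + m then 1 else 0

lemma bandVec_eq_zero {i m j : ℕ} (h : j < i ∨ i + m < j) : bandVec a i m j = 0 := by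
  unfold bandVec
  split_ifs with h1 h2 h2
  · rw [bandMinor_eq_zero_of_lt h1 (by omega), zero_div]
  · rfl
  · omega
  · rfl

lemma bandVec_nonneg (ha : IsTotallyPositiveBand N K a) {i m : ℕ} (hm : m ≤ K) (j : ℕ) :
    0 ≤ bandVec a i m j := by
  by_cases hij : i ≤ j
  · unfold bandVec
    split_ifs with h1 h2
    · exact (div_pos (bandMinor_pos ha hm hij h2)
        (bandMinor_pos ha hm le_rfl (by omega))).le
    all_goals norm_num
  · rw [bandVec_eq_zero (by omega)]

lemma bandVec_last_pos (ha : IsTotallyPositiveBand N K a) {i m : ℕ} (hm : m ≤ K) :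
    0 < bandVec a i m (i + m) := by
  unfold bandVec
  split_ifs with h1 h2
  · exact div_pos (bandMinor_pos ha hm (by omega) le_rfl)
      (bandMinor_pos ha hm le_rfl (by omega))
  · omega
  · exact one_pos
  · exact absurd rfl ‹_›

lemma bandVec_zero (ha : IsTotallyPositiveBand N K a) {i : ℕ} (hi : i < N) (j : ℕ) :
    bandVec a i 0 j = if j = i then 1 else 0 := by
  split_ifs with h
  · have := bandMinor_pos ha (Nat.zero_le K) le_rfl (show i ≤ i + 0 by omega)
    subst h
    simp [bandVec, hi, this.ne']
  · exact bandVec_eq_zero (by omega)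

/-- The normalized three-term relation. For the last row the elimination is empty, and the step only
adds one more column. -/
lemma bandVec_succ (ha : IsTotallyPositiveBand N K a) {i m : ℕ} (hi : i < N) (hm : m < K) :
    ∃ b : ℝ, 0 < b ∧ ∀ j, bandVec a i (m + 1) j = bandVec a i m j + b * bandVec a (i + 1) m j := by
  have p1 := bandMinor_pos ha hm.le le_rfl (show i ≤ i + m by omega)
  have p2 := bandMinor_pos ha (show m + 1 ≤ K from hm) le_rfl (show i ≤ i + (m + 1) by omega)
  have p3 := bandMinor_pos ha (show m + 1 ≤ K from hm) (show i ≤ i + 1 + m by omega)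
    (show i + 1 + m ≤ i + (m + 1) by omega)
  by_cases hi1 : i + 1 < N
  · have p4 := bandMinor_pos ha hm.le le_rfl (show i + 1 ≤ i + 1 + m by omega)
    have p5 := bandMinor_pos ha hm.le (show i + 1 ≤ i + 1 + m by omega) le_rfl
    refine ⟨bandMinor a i (m + 1) (i + 1 + m) / bandMinor a (i + 1) m (i + 1 + m) *
      bandMinor a (i + 1) m (i + 1) / bandMinor a i (m + 1) i, by positivity, fun j => ?_⟩
    simp only [bandVec, if_pos hi, if_pos hi1]
    by_cases hj : j ≤ i + 1 + m
    · rw [if_pos (show j ≤ i + (m + 1) by omega), if_pos hj]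
      have hcut : (if j ≤ i + m then bandMinor a i m j / bandMinor a i m i else 0) =
          bandMinor a i m j / bandMinor a i m i := by
        split_ifs with h
        · rfl
        · rw [show j = m + (i + 1) by omega, bandMinor_eq_zero_of_gt (by omega) hi1, zero_div]
      rw [hcut, bandMinor_relation ha hi1 hm j]
      field_simp
    · rw [if_neg (by omega), if_neg (by omega), if_neg hj]
      ring
  · have hcol : ∀ j, bandMinor a i (m + 1) j = bandMinor a i m j := by
      intro j
      have : bandColumns N i (m + 1) j = bandColumns N i m j := by
        funext r
        have := r.2
        simp only [bandColumns]
        split_ifs <;> omega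
      rw [bandMinor, this, bandMinor]
    refine ⟨bandMinor a i (m + 1) (i + 1 + m) / bandMinor a i (m + 1) i, by positivity,
      fun j => ?_⟩
    simp only [bandVec, if_pos hi, if_neg hi1, hcol]
    rcases lt_trichotomy j (i + 1 + m) with h | h | h
    · rw [if_pos (by omega), if_pos (by omega), if_neg (by omega)]
      ring
    · rw [if_pos (by omega), if_neg (by omega), if_pos h, h]
      ring
    · rw [if_neg (by omega), if_neg (by omega), if_neg (by omega)]
      ring

/-- Without elimination the vector is a multiple of row `i`. -/
lemma bandVec_last (ha : IsTotallyPositiveBand N K a) (i : Fin N) :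
    0 < a i i.val ∧ ∀ j, a i j = a i i.val * bandVec a i.val K j := by
  have hi := i.2
  have p1 := bandMinor_pos ha (le_refl K) le_rfl (show i.val ≤ i.val + K by omega)
  obtain ⟨c, hc⟩ := bandMinor_mem_rowSpace (a := a) hi K
  have key : ∀ j, bandMinor a i.val K i.val * a i j - a i i.val * bandMinor a i.val K j = 0 := by
    refine ha.eq_zero (y := fun j => bandMinor a i.val K i.val * a i j -
        a i i.val * bandMinor a i.val K j)
      ⟨fun r => (if r = i then bandMinor a i.val K i.val else 0) - a i i.val * c r, fun j => ?_⟩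
      (s := bandColumns N i.val K i.val) ?_ ?_ ?_
    · rw [hc j, Finset.mul_sum]
      simp only [sub_mul, Finset.sum_sub_distrib, ite_mul, zero_mul, Finset.sum_ite_eq',
        Finset.mem_univ, if_true]
      congr 1
      exact Finset.sum_congr rfl fun r _ => by ring
    · intro p q hpq
      have hpq' : p.val < q.val := hpq
      simp only [bandColumns]
      split_ifs <;> omega
    · intro p
      have := p.2
      simp only [bandColumns]
      split_ifs <;> omega
    · intro r
      have hr := r.2
      simp only [bandColumns]
      split_ifs with h1 h2
      · rw [bandMinor_eq_zero_of_lt hi h1, ha.band i _ (Or.inl h1)]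
        ring
      · ring
      · rw [bandMinor_eq_zero_of_gt (i := i.val) (by omega) hr, ha.band i _ (Or.inr (by omega))]
        ring
  have hrow : ∀ j, a i j = a i i.val * bandVec a i.val K j := by
    intro j
    by_cases hj : j ≤ i.val + K
    · simp only [bandVec, if_pos hi, if_pos hj]
      have := key j
      field_simp
      linarith
    · rw [ha.band i j (by omega), bandVec_eq_zero (by omega), mul_zero]
  refine ⟨?_, hrow⟩
  have hsum := ha.row_sum i
  rw [Finset.sum_congr rfl fun j _ => hrow j, ← Finset.mul_sum] at hsum
  refine pos_of_mul_pos_left (hsum ▸ one_pos) (Finset.sum_nonneg fun j _ => ?_)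
  exact bandVec_nonneg ha le_rfl j

/-- The vectors `bandVec`, normalized to have coordinate sum one. -/
def bandUnit {N : ℕ} (K : ℕ) (a : Matrix (Fin N) ℕ ℝ) (i m j : ℕ) : ℝ :=
  bandVec a i m j / ∑ q ∈ Finset.range (N + K), bandVec a i m q

lemma bandVec_sum_pos (ha : IsTotallyPositiveBand N K a) {i m : ℕ} (hm : m ≤ K)
    (him : i + m < N + K) : 0 < ∑ q ∈ Finset.range (N + K), bandVec a i m q :=
  Finset.sum_pos' (fun q _ => bandVec_nonneg ha hm q)
    ⟨i + m, Finset.mem_range.2 him, bandVec_last_pos ha hm⟩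

lemma bandUnit_eq_zero {i m j : ℕ} (h : j < i ∨ i + m < j) : bandUnit K a i m j = 0 := by
  rw [bandUnit, bandVec_eq_zero h, zero_div]

lemma bandUnit_last_pos (ha : IsTotallyPositiveBand N K a) {i m : ℕ} (hm : m ≤ K)
    (him : i + m < N + K) : 0 < bandUnit K a i m (i + m) :=
  div_pos (bandVec_last_pos ha hm) (bandVec_sum_pos ha hm him)

lemma bandUnit_sum (ha : IsTotallyPositiveBand N K a) {i m : ℕ} (hm : m ≤ K)
    (him : i + m < N + K) : ∑ j ∈ Finset.range (N + K), bandUnit K a i m j = 1 := by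
  simp only [bandUnit]
  rw [← Finset.sum_div, div_self (bandVec_sum_pos ha hm him).ne']

lemma bandUnit_top {m j : ℕ} (hm : m < K) :
    bandUnit K a N m j = if j = N + m then 1 else 0 := by
  simp [bandUnit, bandVec, hm]

/-- Row `i` is a positive combination of the unit vector `e_i` and the vectors `bandUnit` of the
row below, and the truncations of this combination are proportional to the vectors `bandUnit` of
row `i`. -/
lemma IsTotallyPositiveBand.exists_weights (ha : IsTotallyPositiveBand N K a) (i : Fin N) :
    ∃ c : ℕ → ℝ, (∀ l ≤ K, 0 < c l) ∧
      (∀ j, a i j = c 0 * (if j = i.val then 1 else 0) +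
        ∑ l ∈ Finset.range K, c (l + 1) * bandUnit K a (i.val + 1) l j) ∧
      ∀ m ≤ K, ∀ j, c 0 * (if j = i.val then 1 else 0) +
        ∑ l ∈ Finset.range m, c (l + 1) * bandUnit K a (i.val + 1) l j =
          (∑ l ∈ Finset.range (m + 1), c l) * bandUnit K a i.val m j := by
  have hi := i.2
  obtain ⟨haii, hrow⟩ := bandVec_last ha i
  have hstep : ∀ m, ∃ b : ℝ, m < K → 0 < b ∧ ∀ j, bandVec a i.val (m + 1) j =
      bandVec a i.val m j + b * bandVec a (i.val + 1) m j := by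
    intro m
    by_cases hm : m < K
    · obtain ⟨b, hb⟩ := bandVec_succ ha hi hm
      exact ⟨b, fun _ => hb⟩
    · exact ⟨0, fun h => absurd h hm⟩
  choose b hb using hstep
  -- `c 0` and `c (l + 1)` are the coefficients of the successive three-term relations, rescaled
  -- because the vectors of the row below are normalized by their coordinate sums `σ l`
  set σ : ℕ → ℝ := fun m => ∑ q ∈ Finset.range (N + K), bandVec a (i.val + 1) m q with hσ
  have hσpos : ∀ m < K, 0 < σ m := fun m hm => bandVec_sum_pos ha hm.le (by omega)
  set c : ℕ → ℝ := fun l => Nat.casesOn l (a i i.val) fun l => a i i.val * b l * σ l with hc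
  have hpart : ∀ m ≤ K, ∀ j, c 0 * (if j = i.val then 1 else 0) +
        ∑ l ∈ Finset.range m, c (l + 1) * bandUnit K a (i.val + 1) l j =
          a i i.val * bandVec a i.val m j := by
    intro m
    induction m with
    | zero =>
      intro _ j
      rw [bandVec_zero ha hi]
      simp [hc]
    | succ m ih =>
      intro hm j
      rw [Finset.sum_range_succ, ← add_assoc, ih (by omega) j, (hb m hm).2 j]
      have := hσpos m hm
      simp only [hc, bandUnit, hσ] at this ⊢
      field_simp
  have hcsum : ∀ m ≤ K, ∑ l ∈ Finset.range (m + 1), c l =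
      a i i.val * ∑ q ∈ Finset.range (N + K), bandVec a i.val m q := by
    intro m hm
    rw [Finset.mul_sum, ← Finset.sum_congr rfl fun q _ => hpart m hm q, Finset.sum_add_distrib,
      ← Finset.mul_sum, Finset.sum_ite_eq', if_pos (Finset.mem_range.2 (by omega)), mul_one,
      Finset.sum_comm, Finset.sum_range_succ', add_comm]
    congr 1
    refine Finset.sum_congr rfl fun l hl => ?_
    have := Finset.mem_range.1 hl
    rw [← Finset.mul_sum, bandUnit_sum ha (by omega) (by omega), mul_one]
  refine ⟨c, fun l hl => ?_, fun j => ?_, fun m hm j => ?_⟩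
  · cases l with
    | zero => exact haii
    | succ l => exact mul_pos (mul_pos haii (hb l hl).1) (hσpos l hl)
  · rw [hpart K le_rfl j, hrow j]
  · rw [hpart m hm j, hcsum m hm, bandUnit]
    have := bandVec_sum_pos ha hm (show i.val + m < N + K by omega)
    field_simp

end Band

/-! ### The weights of a sheet -/

/-- The matrix `A` with its columns indexed by `ℕ` and extended by zero. -/
def extendColumns (A : Matrix (Fin N) (Fin M) ℝ) : Matrix (Fin N) ℕ ℝ :=
  fun i j => if h : j < M then A i ⟨j, h⟩ else 0

lemma extendColumns_apply (A : Matrix (Fin N) (Fin M) ℝ) (i : Fin N) (j : Fin M) :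
    extendColumns A i j.val = A i j := by
  simp [extendColumns]

lemma IsNormalizedBanded.isTotallyPositiveBand (hNM : N < M) {A : Matrix (Fin N) (Fin M) ℝ}
    (hA : IsNormalizedBanded A) : IsTotallyPositiveBand N (M - N) (extendColumns A) := by
  have hM : N + (M - N) = M := by omega
  refine ⟨fun i j hij => ?_, fun s hs hs' => ?_, fun i => ?_⟩
  · unfold extendColumns
    split_ifs with h
    · exact hA.band i ⟨j, h⟩ hij
    · rfl
  · rw [hM] at hs'
    have h := hA.minor_pos (fun r => ⟨s r, hs' r⟩) (fun p q hpq => hs hpq)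
    convert h using 2
    ext p q
    simp [extendColumns, hs' q]
  · rw [hM, ← Fin.sum_univ_eq_sum_range (fun j => extendColumns A i j)]
    simp only [extendColumns_apply]
    exact hA.row_sum i

/-- The entries on the right edge of the band do not vanish. -/
lemma IsNormalizedBanded.right_ne_zero (hNM : N < M) {A : Matrix (Fin N) (Fin M) ℝ}
    (hA : IsNormalizedBanded A) (i : Fin N) (j : Fin M) (hij : j.val = i.val + (M - N)) :
    A i j ≠ 0 := by
  have h := (hA.minor_pos (fun r : Fin N => ⟨r.val + (M - N), by omega⟩)
    (fun p q hpq => Fin.lt_def.2 (by simpa using hpq))).ne'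
  rw [Matrix.det_of_isLowerTriangular] at h
  · have h2 := (Finset.prod_ne_zero_iff.1 h) i (Finset.mem_univ _)
    rwa [Matrix.submatrix_apply, show (⟨i.val + (M - N), _⟩ : Fin M) = j from Fin.ext hij.symm] at h2
  · intro p q hpq
    have hpq' : p < q := OrderDual.toDual_lt_toDual.1 hpq
    exact hA.band _ _ (Or.inr (by simpa using hpq'))

/-- The position of row `i`, column `i + l`. -/
def bandIndex (hNM : N < M) (i : Fin N) (l : Fin (M - N + 1)) : Fin M :=
  ⟨i.val + l.val, by omega⟩

/-- The position of row `i`, column `i + M - N`. -/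
def rightIndex (M : ℕ) (i : Fin N) (hNM : N < M) : Fin M := ⟨i.val + (M - N), by omega⟩

/-- The columns left of the band of row `i`, in that band, and right of it. -/
lemma sum_columns (hNM : N < M) (i : Fin N) (G : Fin M → ℝ) :
    ∑ j, G j = ∑ j : Fin i.val, G ⟨j.val, by omega⟩ + ∑ l, G (bandIndex hNM i l) +
      ∑ i' ∈ Finset.Ioi i, G (rightIndex M i' hNM) := by
  set g : ℕ → ℝ := fun j => if h : j < M then G ⟨j, h⟩ else 0 with hg
  have hgj : ∀ j (h : j < M), G ⟨j, h⟩ = g j := fun j h => by simp [hg, h]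
  have h1 : ∑ j, G j = ∑ j ∈ Finset.range M, g j := by
    rw [← Fin.sum_univ_eq_sum_range]
    exact Finset.sum_congr rfl fun j _ => hgj j.1 j.2
  have h2 : ∑ j : Fin i.val, G ⟨j.val, by omega⟩ = ∑ j ∈ Finset.range i.val, g j := by
    rw [← Fin.sum_univ_eq_sum_range]
    exact Finset.sum_congr rfl fun j _ => hgj _ _
  have h3 : ∑ l, G (bandIndex hNM i l) = ∑ l ∈ Finset.range (M - N + 1), g (i.val + l) := by
    rw [← Fin.sum_univ_eq_sum_range (fun l => g (i.val + l))]
    exact Finset.sum_congr rfl fun j _ => hgj _ _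
  have h4 : ∑ i' ∈ Finset.Ioi i, G (rightIndex M i' hNM) =
      ∑ x ∈ Finset.range (N - 1 - i.val), g (i.val + (M - N + 1) + x) := by
    refine Finset.sum_bij' (fun i' _ => i'.val - i.val - 1)
      (fun x hx => ⟨i.val + 1 + x, by have := Finset.mem_range.1 hx; omega⟩) ?_ ?_ ?_ ?_ ?_
    · intro i' hi'
      have := Fin.lt_def.1 (Finset.mem_Ioi.1 hi')
      rw [Finset.mem_range]
      omega
    · intro x hx
      rw [Finset.mem_Ioi, Fin.lt_def]
      simp only
      omega
    · intro i' hi'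
      have := Fin.lt_def.1 (Finset.mem_Ioi.1 hi')
      exact Fin.ext (by simp only; omega)
    · intro x hx
      simp only
      omega
    · intro i' hi'
      have := Fin.lt_def.1 (Finset.mem_Ioi.1 hi')
      rw [rightIndex, hgj]
      congr 1
      omega
  rw [h1, h2, h3, h4, ← Finset.sum_range_add, ← Finset.sum_range_add]
  congr 2
  have := i.2
  omega

/-- The nodes of a sheet attached to row `i`: the vector of the value at `λ_1` is `e_i`, those of
the values at `λ_2, …, λ_{M-N+1}` are given. -/
def sheetNodes (hNM : N < M) (i : Fin N) (Y : Fin (M - N) → Fin M → ℝ) :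
    Fin (M - N + 1) → Fin M → ℝ :=
  Fin.cons (Pi.single ⟨i.val, i.2.trans hNM⟩ 1) Y

/-- The square matrix whose rows are `e_j` for `j < i`, the nodes of the sheet, and the rows of `A`
below row `i`. -/
def elimMatrix (hNM : N < M) (A : Matrix (Fin N) (Fin M) ℝ) (i : Fin N)
    (Y : Fin (M - N) → Fin M → ℝ) : Matrix (Fin M) (Fin M) ℝ :=
  Matrix.of fun j => if j.val < i.val then Pi.single j 1 else
    if h : j.val - i.val < M - N + 1 then sheetNodes hNM i Y ⟨j.val - i.val, h⟩ else
      A ⟨j.val - (M - N), by omega⟩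

lemma elimMatrix_bandIndex (hNM : N < M) (A : Matrix (Fin N) (Fin M) ℝ) (i : Fin N)
    (Y : Fin (M - N) → Fin M → ℝ) (l : Fin (M - N + 1)) :
    elimMatrix hNM A i Y (bandIndex hNM i l) = sheetNodes hNM i Y l := by
  have hl : i.val + l.val - i.val = l.val := by omega
  funext q
  simp only [elimMatrix, Matrix.of_apply, bandIndex]
  rw [if_neg (by omega), dif_pos (by omega)]
  simp only [hl]

lemma elimMatrix_rightIndex (hNM : N < M) (A : Matrix (Fin N) (Fin M) ℝ) {i i' : Fin N}
    (Y : Fin (M - N) → Fin M → ℝ) (hi : i < i') :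
    elimMatrix hNM A i Y (rightIndex M i' hNM) = A i' := by
  have hi' := Fin.lt_def.1 hi
  funext q
  simp only [elimMatrix, Matrix.of_apply, rightIndex]
  rw [if_neg (by omega), dif_neg (by omega)]
  simp only [Nat.add_sub_cancel]

lemma vecMul_elimMatrix (hNM : N < M) (A : Matrix (Fin N) (Fin M) ℝ) (i : Fin N)
    (Y : Fin (M - N) → Fin M → ℝ) (x : Fin M → ℝ) (q : Fin M) :
    (Matrix.vecMul x (elimMatrix hNM A i Y)) q =
      (if q.val < i.val then x q else 0) + ∑ l, x (bandIndex hNM i l) * sheetNodes hNM i Y l q +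
        ∑ i' ∈ Finset.Ioi i, x (rightIndex M i' hNM) * A i' q := by
  change ∑ j, x j * elimMatrix hNM A i Y j q = _
  rw [sum_columns hNM i]
  congr 1
  · congr 1
    · split_ifs with hq
      · rw [Finset.sum_eq_single ⟨q.val, hq⟩]
        · simp [elimMatrix, hq]
        · intro j _ hj
          have : q ≠ ⟨j.val, by omega⟩ := fun h => hj (Fin.ext (congrArg Fin.val h).symm)
          simp [elimMatrix, this]
        · simp
      · refine Finset.sum_eq_zero fun j _ => ?_
        have : q ≠ ⟨j.val, by omega⟩ := fun h => hq (by rw [h]; exact j.2)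
        simp [elimMatrix, this]
    · refine Finset.sum_congr rfl fun l _ => ?_
      rw [elimMatrix_bandIndex]
  · refine Finset.sum_congr rfl fun i' hi' => ?_
    rw [elimMatrix_rightIndex hNM A Y (Finset.mem_Ioi.1 hi')]

/-- The coefficients that express row `i` of `A` through the rows of `elimMatrix`; meaningful only
if that matrix is invertible. -/
def elimCoeff (hNM : N < M) (A : Matrix (Fin N) (Fin M) ℝ) (i : Fin N)
    (Y : Fin (M - N) → Fin M → ℝ) : Fin M → ℝ :=
  Matrix.vecMul (A i) (elimMatrix hNM A i Y)⁻¹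

/-- The coefficients of the nodes of the sheet, normalized to have sum one. The vacuum wave function
is to be `∑ w_l y_l / (z - λ_l)` divided by `∑ w_l / (z - λ_l)`, with the weights `w` and the nodes
`y`: it then takes the value `y_l` at `λ_l` and the weighted mean `∑ w_l y_l` at infinity. -/
def sheetWeight (hNM : N < M) (A : Matrix (Fin N) (Fin M) ℝ) (i : Fin N)
    (Y : Fin (M - N) → Fin M → ℝ) (l : Fin (M - N + 1)) : ℝ :=
  elimCoeff hNM A i Y (bandIndex hNM i l) / ∑ l', elimCoeff hNM A i Y (bandIndex hNM i l')

/-- With positive coefficients the weighted mean of the nodes is the prescribed value at infinity: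
row `i` modified by the rows below it. -/
lemma sheetWeight_spec (hNM : N < M) {A : Matrix (Fin N) (Fin M) ℝ} (hA : IsNormalizedBanded A)
    (i : Fin N) (Y : Fin (M - N) → Fin M → ℝ) (hY : ∀ m j, j.val ≤ i.val → Y m j = 0)
    (hYsum : ∀ m, ∑ j, Y m j = 1) (hdet : (elimMatrix hNM A i Y).det ≠ 0)
    (hpos : ∀ l, 0 < elimCoeff hNM A i Y (bandIndex hNM i l)) :
    (∀ l, 0 < sheetWeight hNM A i Y l) ∧ ∑ l, sheetWeight hNM A i Y l = 1 ∧
      ∃ ε : Fin N → ℝ, 1 + ∑ i' ∈ Finset.Ioi i, ε i' ≠ 0 ∧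
        ∀ j, ∑ l, sheetWeight hNM A i Y l * sheetNodes hNM i Y l j =
          (A i j + ∑ i' ∈ Finset.Ioi i, ε i' * A i' j) / (1 + ∑ i' ∈ Finset.Ioi i, ε i') := by
  set x := elimCoeff hNM A i Y with hx
  have hS : 0 < ∑ l, x (bandIndex hNM i l) :=
    Finset.sum_pos (fun l _ => hpos l) Finset.univ_nonempty
  have hsol : Matrix.vecMul x (elimMatrix hNM A i Y) = A i := by
    rw [hx, elimCoeff, Matrix.vecMul_vecMul, Matrix.nonsing_inv_mul _ (isUnit_iff_ne_zero.2 hdet),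
      Matrix.vecMul_one]
  have hcol : ∀ q, (if q.val < i.val then x q else 0) +
      ∑ l, x (bandIndex hNM i l) * sheetNodes hNM i Y l q +
        ∑ i' ∈ Finset.Ioi i, x (rightIndex M i' hNM) * A i' q = A i q := fun q => by
    rw [← vecMul_elimMatrix, hsol]
  -- to the left of column `i` only the unit rows have entries
  have hx0 : ∀ q : Fin M, q.val < i.val → x q = 0 := by
    intro q hq
    have h1 := hcol q
    rw [if_pos hq, Fin.sum_univ_succ] at h1
    have h2 : ∑ i' ∈ Finset.Ioi i, x (rightIndex M i' hNM) * A i' q = 0 :=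
      Finset.sum_eq_zero fun i' hi' => by
        have := Fin.lt_def.1 (Finset.mem_Ioi.1 hi')
        rw [hA.band i' q (Or.inl (by omega)), mul_zero]
    have h3 : ∑ l : Fin (M - N), x (bandIndex hNM i l.succ) * sheetNodes hNM i Y l.succ q = 0 :=
      Finset.sum_eq_zero fun l _ => by
        simp [sheetNodes, hY l q hq.le]
    have h4 : q ≠ ⟨i.val, i.2.trans hNM⟩ := fun h => by rw [h] at hq; simp at hq
    rw [h2, h3, hA.band i q (Or.inl hq)] at h1
    simpa [sheetNodes, h4] using h1
  have hcol' : ∀ q, ∑ l, x (bandIndex hNM i l) * sheetNodes hNM i Y l q =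
      A i q + ∑ i' ∈ Finset.Ioi i, (-x (rightIndex M i' hNM)) * A i' q := by
    intro q
    have h1 := hcol q
    have h2 : (if q.val < i.val then x q else 0) = 0 := by
      split_ifs with h
      · exact hx0 q h
      · rfl
    rw [h2] at h1
    simp only [neg_mul, Finset.sum_neg_distrib]
    linarith
  have hnodes : ∀ l, ∑ j, sheetNodes hNM i Y l j = 1 := by
    intro l
    refine Fin.cases ?_ (fun l => ?_) l
    · simp [sheetNodes]
    · simpa [sheetNodes] using hYsum l
  -- all rows have sum one, which identifies the normalization of the weights with that of the value
  -- at infinity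
  have hsum : ∑ l, x (bandIndex hNM i l) = 1 + ∑ i' ∈ Finset.Ioi i, (-x (rightIndex M i' hNM)) := by
    have h1 := Finset.sum_congr rfl fun q (_ : q ∈ Finset.univ) => hcol' q
    rw [Finset.sum_comm, Finset.sum_add_distrib, Finset.sum_comm (s := Finset.univ)
      (t := Finset.Ioi i)] at h1
    simpa only [← Finset.mul_sum, hnodes, hA.row_sum, mul_one] using h1
  refine ⟨fun l => div_pos (hpos l) hS, ?_, fun i' => -x (rightIndex M i' hNM), ?_, fun j => ?_⟩
  · simp only [sheetWeight]
    rw [← Finset.sum_div, div_self hS.ne']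
  · rw [← hsum]
    exact hS.ne'
  · rw [← hsum, ← hcol', Finset.sum_div]
    exact Finset.sum_congr rfl fun l _ => by rw [sheetWeight]; ring

/-- The vectors `bandUnit`, indexed by `Fin M`. For `ξ → ∞` the nodes converge to them. -/
def limitNodes (A : Matrix (Fin N) (Fin M) ℝ) (i : ℕ) (m : Fin (M - N)) (j : Fin M) : ℝ :=
  bandUnit (M - N) (extendColumns A) i m.val j.val

/-- At the limit nodes the linear system of `elimCoeff` is triangular with nonzero diagonal, and its
solution is given by the positive weights coming from total positivity. -/
lemma elimCoeff_limit (hNM : N < M) {A : Matrix (Fin N) (Fin M) ℝ} (hA : IsNormalizedBanded A)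
    (i : Fin N) {c : ℕ → ℝ}
    (hc : ∀ j, extendColumns A i j = c 0 * (if j = i.val then 1 else 0) +
        ∑ l ∈ Finset.range (M - N), c (l + 1) *
          bandUnit (M - N) (extendColumns A) (i.val + 1) l j) :
    (elimMatrix hNM A i (limitNodes A (i.val + 1))).det ≠ 0 ∧
      ∀ l, elimCoeff hNM A i (limitNodes A (i.val + 1)) (bandIndex hNM i l) = c l.val := by
  have ha := hA.isTotallyPositiveBand hNM
  have hi := i.2
  set Y := limitNodes A (i.val + 1)
  have hdet : (elimMatrix hNM A i Y).det ≠ 0 := by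
    rw [Matrix.det_of_isLowerTriangular, Finset.prod_ne_zero_iff]
    · intro j _
      have hj := j.2
      simp only [elimMatrix, Matrix.of_apply]
      split_ifs with h1 h2
      · simp
      · by_cases h3 : j.val = i.val
        · have e1 : (⟨j.val - i.val, h2⟩ : Fin (M - N + 1)) = 0 := Fin.ext (by simp [h3])
          have e2 : (⟨i.val, i.2.trans hNM⟩ : Fin M) = j := Fin.ext h3.symm
          rw [e1, sheetNodes, Fin.cons_zero, e2]
          simp
        · have e1 : (⟨j.val - i.val, h2⟩ : Fin (M - N + 1)) =
              Fin.succ ⟨j.val - i.val - 1, by omega⟩ := Fin.ext (by simp; omega)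
          rw [e1, sheetNodes, Fin.cons_succ]
          have := bandUnit_last_pos ha (i := i.val + 1) (m := j.val - i.val - 1) (by omega) (by omega)
          rw [show i.val + 1 + (j.val - i.val - 1) = j.val by omega] at this
          exact this.ne'
      · exact hA.right_ne_zero hNM _ _ (by simp only; omega)
    · intro p q hpq
      have hpq' : p.val < q.val := OrderDual.toDual_lt_toDual.1 hpq
      have hne : q ≠ p := fun h => by rw [h] at hpq'; exact lt_irrefl _ hpq'
      simp only [elimMatrix, Matrix.of_apply]
      split_ifs with h1 h2
      · simp [hne]
      · by_cases h3 : p.val = i.val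
        · have e1 : (⟨p.val - i.val, h2⟩ : Fin (M - N + 1)) = 0 := Fin.ext (by simp [h3])
          have e2 : (⟨i.val, i.2.trans hNM⟩ : Fin M) = p := Fin.ext h3.symm
          rw [e1, sheetNodes, Fin.cons_zero, e2]
          simp [hne]
        · have e1 : (⟨p.val - i.val, h2⟩ : Fin (M - N + 1)) =
              Fin.succ ⟨p.val - i.val - 1, by omega⟩ := Fin.ext (by simp; omega)
          rw [e1, sheetNodes, Fin.cons_succ]
          exact bandUnit_eq_zero (by simp only; omega)
      · exact hA.band _ _ (Or.inr (by simp only; omega))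
  refine ⟨hdet, ?_⟩
  set x : Fin M → ℝ := fun j => if i.val ≤ j.val ∧ j.val ≤ i.val + (M - N) then c (j.val - i.val)
    else 0 with hx
  have hxb : ∀ l, x (bandIndex hNM i l) = c l.val := fun l => by
    have := l.2
    simp [hx, bandIndex]
    omega
  have hsol : Matrix.vecMul x (elimMatrix hNM A i Y) = A i := by
    funext q
    rw [vecMul_elimMatrix]
    have h1 : (if q.val < i.val then x q else 0) = 0 := by
      split_ifs with h
      · simp [hx]
        omega
      · rfl
    have h2 : ∑ i' ∈ Finset.Ioi i, x (rightIndex M i' hNM) * A i' q = 0 :=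
      Finset.sum_eq_zero fun i' hi' => by
        have := Fin.lt_def.1 (Finset.mem_Ioi.1 hi')
        have : x (rightIndex M i' hNM) = 0 := by
          simp [hx, rightIndex]
          omega
        rw [this, zero_mul]
    rw [h1, h2, Fin.sum_univ_succ, ← extendColumns_apply A i q, hc,
      ← Fin.sum_univ_eq_sum_range (fun l => c (l + 1) *
          bandUnit (M - N) (extendColumns A) (i.val + 1) l q.val)]
    simp only [hxb, sheetNodes, Fin.cons_zero, Fin.cons_succ, Fin.val_zero, Fin.val_succ, zero_add,
      add_zero]
    congr 2
    simp [Pi.single_apply, Fin.ext_iff]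
  intro l
  rw [elimCoeff, ← hsol, Matrix.vecMul_vecMul, Matrix.mul_nonsing_inv _ (isUnit_iff_ne_zero.2 hdet),
    Matrix.vecMul_one, hxb]

/-- Continuity of the solution of the linear system. -/
lemma tendsto_elimCoeff (hNM : N < M) (A : Matrix (Fin N) (Fin M) ℝ) (i : Fin N)
    {Y : ℝ → Fin (M - N) → Fin M → ℝ} {Y₀ : Fin (M - N) → Fin M → ℝ}
    (hY : Tendsto Y atTop (𝓝 Y₀)) (hdet : (elimMatrix hNM A i Y₀).det ≠ 0) :
    Tendsto (fun ξ => (elimMatrix hNM A i (Y ξ)).det) atTop (𝓝 (elimMatrix hNM A i Y₀).det) ∧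
      Tendsto (fun ξ => elimCoeff hNM A i (Y ξ)) atTop (𝓝 (elimCoeff hNM A i Y₀)) := by
  have hcont : Continuous fun Y : Fin (M - N) → Fin M → ℝ => elimMatrix hNM A i Y := by
    refine continuous_matrix fun p q => ?_
    simp only [elimMatrix, Matrix.of_apply]
    split_ifs with h1 h2
    · exact continuous_const
    · generalize (⟨p.val - i.val, h2⟩ : Fin (M - N + 1)) = l
      refine Fin.cases ?_ (fun l => ?_) l
      · simp only [sheetNodes, Fin.cons_zero]
        exact continuous_const
      · simp only [sheetNodes, Fin.cons_succ]
        fun_prop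
    · exact continuous_const
  have h1 := (hcont.tendsto Y₀).comp hY
  have h2 := ((continuous_id.matrix_det).tendsto (elimMatrix hNM A i Y₀)).comp h1
  have h3 := ((continuous_id.matrix_adjugate).tendsto (elimMatrix hNM A i Y₀)).comp h1
  refine ⟨h2, ?_⟩
  have h4 : Tendsto (fun ξ => (elimMatrix hNM A i (Y ξ))⁻¹) atTop
      (𝓝 (elimMatrix hNM A i Y₀)⁻¹) := by
    simp only [Matrix.inv_def, Ring.inverse_eq_inv']
    exact (h2.inv₀ hdet).smul h3
  have hcont2 : Continuous fun G : Matrix (Fin M) (Fin M) ℝ => Matrix.vecMul (A i) G :=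
    continuous_const.matrix_vecMul continuous_id
  exact (hcont2.tendsto _).comp h4

/-! ### The sheets for large `ξ` -/

/-- Geometric separation: `|λ_1|, …, |λ_{m+1}|` are negligible against `α_{m+2}`, which is
negligible against the following `|λ_l|`. -/
lemma tendsto_alp_div (m l : ℕ) :
    Tendsto (fun ξ : ℝ => alp ξ (m + 2) / (alp ξ (m + 2) - lam ξ (l + 1))) atTop
      (𝓝 (if l ≤ m then 1 else 0)) := by
  rcases Nat.eq_zero_or_pos l with rfl | hl
  · rw [if_pos (Nat.zero_le _)]
    refine tendsto_const_nhds.congr' ?_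
    filter_upwards [eventually_gt_atTop 1] with ξ hξ
    rw [zero_add, lam_one, sub_zero, div_self (alp_pos hξ (by omega)).ne']
  · have key : ∀ᶠ ξ : ℝ in atTop, (1 + ξ ^ (2 * ((l : ℤ) - m) - 1))⁻¹ =
        alp ξ (m + 2) / (alp ξ (m + 2) - lam ξ (l + 1)) := by
      filter_upwards [eventually_gt_atTop 1] with ξ hξ
      have h0 : 0 < ξ := by linarith
      have h1 : alp ξ (m + 2) ≠ 0 := (alp_pos hξ (by omega)).ne'
      have h2 : lam ξ (l + 1) = -(alp ξ (m + 2) * ξ ^ (2 * ((l : ℤ) - m) - 1)) := by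
        rw [lam, alp, if_neg (by omega), if_neg (by omega), ← zpow_add₀ h0.ne', ← zpow_natCast]
        congr 2
        push_cast [show l + 1 - 2 = l - 1 by omega, Nat.cast_sub hl]
        ring
      rw [h2, sub_neg_eq_add, ← mul_one_add, ← div_div, div_self h1, one_div]
    refine Tendsto.congr' key ?_
    split_ifs with h
    · have h1 : Tendsto (fun ξ : ℝ => ξ ^ (2 * ((l : ℤ) - m) - 1)) atTop (𝓝 0) :=
        tendsto_zpow_atTop_zero (by omega)
      simpa using (h1.const_add 1).inv₀ (by norm_num)
    · obtain ⟨n, hn⟩ : ∃ n : ℕ, 2 * ((l : ℤ) - m) - 1 = (n + 1 : ℕ) :=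
        ⟨2 * (l - m) - 2, by omega⟩
      simp only [hn, zpow_natCast]
      exact (tendsto_atTop_add_const_left _ 1 (tendsto_pow_atTop (Nat.succ_ne_zero n))).inv_tendsto_atTop

/-- The vectors of the values at `α_2, …, α_{M-N+1}` of a function on a sheet with the weights `w`
and the nodes `y`. -/
def nextNodes (ξ : ℝ) (w : Fin (M - N + 1) → ℝ) (y : Fin (M - N + 1) → Fin M → ℝ)
    (m : Fin (M - N)) (j : Fin M) : ℝ :=
  (∑ l, w l / (alp ξ (m.val + 2) - lam ξ (l.val + 1)) * y l j) /
    ∑ l, w l / (alp ξ (m.val + 2) - lam ξ (l.val + 1))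

lemma tendsto_sheetWeight (hNM : N < M) {A : Matrix (Fin N) (Fin M) ℝ} {i : Fin N}
    {Y : ℝ → Fin (M - N) → Fin M → ℝ} {c : ℕ → ℝ} (hc : ∀ l ≤ M - N, 0 < c l)
    (h : ∀ l, Tendsto (fun ξ => elimCoeff hNM A i (Y ξ) (bandIndex hNM i l)) atTop (𝓝 (c l.val)))
    (l : Fin (M - N + 1)) :
    Tendsto (fun ξ => sheetWeight hNM A i (Y ξ) l) atTop
      (𝓝 (c l.val / ∑ l : Fin (M - N + 1), c l.val)) :=
  (h l).div (tendsto_finsetSum _ fun l' _ => h l')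
    (Finset.sum_pos (fun (l' : Fin (M - N + 1)) _ => hc l'.val (by omega)) Finset.univ_nonempty).ne'

/-- One step of the construction: if the nodes converge to the vectors of total positivity of row
`i + 1`, then for large `ξ` the weights of the sheet are positive, and the nodes of the next sheet
converge to the vectors of row `i`. -/
lemma sheet_limit (hNM : N < M) {A : Matrix (Fin N) (Fin M) ℝ} (hA : IsNormalizedBanded A)
    (i : Fin N) {Y : ℝ → Fin (M - N) → Fin M → ℝ}
    (hY : Tendsto Y atTop (𝓝 (limitNodes A (i.val + 1)))) :
    (∀ᶠ ξ in atTop, (elimMatrix hNM A i (Y ξ)).det ≠ 0 ∧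
        ∀ l, 0 < elimCoeff hNM A i (Y ξ) (bandIndex hNM i l)) ∧
      Tendsto (fun ξ => nextNodes ξ (sheetWeight hNM A i (Y ξ)) (sheetNodes hNM i (Y ξ))) atTop
        (𝓝 (limitNodes A i.val)) := by
  obtain ⟨c, hcpos, hc, hpart⟩ := (hA.isTotallyPositiveBand hNM).exists_weights i
  obtain ⟨hdet, hcoef⟩ := elimCoeff_limit hNM hA i hc
  obtain ⟨h1, h2⟩ := tendsto_elimCoeff hNM A i hY hdet
  have h3 : ∀ l, Tendsto (fun ξ => elimCoeff hNM A i (Y ξ) (bandIndex hNM i l)) atTop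
      (𝓝 (c l.val)) := fun l => by
    rw [← hcoef l]
    exact (tendsto_pi_nhds.1 h2) _
  refine ⟨(h1.eventually_ne hdet).and (eventually_all.2 fun l =>
    (h3 l).eventually (lt_mem_nhds (hcpos _ (by omega)))), ?_⟩
  set S := ∑ l : Fin (M - N + 1), c l.val with hS
  have hSpos : 0 < S := Finset.sum_pos (fun l' _ => hcpos l' (by omega)) Finset.univ_nonempty
  have hw := tendsto_sheetWeight hNM hcpos h3
  have hnode : ∀ l j, Tendsto (fun ξ => sheetNodes hNM i (Y ξ) l j) atTop
      (𝓝 (sheetNodes hNM i (limitNodes A (i.val + 1)) l j)) := by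
    intro l j
    refine Fin.cases ?_ (fun l => ?_) l
    · simp only [sheetNodes, Fin.cons_zero]
      exact tendsto_const_nhds
    · simp only [sheetNodes, Fin.cons_succ]
      exact (tendsto_pi_nhds.1 ((tendsto_pi_nhds.1 hY) l)) j
  refine tendsto_pi_nhds.2 fun m => tendsto_pi_nhds.2 fun j => ?_
  have hm := m.2
  -- sums over the nodes with the limit weights of geometric separation are truncated sums
  have htrunc : ∀ f : ℕ → ℝ, ∑ l : Fin (M - N + 1), f l.val * (if l.val ≤ m.val then 1 else 0) =
      ∑ l ∈ Finset.range (m.val + 1), f l := by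
    intro f
    rw [Fin.sum_univ_eq_sum_range (fun l => f l * (if l ≤ m.val then 1 else 0))]
    simp only [mul_ite, mul_one, mul_zero]
    rw [← Finset.sum_filter]
    congr 1
    ext l
    simp only [Finset.mem_filter, Finset.mem_range]
    omega
  have hden : Tendsto (fun ξ => ∑ l, sheetWeight hNM A i (Y ξ) l *
      (alp ξ (m.val + 2) / (alp ξ (m.val + 2) - lam ξ (l.val + 1)))) atTop
      (𝓝 ((∑ l ∈ Finset.range (m.val + 1), c l) / S)) := by
    rw [← htrunc c, Finset.sum_div]
    refine tendsto_finsetSum _ fun l _ => ?_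
    have := (hw l).mul (tendsto_alp_div m.val l.val)
    rwa [div_mul_eq_mul_div] at this
  have hnum : Tendsto (fun ξ => ∑ l, sheetWeight hNM A i (Y ξ) l *
      (alp ξ (m.val + 2) / (alp ξ (m.val + 2) - lam ξ (l.val + 1))) * sheetNodes hNM i (Y ξ) l j)
      atTop (𝓝 ((∑ l ∈ Finset.range (m.val + 1), c l) * limitNodes A i.val m j / S)) := by
    have hlim : (∑ l ∈ Finset.range (m.val + 1), c l) * limitNodes A i.val m j =
        ∑ l : Fin (M - N + 1), c l.val * (if l.val ≤ m.val then 1 else 0) *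
          sheetNodes hNM i (limitNodes A (i.val + 1)) l j := by
      rw [limitNodes, ← hpart m.val (by omega) j.val, Fin.sum_univ_succ]
      congr 1
      · simp [sheetNodes, Pi.single_apply, Fin.ext_iff]
      · have := Fin.sum_univ_eq_sum_range (fun l => c (l + 1) * (if l + 1 ≤ m.val then 1 else 0) *
          bandUnit (M - N) (extendColumns A) (i.val + 1) l j.val) (M - N)
        simp only [sheetNodes, Fin.cons_succ, Fin.val_succ, limitNodes]
        rw [this]
        simp only [mul_ite, mul_one, mul_zero, ite_mul, zero_mul]
        rw [← Finset.sum_filter]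
        refine Finset.sum_congr ?_ fun l _ => rfl
        ext l
        simp only [Finset.mem_filter, Finset.mem_range]
        omega
    rw [hlim, Finset.sum_div]
    refine tendsto_finsetSum _ fun l _ => ?_
    have := ((hw l).mul (tendsto_alp_div m.val l.val)).mul (hnode l j)
    convert this using 2
    ring
  have hne : (∑ l ∈ Finset.range (m.val + 1), c l) ≠ 0 :=
    (Finset.sum_pos (fun l hl => hcpos l (by have := Finset.mem_range.1 hl; omega)) (by simp)).ne'
  have hlim := hnum.div hden (div_ne_zero hne hSpos.ne')
  have hval : (∑ l ∈ Finset.range (m.val + 1), c l) * limitNodes A i.val m j / S /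
      ((∑ l ∈ Finset.range (m.val + 1), c l) / S) = limitNodes A i.val m j := by
    field_simp
  rw [hval] at hlim
  refine hlim.congr' ?_
  filter_upwards [eventually_gt_atTop 1] with ξ hξ
  have hα : alp ξ (m.val + 2) ≠ 0 := (alp_pos hξ (by omega)).ne'
  have e1 : ∀ l, sheetWeight hNM A i (Y ξ) l *
      (alp ξ (m.val + 2) / (alp ξ (m.val + 2) - lam ξ (l.val + 1))) =
      alp ξ (m.val + 2) *
        (sheetWeight hNM A i (Y ξ) l / (alp ξ (m.val + 2) - lam ξ (l.val + 1))) :=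
    fun l => by ring
  simp only [Pi.div_apply, e1, nextNodes]
  simp only [mul_assoc (alp ξ (m.val + 2))]
  rw [← Finset.mul_sum, ← Finset.mul_sum, mul_div_mul_left _ _ hα]

/-- The vectors of the values of the vacuum wave function at `λ_2, …, λ_{M-N+1}` on the sheet
`Γ_{r+1}`: unit vectors for `Γ_1`, by the gluing to `Γ_0`, and for the other sheets the values at
`α_2, …, α_{M-N+1}` on the preceding sheet. -/
def chainNodes (hNM : N < M) (A : Matrix (Fin N) (Fin M) ℝ) (ξ : ℝ) :
    ℕ → Fin (M - N) → Fin M → ℝ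
  | 0 => fun l => Pi.single ⟨N + l.val, by omega⟩ 1
  | r + 1 => if h : r < N then
      nextNodes ξ (sheetWeight hNM A (Fin.rev ⟨r, h⟩) (chainNodes hNM A ξ r))
        (sheetNodes hNM (Fin.rev ⟨r, h⟩) (chainNodes hNM A ξ r)) else 0

lemma chainNodes_succ (hNM : N < M) (A : Matrix (Fin N) (Fin M) ℝ) (ξ : ℝ) (r : Fin N) :
    chainNodes hNM A ξ (r.val + 1) =
      nextNodes ξ (sheetWeight hNM A r.rev (chainNodes hNM A ξ r.val))
        (sheetNodes hNM r.rev (chainNodes hNM A ξ r.val)) := by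
  rw [chainNodes, dif_pos r.2]

lemma chainNodes_eq_zero (hNM : N < M) (A : Matrix (Fin N) (Fin M) ℝ) (ξ : ℝ) {r : ℕ}
    (hr : r ≤ N) (m : Fin (M - N)) (j : Fin M) (hj : j.val + r < N) :
    chainNodes hNM A ξ r m j = 0 := by
  induction r generalizing m j with
  | zero =>
    have : j ≠ ⟨N + m.val, by omega⟩ := fun h => by rw [h] at hj; simp at hj
    simp [chainNodes, this]
  | succ r ih =>
    rw [chainNodes_succ hNM A ξ ⟨r, hr⟩, nextNodes, Fin.sum_univ_succ]
    have h1 : j ≠ ⟨(Fin.rev ⟨r, hr⟩ : Fin N).val, by omega⟩ := fun h => by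
      rw [h] at hj; simp at hj; omega
    have h2 : ∀ l, chainNodes hNM A ξ r l j = 0 := fun l => ih (by omega) l j (by omega)
    have h3 : (Pi.single ⟨(Fin.rev ⟨r, hr⟩ : Fin N).val, by omega⟩ 1 : Fin M → ℝ) j = 0 :=
      Pi.single_eq_of_ne h1 _
    simp only [sheetNodes, Fin.cons_zero, Fin.cons_succ, h2, h3, mul_zero, Finset.sum_const_zero,
      add_zero, zero_div]

/-- The limits of the nodes, row by row from the last one upwards: sheet `Γ_{r+1}` starts from the
vectors of row `N - r` (counted from `0`). -/
lemma tendsto_chainNodes (hNM : N < M) {A : Matrix (Fin N) (Fin M) ℝ} (hA : IsNormalizedBanded A)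
    {r : ℕ} (hr : r ≤ N) :
    Tendsto (fun ξ => chainNodes hNM A ξ r) atTop (𝓝 (limitNodes A (N - r))) := by
  induction r with
  | zero =>
    have : (fun ξ => chainNodes hNM A ξ 0) = fun _ => limitNodes A (N - 0) := by
      funext ξ m j
      rw [limitNodes, Nat.sub_zero, bandUnit_top m.2]
      simp [chainNodes, Pi.single_apply, Fin.ext_iff]
    rw [this]
    exact tendsto_const_nhds
  | succ r ih =>
    have h1 := ih (by omega)
    rw [show N - r = (Fin.rev ⟨r, hr⟩ : Fin N).val + 1 by simp; omega] at h1
    have h2 := (sheet_limit hNM hA (Fin.rev ⟨r, hr⟩) h1).2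
    rw [show N - (r + 1) = (Fin.rev ⟨r, hr⟩ : Fin N).val by simp]
    simpa only [chainNodes_succ hNM A _ ⟨r, hr⟩] using h2

lemma nextNodes_sum {ξ : ℝ} (hξ : 1 < ξ) {w : Fin (M - N + 1) → ℝ}
    {y : Fin (M - N + 1) → Fin M → ℝ} (hw : ∀ l, 0 < w l) (hy : ∀ l, ∑ j, y l j = 1)
    (m : Fin (M - N)) : ∑ j, nextNodes ξ w y m j = 1 := by
  have hS : 0 < ∑ l, w l / (alp ξ (m.val + 2) - lam ξ (l.val + 1)) :=
    Finset.sum_pos (fun l _ => div_pos (hw l) (by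
      have := alp_pos hξ (show 2 ≤ m.val + 2 by omega)
      have := lam_nonpos hξ (l.val + 1)
      linarith)) Finset.univ_nonempty
  simp only [nextNodes]
  rw [← Finset.sum_div, Finset.sum_comm]
  simp only [← Finset.mul_sum, hy, mul_one]
  exact div_self hS.ne'

/-- For large `ξ` all weights are positive and the values at infinity are as prescribed. -/
lemma eventually_sheetWeight (hNM : N < M) {A : Matrix (Fin N) (Fin M) ℝ}
    (hA : IsNormalizedBanded A) : ∀ᶠ ξ : ℝ in atTop, ∀ r : Fin N,
      (∀ l, 0 < sheetWeight hNM A r.rev (chainNodes hNM A ξ r.val) l) ∧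
      ∑ l, sheetWeight hNM A r.rev (chainNodes hNM A ξ r.val) l = 1 ∧
      ∃ ε : Fin N → ℝ, 1 + ∑ i' ∈ Finset.Ioi r.rev, ε i' ≠ 0 ∧
        ∀ j, ∑ l, sheetWeight hNM A r.rev (chainNodes hNM A ξ r.val) l *
            sheetNodes hNM r.rev (chainNodes hNM A ξ r.val) l j =
          (A r.rev j + ∑ i' ∈ Finset.Ioi r.rev, ε i' * A i' j) /
            (1 + ∑ i' ∈ Finset.Ioi r.rev, ε i') := by
  have h1 : ∀ᶠ ξ : ℝ in atTop, ∀ r : Fin N,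
      (elimMatrix hNM A r.rev (chainNodes hNM A ξ r.val)).det ≠ 0 ∧
        ∀ l, 0 < elimCoeff hNM A r.rev (chainNodes hNM A ξ r.val) (bandIndex hNM r.rev l) := by
    refine eventually_all.2 fun r => ?_
    have h2 := tendsto_chainNodes hNM hA r.2.le
    rw [show N - r.val = r.rev.val + 1 by rw [Fin.val_rev]; omega] at h2
    exact (sheet_limit hNM hA r.rev h2).1
  filter_upwards [h1, eventually_gt_atTop 1] with ξ h hξ
  have hzero : ∀ (r : Fin N) m j, j.val ≤ r.rev.val → chainNodes hNM A ξ r.val m j = 0 := by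
    intro r m j hj
    rw [Fin.val_rev] at hj
    exact chainNodes_eq_zero hNM A ξ r.2.le m j (by omega)
  have hsum : ∀ (r : ℕ) (hr : r < N) m, ∑ j, chainNodes hNM A ξ r m j = 1 := by
    intro r
    induction r with
    | zero => intro _ m; simp [chainNodes]
    | succ r ih =>
      intro hr m
      have hr' : r < N := by omega
      have hspec := sheetWeight_spec hNM hA (Fin.rev ⟨r, hr'⟩) _ (hzero ⟨r, hr'⟩) (ih hr')
        (h ⟨r, hr'⟩).1 (h ⟨r, hr'⟩).2
      rw [chainNodes_succ hNM A ξ ⟨r, hr'⟩]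
      refine nextNodes_sum hξ hspec.1 (fun l => ?_) m
      refine Fin.cases ?_ (fun l => ?_) l
      · simp [sheetNodes]
      · simpa [sheetNodes] using ih hr' l
  exact fun r => sheetWeight_spec hNM hA r.rev _ (hzero r) (hsum r.1 r.2) (h r).1 (h r).2

/-! ### Construction of a vacuum wave function -/

/-- The product of all `X - λ_m`, `1 ≤ m ≤ n + 1`, except for the factor with index `l` (counted
from `0`). -/
def nodeProd (ξ : ℝ) {n : ℕ} (l : Fin (n + 1)) : ℝ[X] :=
  ∏ m ∈ Finset.univ.erase l, (X - C (lam ξ (m.val + 1)))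

lemma nodeProd_monic (ξ : ℝ) {n : ℕ} (l : Fin (n + 1)) : (nodeProd ξ l).Monic :=
  monic_prod_of_monic _ _ fun _ _ => monic_X_sub_C _

lemma nodeProd_natDegree (ξ : ℝ) {n : ℕ} (l : Fin (n + 1)) : (nodeProd ξ l).natDegree = n := by
  rw [nodeProd, natDegree_prod_of_monic _ _ fun _ _ => monic_X_sub_C _]
  simp

lemma eval_nodeProd (ξ : ℝ) {n : ℕ} (l : Fin (n + 1)) (x : ℝ) :
    (nodeProd ξ l).eval x = ∏ m ∈ Finset.univ.erase l, (x - lam ξ (m.val + 1)) := by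
  simp [nodeProd, eval_prod]

lemma eval_nodeProd_of_ne (ξ : ℝ) {n : ℕ} {l m : Fin (n + 1)} (h : m ≠ l) :
    (nodeProd ξ l).eval (lam ξ (m.val + 1)) = 0 := by
  rw [eval_nodeProd]
  exact Finset.prod_eq_zero (Finset.mem_erase.2 ⟨h, Finset.mem_univ _⟩) (sub_self _)

lemma eval_nodeProd_self_ne_zero {ξ : ℝ} (hξ : 1 < ξ) {n : ℕ} (l : Fin (n + 1)) :
    (nodeProd ξ l).eval (lam ξ (l.val + 1)) ≠ 0 := by
  rw [eval_nodeProd, Finset.prod_ne_zero_iff]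
  intro m hm
  exact sub_ne_zero.2 fun h => (Finset.ne_of_mem_erase hm) (lam_injective hξ _ h).symm

lemma coeff_nodeProd (ξ : ℝ) {n : ℕ} (l : Fin (n + 1)) : (nodeProd ξ l).coeff n = 1 := by
  have := (nodeProd_monic ξ l).coeff_natDegree
  rwa [nodeProd_natDegree] at this

lemma eval_sum_nodeProd (ξ : ℝ) {n : ℕ} (w : Fin (n + 1) → ℝ) (l : Fin (n + 1)) :
    (∑ m, C (w m) * nodeProd ξ m).eval (lam ξ (l.val + 1)) =
      w l * (nodeProd ξ l).eval (lam ξ (l.val + 1)) := by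
  rw [eval_finsetSum, Finset.sum_eq_single l]
  · simp
  · intro m _ hm
    rw [eval_mul, eval_nodeProd_of_ne ξ hm.symm, mul_zero]
  · simp

lemma natDegree_sum_nodeProd_le (ξ : ℝ) {n : ℕ} (w : Fin (n + 1) → ℝ) :
    (∑ m, C (w m) * nodeProd ξ m).natDegree ≤ n :=
  natDegree_sum_le_of_forall_le _ _ fun m _ =>
    (natDegree_C_mul_le _ _).trans (nodeProd_natDegree ξ m).le

lemma coeff_sum_nodeProd (ξ : ℝ) {n : ℕ} (w : Fin (n + 1) → ℝ) :
    (∑ m, C (w m) * nodeProd ξ m).coeff n = ∑ m, w m := by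
  simp [finsetSum_coeff, coeff_nodeProd]

/-- With positive weights the polynomial `∑ w_l ∏_{m ≠ l} (X - λ_m)` changes sign between
consecutive points `λ_l`, so its zeros interlace these points. -/
lemma exists_poles {ξ : ℝ} (hξ : 1 < ξ) {n : ℕ} (w : Fin (n + 1) → ℝ) (hw : ∀ l, 0 < w l)
    (hsum : ∑ l, w l = 1) : ∃ b : Fin n → ℝ,
      (∀ i, b i ∈ Set.Ioo (lam ξ (i.val + 2)) (lam ξ (i.val + 1))) ∧
        polePoly b = ∑ l, C (w l) * nodeProd ξ l := by
  set R : ℝ[X] := ∑ l, C (w l) * nodeProd ξ l with hR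
  have hex : ∀ i : Fin n, ∃ x ∈ Set.Ioo (lam ξ (i.val + 2)) (lam ξ (i.val + 1)), R.eval x = 0 := by
    intro i
    have h1 : R.eval (lam ξ (i.val + 1)) = w i.castSucc * ((lam ξ (i.val + 1) - lam ξ (i.val + 2)) *
        ∏ m ∈ (Finset.univ.erase i.castSucc).erase i.succ,
          (lam ξ (i.val + 1) - lam ξ (m.val + 1))) := by
      have := eval_sum_nodeProd ξ w i.castSucc
      rw [eval_nodeProd, ← Finset.mul_prod_erase _ _ (Finset.mem_erase.2
        ⟨(Fin.castSucc_lt_succ (i := i)).ne', Finset.mem_univ _⟩)] at this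
      simpa using this
    have h2 : R.eval (lam ξ (i.val + 2)) = w i.succ * ((lam ξ (i.val + 2) - lam ξ (i.val + 1)) *
        ∏ m ∈ (Finset.univ.erase i.castSucc).erase i.succ,
          (lam ξ (i.val + 2) - lam ξ (m.val + 1))) := by
      have := eval_sum_nodeProd ξ w i.succ
      rw [eval_nodeProd, ← Finset.mul_prod_erase _ _ (Finset.mem_erase.2
        ⟨(Fin.castSucc_lt_succ (i := i)).ne, Finset.mem_univ _⟩), Finset.erase_right_comm] at this
      simpa using this
    have hlt : lam ξ (i.val + 2) < lam ξ (i.val + 1) := lam_lt hξ (by omega) (by omega)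
    have h3 : 0 < (∏ m ∈ (Finset.univ.erase i.castSucc).erase i.succ,
          (lam ξ (i.val + 1) - lam ξ (m.val + 1))) *
        ∏ m ∈ (Finset.univ.erase i.castSucc).erase i.succ,
          (lam ξ (i.val + 2) - lam ξ (m.val + 1)) := by
      rw [← Finset.prod_mul_distrib]
      refine Finset.prod_pos fun m hm => ?_
      have e1 : m.val ≠ i.val + 1 := fun h => (Finset.ne_of_mem_erase hm) (Fin.ext (by simp [h]))
      have e2 : m.val ≠ i.val := fun h =>
        (Finset.ne_of_mem_erase (Finset.mem_of_mem_erase hm)) (Fin.ext (by simp [h]))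
      rcases lt_or_gt_of_ne e2 with h | h
      · have := lam_lt hξ (show 1 ≤ m.val + 1 by omega) (show m.val + 1 < i.val + 1 by omega)
        exact mul_pos_of_neg_of_neg (by linarith) (by linarith)
      · have := lam_lt hξ (show 1 ≤ i.val + 2 by omega) (show i.val + 2 < m.val + 1 by omega)
        exact mul_pos (by linarith) (by linarith)
    have h4 : R.eval (lam ξ (i.val + 2)) * R.eval (lam ξ (i.val + 1)) < 0 := by
      rw [h1, h2]
      have h5 := mul_pos (mul_pos (hw i.castSucc) (hw i.succ))
        (mul_pos (mul_pos (sub_pos.2 hlt) (sub_pos.2 hlt)) h3)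
      linarith
    have hcont : ContinuousOn (fun x => R.eval x) (Set.Icc (lam ξ (i.val + 2)) (lam ξ (i.val + 1))) :=
      R.continuous.continuousOn
    rcases mul_neg_iff.1 h4 with ⟨ha, hc⟩ | ⟨ha, hc⟩
    · obtain ⟨x, hx, hx0⟩ := intermediate_value_Ioo' hlt.le hcont ⟨hc, ha⟩
      exact ⟨x, hx, hx0⟩
    · obtain ⟨x, hx, hx0⟩ := intermediate_value_Ioo hlt.le hcont ⟨ha, hc⟩
      exact ⟨x, hx, hx0⟩
  choose b hb hb0 using hex
  refine ⟨b, hb, ?_⟩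
  have hbinj : Function.Injective b := by
    have key : ∀ i j : Fin n, i.val < j.val → b j < b i := fun i j hij => by
      have := lam_le hξ (show 1 ≤ i.val + 2 by omega) (show i.val + 2 ≤ j.val + 1 by omega)
      linarith [(hb i).1, (hb j).2]
    intro i j hij
    rcases lt_trichotomy i.val j.val with h | h | h
    · exact absurd hij (key i j h).ne'
    · exact Fin.ext h
    · exact absurd hij (key j i h).ne
  refine sub_eq_zero.1 (Polynomial.eq_zero_of_degree_lt_of_eval_index_eq_zero Finset.univ (v := b)
    hbinj.injOn ?_ fun i _ => ?_)
  · rw [Finset.card_univ, Fintype.card_fin, degree_lt_iff_coeff_zero]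
    intro m hm
    rcases hm.eq_or_lt with rfl | hm
    · have h1 := (polePoly_monic b).coeff_natDegree
      rw [polePoly_natDegree] at h1
      rw [coeff_sub, h1, coeff_sum_nodeProd, hsum, sub_self]
    · rw [coeff_sub, coeff_eq_zero_of_natDegree_lt (by rwa [polePoly_natDegree]),
        coeff_eq_zero_of_natDegree_lt ((natDegree_sum_nodeProd_le ξ w).trans_lt hm), sub_zero]
  · rw [eval_sub, hb0, sub_zero, eval_polePoly]
    exact Finset.prod_eq_zero (Finset.mem_univ i) (sub_self _)

/-- Sato's vacuum wave function on `Γ_0`; on the sheets `Γ_1, …, Γ_N` the function with the poles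
`b` and with the combination of the `e^{θ(k_j)}` with coefficients `p r j` as its numerator. -/
def waveFunction (k : Fin M → ℝ) (b : Fin N → Fin (M - N) → ℝ) (p : Fin N → Fin M → ℝ[X])
    (r : Fin (N + 1)) (z : ℂ) (t : Times) : ℂ :=
  Fin.cases (motive := fun _ => ℂ) (Complex.exp (theta z t))
    (fun r => (∑ j, aeval z (p r j) * ((Real.exp (theta (k j) t) : ℝ) : ℂ)) / ∏ n, (z - b r n)) r

lemma waveFunction_real (k : Fin M → ℝ) (b : Fin N → Fin (M - N) → ℝ) (p : Fin N → Fin M → ℝ[X])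
    (r : Fin N) (x : ℝ) (t : Times) : waveFunction k b p r.succ x t =
      ((∑ j, (p r j).eval x / (polePoly (b r)).eval x * Real.exp (theta (k j) t) : ℝ) : ℂ) := by
  simp only [waveFunction, Fin.cases_succ]
  rw [← aeval_polePoly, aeval_ofReal, Finset.sum_div]
  push_cast
  refine Finset.sum_congr rfl fun j _ => ?_
  rw [aeval_ofReal]
  ring

/-- The value away from the nodes of a quotient of two combinations of the polynomials
`nodeProd`. -/
lemma eval_sum_nodeProd_div {ξ : ℝ} {n : ℕ} (w y : Fin (n + 1) → ℝ) {x : ℝ}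
    (hx : ∀ l : Fin (n + 1), x - lam ξ (l.val + 1) ≠ 0) :
    (∑ l, C (w l * y l) * nodeProd ξ l).eval x / (∑ l, C (w l) * nodeProd ξ l).eval x =
      (∑ l, w l / (x - lam ξ (l.val + 1)) * y l) / ∑ l, w l / (x - lam ξ (l.val + 1)) := by
  set Λ : ℝ := ∏ l : Fin (n + 1), (x - lam ξ (l.val + 1)) with hΛ
  have hΛ0 : Λ ≠ 0 := Finset.prod_ne_zero_iff.2 fun l _ => hx l
  have h1 : ∀ l : Fin (n + 1), (nodeProd ξ l).eval x = Λ / (x - lam ξ (l.val + 1)) := by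
    intro l
    rw [eval_nodeProd, eq_div_iff (hx l), mul_comm, hΛ, Finset.mul_prod_erase _ (fun l : Fin (n + 1)
      => x - lam ξ (l.val + 1)) (Finset.mem_univ l)]
  have h2 : (∑ l, C (w l * y l) * nodeProd ξ l).eval x =
      Λ * ∑ l, w l / (x - lam ξ (l.val + 1)) * y l := by
    rw [eval_finsetSum, Finset.mul_sum]
    refine Finset.sum_congr rfl fun l _ => ?_
    rw [eval_mul, eval_C, h1]
    ring
  have h3 : (∑ l, C (w l) * nodeProd ξ l).eval x =
      Λ * ∑ l, w l / (x - lam ξ (l.val + 1)) := by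
    rw [eval_finsetSum, Finset.mul_sum]
    refine Finset.sum_congr rfl fun l _ => ?_
    rw [eval_mul, eval_C, h1]
    ring
  rw [h2, h3, mul_div_mul_left _ _ hΛ0]

/-- Positive weights with the prescribed weighted means of the nodes give a vacuum wave function:
on each sheet the rational function with the residues given by the weights. -/
lemma exists_vacuumWave (hNM : N < M) {A : Matrix (Fin N) (Fin M) ℝ} {ξ : ℝ} (hξ : 1 < ξ)
    (k : Fin M → ℝ)
    (h : ∀ r : Fin N,
      (∀ l, 0 < sheetWeight hNM A r.rev (chainNodes hNM A ξ r.val) l) ∧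
      ∑ l, sheetWeight hNM A r.rev (chainNodes hNM A ξ r.val) l = 1 ∧
      ∃ ε : Fin N → ℝ, 1 + ∑ i' ∈ Finset.Ioi r.rev, ε i' ≠ 0 ∧
        ∀ j, ∑ l, sheetWeight hNM A r.rev (chainNodes hNM A ξ r.val) l *
            sheetNodes hNM r.rev (chainNodes hNM A ξ r.val) l j =
          (A r.rev j + ∑ i' ∈ Finset.Ioi r.rev, ε i' * A i' j) /
            (1 + ∑ i' ∈ Finset.Ioi r.rev, ε i')) :
    ∃ b Ψ, IsVacuumWave A k ξ b Ψ := by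
  set w : Fin N → Fin (M - N + 1) → ℝ := fun r =>
    sheetWeight hNM A r.rev (chainNodes hNM A ξ r.val) with hw
  set y : Fin N → Fin (M - N + 1) → Fin M → ℝ := fun r =>
    sheetNodes hNM r.rev (chainNodes hNM A ξ r.val) with hy
  have hpoles := fun r => exists_poles hξ (w r) (h r).1 (h r).2.1
  choose b hb hbpoly using hpoles
  set p : Fin N → Fin M → ℝ[X] := fun r j => ∑ l, C (w r l * y r l j) * nodeProd ξ l with hp
  have hpdeg : ∀ r j, (p r j).natDegree ≤ M - N := fun r j =>
    natDegree_sum_nodeProd_le ξ fun l => w r l * y r l j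
  have hsumdeg : ∀ r t, (∑ j, C (Real.exp (theta (k j) t)) * p r j).natDegree ≤ M - N :=
    fun r t => natDegree_sum_le_of_forall_le _ _ fun j _ =>
      (natDegree_C_mul_le _ _).trans (hpdeg r j)
  have hnum : ∀ r t (z : ℂ), ∑ j, aeval z (p r j) * ((Real.exp (theta (k j) t) : ℝ) : ℂ) =
      aeval z (∑ j, C (Real.exp (theta (k j) t)) * p r j) := fun r t z => by
    rw [map_sum]
    refine Finset.sum_congr rfl fun j _ => ?_
    simp [mul_comm]
  -- the values at the nodes and at the following marked points
  have hnode : ∀ (r : Fin N) (l : Fin (M - N + 1)) t,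
      waveFunction k b p r.succ (lam ξ (l.val + 1) : ℝ) t =
        ((∑ j, y r l j * Real.exp (theta (k j) t) : ℝ) : ℂ) := by
    intro r l t
    rw [waveFunction_real]
    congr 1
    refine Finset.sum_congr rfl fun j _ => ?_
    have h1 : (p r j).eval (lam ξ (l.val + 1)) =
        w r l * y r l j * (nodeProd ξ l).eval (lam ξ (l.val + 1)) :=
      eval_sum_nodeProd ξ (fun l => w r l * y r l j) l
    rw [h1, hbpoly, eval_sum_nodeProd]
    have h2 : w r l ≠ 0 := ((h r).1 l).ne'
    have h3 := eval_nodeProd_self_ne_zero hξ l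
    congr 1
    field_simp
  have hnext : ∀ (r : Fin N) (m : Fin (M - N)) t,
      waveFunction k b p r.succ (alp ξ (m.val + 2) : ℝ) t =
        ((∑ j, nextNodes ξ (w r) (y r) m j * Real.exp (theta (k j) t) : ℝ) : ℂ) := by
    intro r m t
    rw [waveFunction_real]
    congr 1
    refine Finset.sum_congr rfl fun j _ => ?_
    rw [hbpoly, nextNodes]
    congr 1
    refine eval_sum_nodeProd_div (w r) (fun l => y r l j) fun l => ?_
    have := alp_pos hξ (show 2 ≤ m.val + 2 by omega)
    have := lam_nonpos hξ (l.val + 1)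
    linarith
  have hsingle : ∀ (j : Fin M) t, waveFunction k b p 0 (k j : ℝ) t =
      ((∑ q, (Pi.single j 1 : Fin M → ℝ) q * Real.exp (theta (k q) t) : ℝ) : ℂ) := by
    intro j t
    simp [waveFunction, theta_ofReal, Pi.single_apply]
  refine ⟨b, waveFunction k b p, fun z t => rfl, hb, fun r t => ⟨_, hsumdeg r t, fun z _ => ?_⟩,
    fun r => ?_, ?_⟩
  · rw [← hnum]
    rfl
  · obtain ⟨ε, hε, hval⟩ := (h r).2.2
    refine ⟨ε, hε, fun t => ?_⟩
    have h1 := tendsto_aeval_div (b r) _ (hsumdeg r t)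
    have h2 : (∑ j, C (Real.exp (theta (k j) t)) * p r j).coeff (M - N) =
        (heat A k r.rev t + ∑ i ∈ Finset.Ioi r.rev, ε i * heat A k i t) /
          (1 + ∑ i ∈ Finset.Ioi r.rev, ε i) := by
      rw [finsetSum_coeff]
      have h3 : ∀ j, (C (Real.exp (theta (k j) t)) * p r j).coeff (M - N) =
          Real.exp (theta (k j) t) * ((A r.rev j + ∑ i' ∈ Finset.Ioi r.rev, ε i' * A i' j) /
            (1 + ∑ i' ∈ Finset.Ioi r.rev, ε i')) := fun j => by
        rw [coeff_C_mul, ← hval j]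
        congr 1
        exact coeff_sum_nodeProd ξ fun l => w r l * y r l j
      simp only [h3, heat, Finset.mul_sum]
      rw [Finset.sum_comm, ← Finset.sum_add_distrib, Finset.sum_div]
      refine Finset.sum_congr rfl fun j _ => ?_
      rw [← mul_div_assoc, mul_add, Finset.mul_sum]
      congr 2
      · ring
      · exact Finset.sum_congr rfl fun i _ => by ring
    rw [h2] at h1
    refine h1.congr fun z => ?_
    rw [← hnum]
    rfl
  · intro P Q hPQ t
    cases hPQ with
    | first r j hr hj =>
      obtain ⟨r, rfl⟩ := Fin.exists_succ_eq.2 (show r ≠ 0 by rintro rfl; simp at hr)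
      have h1 := hnode r 0 t
      simp only [Fin.val_zero, zero_add] at h1
      simp only
      rw [h1, hsingle]
      have h2 : (⟨r.rev.val, r.rev.2.trans hNM⟩ : Fin M) = j := by
        apply Fin.ext
        rw [Fin.val_succ] at hj
        simp only [Fin.val_rev]
        omega
      simp only [hy, sheetNodes, Fin.cons_zero, h2]
    | one r l j hr hl hj =>
      obtain ⟨r, rfl⟩ := Fin.exists_succ_eq.2 (show r ≠ 0 by rintro rfl; simp at hr)
      have hjM := j.2
      have h1 := hnode r (Fin.succ ⟨l - 2, by omega⟩) t
      simp only [Fin.val_succ, show l - 2 + 1 + 1 = l by omega] at h1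
      simp only
      rw [h1, hsingle]
      have h2 : (⟨N + (l - 2), by omega⟩ : Fin M) = j := Fin.ext (by simp only; omega)
      have h3 : r.val = 0 := by simpa using hr
      simp only [hy, sheetNodes, Fin.cons_succ, h3, chainNodes, h2]
    | step r s l hs hr hl hl' =>
      obtain ⟨r, rfl⟩ := Fin.exists_succ_eq.2 (show r ≠ 0 by rintro rfl; simp at hr)
      obtain ⟨s, rfl⟩ := Fin.exists_succ_eq.2 (show s ≠ 0 by rintro rfl; simp at hs)
      have h1 := hnode r (Fin.succ ⟨l - 2, by omega⟩) t
      have h2 := hnext s ⟨l - 2, by omega⟩ t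
      simp only [Fin.val_succ, show l - 2 + 1 + 1 = l by omega] at h1 h2
      have h3 : r.val = s.val + 1 := by simpa using hr
      have h4 : y r (Fin.succ ⟨l - 2, by omega⟩) =
          nextNodes ξ (w s) (y s) ⟨l - 2, by omega⟩ := by
        change chainNodes hNM A ξ r.val _ = _
        rw [h3, chainNodes_succ]
      simp only
      rw [h1, h2, h4]

end KPSoliton

end

theorem mainTheorem2 {N M : ℕ} (hN : 0 < N) (hNM : N < M)
    (A : Matrix (Fin N) (Fin M) ℝ) (hA : KPSoliton.IsNormalizedBanded A) :
    ∃ ξ₀ : ℝ, 1 < ξ₀ ∧ ∀ ξ : ℝ, ξ₀ < ξ → ∀ k : Fin M → ℝ, StrictMono k →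
      (∃ b Ψ, KPSoliton.IsVacuumWave A k ξ b Ψ) ∧
      ∀ b Ψ, KPSoliton.IsVacuumWave A k ξ b Ψ →
        (∀ i t, KPSoliton.darboux A k (fun s => (KPSoliton.heat A k i s : ℂ)) t = 0) ∧
        ∃ D : KPSoliton.Times → Fin (N + 1) → Multiset ℂ,
          KPSoliton.IsDivisor A k b Ψ D ∧
          KPSoliton.HasZerosPoles A k b Ψ D (D KPSoliton.zeroTimes) ∧
          (∀ t, (D t 0).card = N ∧
            (∀ r : Fin N, (D t r.succ).card = M - N - 1) ∧
            (∀ r, (D t r).Nodup) ∧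
            KPSoliton.IsDubrovinNatanzon k ξ (D t)) ∧
          KPSoliton.IsDubrovinNatanzon k ξ (D KPSoliton.zeroTimes) := by
  obtain ⟨ξ₁, hξ₁⟩ := Filter.eventually_atTop.1 (KPSoliton.eventually_sheetWeight hNM hA)
  refine ⟨max ξ₁ 2, lt_max_of_lt_right one_lt_two, fun ξ hξ k hk => ?_⟩
  have h1 : 1 < ξ := one_lt_two.trans ((le_max_right _ _).trans_lt hξ)
  refine ⟨KPSoliton.exists_vacuumWave hNM h1 k (hξ₁ ξ ((le_max_left _ _).trans hξ.le)),
    fun b Ψ h => ⟨KPSoliton.darboux_heat hNM hA hk, ?_⟩⟩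
  obtain ⟨D, hD, hZ, hDN⟩ := h.exists_divisor hNM hA h1 hk
  exact ⟨D, hD, hZ, hDN, (hDN KPSoliton.zeroTimes).2.2.2⟩
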